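/- Let $V=\mathbb C v$ and, for $n\ge 0$, let $A_n=\mathrm{Sym}^*(V^\vee)^{\otimes n}\rtimes S_n=\mathbb C[x_1,\dots,x_n]\rtimes S_n$, graded by $\deg x_i=1$ and $\deg\sigma=0$ for $\sigma\in S_n$. Let $D(A_n\text{-gmod})$ be the bounded derived category of finite-dimensional graded left $A_n$-modules, that is, the full subcategory of the derived category of all graded left $A_n$-modules whose objects are represented by bounded complexes of finite-dimensional ones. A representation of $S_n$ is regarded as an object of $D(A_n\text{-gmod})$, in internal and cohomological degree $0$, with all $x_i$ acting by $0$. Let $P(n)=A_{n+1}\otimes_{A_n\otimes A_1}(A_n\otimes\mathbb C)$, where $\mathbb C=A_1/(x_1)$, and let $\mathfrak P=\mathfrak P(n)=P(n)\otimes_{A_n}(-):D(A_n\text{-gmod})\to D(A_{n+1}\text{-gmod})$. Let $T:\mathfrak P\mathfrak P\to\mathfrak P\mathfrak P$ be the natural transformation induced by the endomorphism $1\otimes(1\otimes1\otimes1)\mapsto s_{n+1}\otimes(1\otimes1\otimes1)$ of the bimodule $P(n+1)\otimes_{A_{n+1}}P(n)\cong A_{n+2}\otimes_{A_n\otimes A_1\otimes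 A_1}(A_n\otimes\mathbb C\otimes\mathbb C)$, where $s_{n+1}$ is the transposition of $n+1$ and $n+2$. The transformations $T$ applied to adjacent factors define an action of $S_m$ on $\mathfrak P^m:D(A_d\text{-gmod})\to D(A_{d+m}\text{-gmod})$; put $e_{(m)}=\frac1{m!}\sum_{\sigma\in S_m}\sigma$, which is an idempotent endomorphism of $\mathfrak P^m$. Under the Fock functor $j$, the $1$-morphism $P_m$ of the Heisenberg $2$-category has the image $\mathfrak P_m=j(P_m)=(\mathfrak P^m,e_{(m)})$, an object of the Karoubi envelope of the category of functors $D(A_d\text{-gmod})\to D(A_{d+m}\text{-gmod})$; so, for an object $M$, $\mathfrak P_mM=(\mathfrak P^mM,(e_{(m)})_M)$ is an object of the Karoubi envelope of $D(A_{d+m}\text{-gmod})$. Let $\widetilde\Gamma_-(z)=\sum_{n\ge0}P_nz^n$, with $z$ an indeterminate. For a partition $\lambda$ of $d=|\lambda|$, let $V_\lambda=\mathbb C[S_d]\,a_\lambda b_\lambda$ be the associated irreducible representation of $S_d$, where, for a numbering by $1,\dots,d$ of the boxes of the Young diagram of $\lambda$, $a_\lambda$ is the sum of the permutations preserving the rows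 and $b_\lambda$ is the sum of the permutations preserving the columns, weighted by their signs. For partitions $\mu,\lambda$ write $\mu\succ\lambda$ if they interlace: $\mu_1\ge\lambda_1\ge\mu_2\ge\lambda_2\ge\cdots$. **Proposition.** For every partition $\lambda$, $$ j\bigl(\widetilde\Gamma_-(z)\bigr)V_\lambda=\sum_{n\ge0}\mathfrak P_nV_\lambda\,z^n\;\cong\;\sum_{n\ge0}\Bigl(\bigoplus_{\mu\succ\lambda,\ |\mu|=|\lambda|+n}V_\mu\Bigr)z^n . $$ That is, for every $n\ge0$ the coefficients of $z^n$ are isomorphic, in the Karoubi envelope of $D(A_{|\lambda|+n}\text{-gmod})$. This holds for any choice of the numberings used to define $V_\lambda$ and the $V_\mu$. -/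

import Mathlib

open CategoryTheory CategoryTheory.Limits
open scoped TensorProduct

noncomputable section

namespace Fock

/-! ### The algebras `A n` -/

/-- The monoid `ℕⁿ ⋊ Sₙ`: the pair `⟨m, σ⟩` stands for the element `x₁^m₁ ⋯ xₙ^mₙ σ`. -/
@[ext] structure Wr (n : ℕ) where
  m : Fin n → ℕ
  σ : Equiv.Perm (Fin n)

namespace Wr

variable {n : ℕ}

/-- The multiplication is determined by `σ xᵢ σ⁻¹ = x_{σ i}`. -/
instance : Mul (Wr n) := ⟨fun v w => ⟨fun i => v.m i + w.m (v.σ⁻¹ i), v.σ * w.σ⟩⟩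

instance : One (Wr n) := ⟨⟨fun _ => 0, 1⟩⟩

@[simp] lemma mul_m (v w : Wr n) (i : Fin n) : (v * w).m i = v.m i + w.m (v.σ⁻¹ i) := rfl
@[simp] lemma mul_σ (v w : Wr n) : (v * w).σ = v.σ * w.σ := rfl
@[simp] lemma one_m (i : Fin n) : (1 : Wr n).m i = 0 := rfl
@[simp] lemma one_σ : (1 : Wr n).σ = 1 := rfl

instance : Monoid (Wr n) where
  mul_assoc a b c := by
    ext i
    · simp [add_assoc]
    · simp [mul_assoc]
  one_mul a := by ext i <;> simp
  mul_one a := by ext i <;> simp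

/-- The total degree in the variables. -/
def deg (w : Wr n) : ℤ := ∑ i, (w.m i : ℤ)

lemma deg_mul (v w : Wr n) : (v * w).deg = v.deg + w.deg := by
  simp only [deg, mul_m, Nat.cast_add, Finset.sum_add_distrib]
  congr 1
  exact Equiv.sum_comp v.σ⁻¹ (fun i => (w.m i : ℤ))

/-- The element `σ` of `ℕⁿ ⋊ Sₙ`. -/
def perm : Equiv.Perm (Fin n) →* Wr n where
  toFun σ := ⟨fun _ => 0, σ⟩
  map_one' := rfl
  map_mul' a b := by ext i <;> simp

end Wr

/-- The embedding `S_a × S_b ⊆ S_{a+b}`. -/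
def blockPerm (a b : ℕ) (σ : Equiv.Perm (Fin a)) (τ : Equiv.Perm (Fin b)) :
    Equiv.Perm (Fin (a + b)) :=
  finSumFinEquiv.permCongr (Equiv.sumCongr σ τ)

@[simp] lemma blockPerm_castAdd {a b : ℕ} (σ : Equiv.Perm (Fin a)) (τ : Equiv.Perm (Fin b))
    (i : Fin a) : blockPerm a b σ τ (Fin.castAdd b i) = Fin.castAdd b (σ i) := by
  simp [blockPerm, Equiv.permCongr_apply]

@[simp] lemma blockPerm_natAdd {a b : ℕ} (σ : Equiv.Perm (Fin a)) (τ : Equiv.Perm (Fin b))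
    (i : Fin b) : blockPerm a b σ τ (Fin.natAdd a i) = Fin.natAdd a (τ i) := by
  simp [blockPerm, Equiv.permCongr_apply]

lemma blockPerm_mul {a b : ℕ} (σ σ' : Equiv.Perm (Fin a)) (τ τ' : Equiv.Perm (Fin b)) :
    blockPerm a b (σ * σ') (τ * τ') = blockPerm a b σ τ * blockPerm a b σ' τ' := by
  ext i
  refine Fin.addCases (fun i => ?_) (fun i => ?_) i <;> simp

@[simp] lemma blockPerm_one (a b : ℕ) : blockPerm a b 1 1 = 1 := by
  ext i
  refine Fin.addCases (fun i => ?_) (fun i => ?_) i <;> simp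

lemma blockPerm_inv {a b : ℕ} (σ : Equiv.Perm (Fin a)) (τ : Equiv.Perm (Fin b)) :
    (blockPerm a b σ τ)⁻¹ = blockPerm a b σ⁻¹ τ⁻¹ := by
  rw [inv_eq_iff_mul_eq_one, ← blockPerm_mul]; simp

/-- The embedding `(ℕᵃ ⋊ S_a) × (ℕᵇ ⋊ S_b) → ℕᵃ⁺ᵇ ⋊ S_{a+b}`. -/
def block (a b : ℕ) : Wr a × Wr b →* Wr (a + b) where
  toFun p := ⟨Fin.append p.1.m p.2.m, blockPerm a b p.1.σ p.2.σ⟩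
  map_one' := by
    ext i
    · refine Fin.addCases (fun i => ?_) (fun i => ?_) i <;> simp
    · simp
  map_mul' p q := by
    ext i
    · refine Fin.addCases (fun i => ?_) (fun i => ?_) i <;> simp [blockPerm_inv]
    · simp [blockPerm_mul]

lemma deg_block {a b : ℕ} (p : Wr a × Wr b) : (block a b p).deg = p.1.deg + p.2.deg := by
  simp [Wr.deg, block, Fin.sum_univ_add]

/-- The algebra `A_n = Sym(V^∨)^{⊗ n} ⋊ S_n = ℂ[x₁, …, xₙ] ⋊ S_n`, with basis the `x^m σ`. -/
abbrev A (n : ℕ) : Type := MonoidAlgebra ℂ (Wr n)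

/-- The grading of `A_n`: the `xᵢ` have degree `1` and the permutations have degree `0`. -/
def gradA (n : ℕ) (i : ℤ) : Submodule ℂ (A n) :=
  Submodule.span ℂ ((fun w : Wr n => MonoidAlgebra.of ℂ (Wr n) w) '' {w | w.deg = i})

lemma of_mem_gradA {n : ℕ} (w : Wr n) : MonoidAlgebra.of ℂ (Wr n) w ∈ gradA n w.deg :=
  Submodule.subset_span ⟨w, rfl, rfl⟩

lemma gradA_mul {n : ℕ} {i j : ℤ} {a b : A n} (ha : a ∈ gradA n i) (hb : b ∈ gradA n j) :
    a * b ∈ gradA n (i + j) := by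
  induction ha using Submodule.span_induction with
  | mem x hx =>
    obtain ⟨v, hv, rfl⟩ := hx
    induction hb using Submodule.span_induction with
    | mem y hy =>
      obtain ⟨w, hw, rfl⟩ := hy
      simp only [Set.mem_ofPred_eq] at hv hw
      rw [← map_mul, ← hv, ← hw, ← Wr.deg_mul]
      exact of_mem_gradA _
    | zero => simp
    | add x y _ _ hx hy => rw [mul_add]; exact add_mem hx hy
    | smul c x _ hx => rw [mul_smul_comm]; exact Submodule.smul_mem _ _ hx
  | zero => simp
  | add x y _ _ hx hy => rw [add_mul]; exact add_mem hx hy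
  | smul c x _ hx => rw [smul_mul_assoc]; exact Submodule.smul_mem _ _ hx

lemma gradA_one (n : ℕ) : (1 : A n) ∈ gradA n 0 := by
  have := of_mem_gradA (1 : Wr n)
  rw [map_one] at this
  simpa [Wr.deg] using this

/-- Induction on elements of `A n`. -/
lemma A_induction {n : ℕ} {p : A n → Prop} (a : A n) (of : ∀ w, p (MonoidAlgebra.of ℂ _ w))
    (add : ∀ x y, p x → p y → p (x + y)) (smul : ∀ (c : ℂ) x, p x → p (c • x)) : p a :=
  MonoidAlgebra.induction_on a of add smul

/-- The inclusion of `A_n` in `A_{n+1}`, on the first `n` factors. -/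
def inclL (n : ℕ) : A n →ₐ[ℂ] A (n + 1) :=
  MonoidAlgebra.mapDomainAlgHom ℂ ℂ ((block n 1).comp (MonoidHom.inl (Wr n) (Wr 1)))

/-- The inclusion of `A_1` in `A_{n+1}`, on the last factor. -/
def inclR (n : ℕ) : A 1 →ₐ[ℂ] A (n + 1) :=
  MonoidAlgebra.mapDomainAlgHom ℂ ℂ ((block n 1).comp (MonoidHom.inr (Wr n) (Wr 1)))

lemma inclL_of {n : ℕ} (v : Wr n) :
    inclL n (MonoidAlgebra.of ℂ _ v) = MonoidAlgebra.of ℂ _ (block n 1 (v, 1)) :=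
  MonoidAlgebra.mapDomain_single

lemma inclR_of {n : ℕ} (v : Wr 1) :
    inclR n (MonoidAlgebra.of ℂ _ v) = MonoidAlgebra.of ℂ _ (block n 1 (1, v)) :=
  MonoidAlgebra.mapDomain_single

lemma incl_commute {n : ℕ} (x : A n) (y : A 1) : Commute (inclL n x) (inclR n y) := by
  induction x using A_induction with
  | of v =>
    induction y using A_induction with
    | of w =>
      rw [inclL_of, inclR_of]
      simp only [Commute, SemiconjBy, ← map_mul]
      simp
    | add x y hx hy => rw [map_add]; exact hx.add_right hy
    | smul c x hx => rw [map_smul]; exact hx.smul_right c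
  | add x y hx hy => rw [map_add]; exact hx.add_left hy
  | smul c x hx => rw [map_smul]; exact hx.smul_left c

/-- The inclusion `A_n ⊗ A_1 → A_{n+1}`. -/
def incl (n : ℕ) : A n ⊗[ℂ] A 1 →ₐ[ℂ] A (n + 1) :=
  Algebra.TensorProduct.lift (inclL n) (inclR n) incl_commute

/-- The projection `A_1 = Sym(V^∨) → ℂ` with kernel `Sym^{>0}(V^∨)`. -/
def proj1 : A 1 →ₐ[ℂ] ℂ :=
  MonoidAlgebra.lift ℂ ℂ (Wr 1)
    { toFun := fun w => if w.m 0 = 0 then 1 else 0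
      map_one' := by simp
      map_mul' := fun v w => by
        have : v.σ⁻¹ 0 = 0 := Subsingleton.elim _ _
        by_cases h1 : v.m 0 = 0 <;> by_cases h2 : w.m 0 = 0 <;> simp [h1, h2, this] }

/-- The homomorphism `id ⊗ proj1 : A_n ⊗ A_1 → A_n ⊗ ℂ = A_n`, through which `A_n ⊗ A_1` acts on
`A_n ⊗ ℂ`. -/
def projA (n : ℕ) : A n ⊗[ℂ] A 1 →ₐ[ℂ] A n :=
  Algebra.TensorProduct.lift (AlgHom.id ℂ (A n)) ((Algebra.ofId ℂ (A n)).comp proj1)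
    (fun x y => by
      rw [AlgHom.comp_apply, Algebra.ofId_apply]
      exact Algebra.commute_algebraMap_right _ _)

/-! ### Gradings -/

section Grading

variable {M : Type} [AddCommGroup M] (ℳ : ℤ → AddSubgroup M)

/-- The homogeneous component of degree `i`. -/
def comp (h : DirectSum.IsInternal ℳ) (i : ℤ) : M →+ M :=
  letI := h.chooseDecomposition
  ((ℳ i).subtype.comp (DFinsupp.evalAddMonoidHom i)).comp
    (DirectSum.decomposeAddEquiv ℳ).toAddMonoidHom

variable {ℳ}

lemma comp_mem (h : DirectSum.IsInternal ℳ) (i : ℤ) (x : M) : comp ℳ h i x ∈ ℳ i := by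
  let := h.chooseDecomposition
  exact (DirectSum.decompose ℳ x i).2

lemma comp_same (h : DirectSum.IsInternal ℳ) {i : ℤ} {x : M} (hx : x ∈ ℳ i) :
    comp ℳ h i x = x := by
  let := h.chooseDecomposition
  exact DirectSum.decompose_of_mem_same ℳ hx

lemma comp_ne (h : DirectSum.IsInternal ℳ) {i j : ℤ} {x : M} (hx : x ∈ ℳ i) (hij : i ≠ j) :
    comp ℳ h j x = 0 := by
  let := h.chooseDecomposition
  exact DirectSum.decompose_of_mem_ne ℳ hx hij

lemma iSup_eq_top (h : DirectSum.IsInternal ℳ) : iSup ℳ = ⊤ := by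
  have := h.2
  rw [eq_top_iff]
  intro x _
  obtain ⟨y, rfl⟩ := this x
  induction y using DirectSum.induction_on with
  | zero => simp
  | of i y =>
    rw [DirectSum.coeAddMonoidHom_of]
    exact AddSubgroup.mem_iSup_of_mem i y.2
  | add x y hx hy => rw [map_add]; exact add_mem (hx trivial) (hy trivial)

/-- Induction on a sum of homogeneous elements. -/
lemma hom_induction (h : iSup ℳ = ⊤) {p : M → Prop} (x : M)
    (mem : ∀ i, ∀ x ∈ ℳ i, p x) (add : ∀ x y, p x → p y → p (x + y)) : p x := by
  have hx : x ∈ iSup ℳ := h ▸ AddSubgroup.mem_top x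
  exact AddSubgroup.iSup_induction ℳ (C := p) hx mem (mem 0 0 (zero_mem _)) add

lemma isInternal_of_comp (π : ℤ → M →+ M) (same : ∀ i, ∀ x ∈ ℳ i, π i x = x)
    (ne : ∀ i j, ∀ x ∈ ℳ i, i ≠ j → π j x = 0) (top : iSup ℳ = ⊤) :
    DirectSum.IsInternal ℳ := by
  classical
  refine ⟨?_, ?_⟩
  · rw [injective_iff_map_eq_zero]
    intro y hy
    have key : ∀ (z : DirectSum ℤ fun i => ℳ i) (j : ℤ),
        π j (DirectSum.coeAddMonoidHom ℳ z) = z j := by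
      intro z j
      induction z using DirectSum.induction_on with
      | zero => simp
      | of i z =>
        rw [DirectSum.coeAddMonoidHom_of]
        by_cases hij : i = j
        · subst hij
          rw [same i _ z.2, DirectSum.of_eq_same]
        · rw [ne i j _ z.2 hij, DirectSum.of_eq_of_ne _ _ _ (Ne.symm hij)]
          rfl
      | add x y hx hy => rw [map_add, map_add, hx, hy]; rfl
    ext j
    rw [← key, hy, map_zero]
    rfl
  · intro x
    refine hom_induction top (p := fun x => ∃ a, DirectSum.coeAddMonoidHom ℳ a = x) x ?_ ?_
    · intro i x hx
      exact ⟨DirectSum.of (fun i => ℳ i) i ⟨x, hx⟩, by rw [DirectSum.coeAddMonoidHom_of]⟩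
    · rintro _ _ ⟨x, rfl⟩ ⟨y, rfl⟩
      exact ⟨x + y, map_add _ _ _⟩

lemma comp_map {N : Type} [AddCommGroup N] {𝒩 : ℤ → AddSubgroup N}
    (hM : DirectSum.IsInternal ℳ) (hN : DirectSum.IsInternal 𝒩) (f : M →+ N)
    (hf : ∀ i, ∀ x ∈ ℳ i, f x ∈ 𝒩 i) (i : ℤ) (x : M) :
    f (comp ℳ hM i x) = comp 𝒩 hN i (f x) := by
  refine hom_induction (iSup_eq_top hM)
    (p := fun x => f (comp ℳ hM i x) = comp 𝒩 hN i (f x)) x ?_ ?_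
  · intro j x hx
    by_cases hij : j = i
    · subst hij
      rw [comp_same hM hx, comp_same hN (hf _ _ hx)]
    · rw [comp_ne hM hx hij, comp_ne hN (hf _ _ hx) hij, map_zero]
  · intro x y hx hy
    simp only [map_add, hx, hy]

end Grading

/-! ### Graded modules -/

/-- A `ℤ`-graded left `A_n`-module. -/
structure GrMod (n : ℕ) where
  carrier : Type
  [grp : AddCommGroup carrier]
  [mod : Module (A n) carrier]
  deg : ℤ → AddSubgroup carrier
  isInternal : DirectSum.IsInternal deg
  smul_mem : ∀ {i j : ℤ} {a : A n} {x : carrier}, a ∈ gradA n i → x ∈ deg j → a • x ∈ deg (i + j)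

namespace GrMod

variable {n : ℕ}

instance : CoeSort (GrMod n) Type := ⟨carrier⟩

attribute [instance] grp mod

/-- The morphisms of graded modules are the `A_n`-linear maps of degree `0`. -/
@[ext] structure Hom (M N : GrMod n) where
  lin : M →ₗ[A n] N
  mem : ∀ (i : ℤ) (x : M), x ∈ M.deg i → lin x ∈ N.deg i

instance : Category (GrMod n) where
  Hom := Hom
  id M := ⟨LinearMap.id, fun _ _ h => h⟩
  comp f g := ⟨g.lin ∘ₗ f.lin, fun i x h => g.mem i _ (f.mem i x h)⟩

variable {M N L : GrMod n}

@[ext] lemma hom_ext {f g : M ⟶ N} (h : ∀ x, f.lin x = g.lin x) : f = g :=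
  Hom.ext (LinearMap.ext h)

@[simp] lemma id_lin (x : M) : Hom.lin (𝟙 M) x = x := rfl
@[simp] lemma comp_lin (f : M ⟶ N) (g : N ⟶ L) (x : M) : (f ≫ g).lin x = g.lin (f.lin x) := rfl

lemma hom_comp (f : M ⟶ N) (i : ℤ) (x : M) :
    f.lin (comp M.deg M.isInternal i x) = comp N.deg N.isInternal i (f.lin x) :=
  comp_map M.isInternal N.isInternal f.lin.toAddMonoidHom f.mem i x

instance : Zero (M ⟶ N) := ⟨⟨0, fun _ _ _ => zero_mem _⟩⟩
instance : Add (M ⟶ N) := ⟨fun f g => ⟨f.lin + g.lin, fun i x h => add_mem (f.mem i x h) (g.mem i x h)⟩⟩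
instance : Neg (M ⟶ N) := ⟨fun f => ⟨-f.lin, fun i x h => neg_mem (f.mem i x h)⟩⟩

@[simp] lemma zero_lin (x : M) : Hom.lin (0 : M ⟶ N) x = 0 := rfl
@[simp] lemma add_lin (f g : M ⟶ N) (x : M) : (f + g).lin x = f.lin x + g.lin x := rfl
@[simp] lemma neg_lin (f : M ⟶ N) (x : M) : (-f).lin x = -f.lin x := rfl

instance : AddCommGroup (M ⟶ N) where
  add_assoc f g h := by ext; simp [add_assoc]
  zero_add f := by ext; simp
  add_zero f := by ext; simp
  add_comm f g := by ext; simp [add_comm]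
  neg_add_cancel f := by ext; simp
  nsmul := nsmulRec
  zsmul := zsmulRec

instance : Preadditive (GrMod n) where
  add_comp _ _ _ f g h := by ext; simp
  comp_add _ _ _ f g h := by ext; simp

lemma algebraMap_smul_mem (c : ℂ) {i : ℤ} {x : M} (hx : x ∈ M.deg i) :
    algebraMap ℂ (A n) c • x ∈ M.deg i := by
  have h : algebraMap ℂ (A n) c ∈ gradA n 0 := by
    rw [Algebra.algebraMap_eq_smul_one]
    exact Submodule.smul_mem _ _ (gradA_one n)
  simpa using M.smul_mem h hx

instance : SMul ℂ (M ⟶ N) :=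
  ⟨fun c f => ⟨{ toFun := fun x => algebraMap ℂ (A n) c • f.lin x
                 map_add' := fun x y => by simp
                 map_smul' := fun a x => by
                   simp only [map_smul, RingHom.id_apply, ← mul_smul, Algebra.commutes] },
    fun _ _ h => algebraMap_smul_mem c (f.mem _ _ h)⟩⟩

@[simp] lemma smul_lin (c : ℂ) (f : M ⟶ N) (x : M) :
    (c • f).lin x = algebraMap ℂ (A n) c • f.lin x := rfl

instance : Module ℂ (M ⟶ N) where
  one_smul f := by ext; rw [smul_lin, map_one, one_smul]
  mul_smul a b f := by ext; rw [smul_lin, smul_lin, smul_lin, map_mul, mul_smul]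
  smul_zero a := by ext; simp
  smul_add a f g := by ext; simp
  add_smul a b f := by ext; rw [smul_lin, map_add, add_smul]; rfl
  zero_smul f := by ext; rw [smul_lin, map_zero, zero_smul]; rfl

instance : Linear ℂ (GrMod n) where
  smul_comp _ _ _ c f g := by ext; simp
  comp_smul _ _ _ f c g := by ext; simp

/-! ### The category of graded modules is abelian -/

/-- The kernel of a morphism. -/
def ker (f : M ⟶ N) : GrMod n where
  carrier := LinearMap.ker f.lin
  deg i := (M.deg i).comap (LinearMap.ker f.lin).subtype.toAddMonoidHom
  isInternal := by
    have hk : ∀ i (x : M), x ∈ LinearMap.ker f.lin →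
        comp M.deg M.isInternal i x ∈ LinearMap.ker f.lin := by
      intro i x hx
      rw [LinearMap.mem_ker] at hx ⊢
      rw [hom_comp, hx, map_zero]
    refine isInternal_of_comp (fun i => AddMonoidHom.mk' (fun x =>
      (⟨comp M.deg M.isInternal i x, hk i x x.2⟩ : LinearMap.ker f.lin))
      (fun x y => Subtype.ext (by simp))) ?_ ?_ ?_
    · intro i x hx
      exact Subtype.ext (comp_same M.isInternal hx)
    · intro i j x hx hij
      exact Subtype.ext (comp_ne M.isInternal hx hij)
    · rw [eq_top_iff]
      rintro x -
      classical
      let := M.isInternal.chooseDecomposition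
      have : x = ∑ i ∈ (DirectSum.decompose M.deg (x : M)).support,
          (⟨comp M.deg M.isInternal i x, hk i x x.2⟩ : LinearMap.ker f.lin) := by
        apply Subtype.ext
        rw [AddSubmonoidClass.coe_finsetSum]
        exact (DirectSum.sum_support_decompose M.deg (x : M)).symm
      rw [this]
      exact sum_mem fun i _ => AddSubgroup.mem_iSup_of_mem i (comp_mem M.isInternal i x)
  smul_mem ha hx := M.smul_mem ha hx

/-- The inclusion of the kernel. -/
def kerι (f : M ⟶ N) : ker f ⟶ M := ⟨(LinearMap.ker f.lin).subtype, fun _ _ h => h⟩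

/-- The cokernel of a morphism. -/
def coker (f : M ⟶ N) : GrMod n where
  carrier := N ⧸ LinearMap.range f.lin
  deg i := (N.deg i).map (LinearMap.range f.lin).mkQ.toAddMonoidHom
  isInternal := by
    refine isInternal_of_comp (fun i => QuotientAddGroup.lift (LinearMap.range f.lin).toAddSubgroup
      ((LinearMap.range f.lin).mkQ.toAddMonoidHom.comp (comp N.deg N.isInternal i)) ?_) ?_ ?_ ?_
    · rintro _ ⟨x, rfl⟩
      change (LinearMap.range f.lin).mkQ (comp N.deg N.isInternal i (f.lin x)) = 0
      rw [← hom_comp]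
      simp
    · rintro i _ ⟨x, hx, rfl⟩
      change (LinearMap.range f.lin).mkQ (comp N.deg N.isInternal i x) = _
      rw [comp_same N.isInternal hx]
      rfl
    · rintro i j _ ⟨x, hx, rfl⟩ hij
      change (LinearMap.range f.lin).mkQ (comp N.deg N.isInternal j x) = _
      rw [comp_ne N.isInternal hx hij, map_zero]
    · rw [eq_top_iff]
      rintro x -
      obtain ⟨x, rfl⟩ := (LinearMap.range f.lin).mkQ_surjective x
      refine hom_induction (iSup_eq_top N.isInternal)
        (p := fun x => (LinearMap.range f.lin).mkQ x ∈ iSup _) x ?_ ?_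
      · intro i x hx
        exact AddSubgroup.mem_iSup_of_mem i ⟨x, hx, rfl⟩
      · intro x y hx hy
        rw [map_add]
        exact add_mem hx hy
  smul_mem := by
    rintro i j a _ ha ⟨x, hx, rfl⟩
    exact ⟨a • x, N.smul_mem ha hx, map_smul (LinearMap.range f.lin).mkQ a x⟩

/-- The projection to the cokernel. -/
def cokerπ (f : M ⟶ N) : N ⟶ coker f :=
  ⟨(LinearMap.range f.lin).mkQ, fun _ x h => ⟨x, h, rfl⟩⟩

@[simp] lemma kerι_comp (f : M ⟶ N) : kerι f ≫ f = 0 := by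
  ext x
  exact x.2

@[simp] lemma comp_cokerπ (f : M ⟶ N) : f ≫ cokerπ f = 0 := by
  ext x
  exact (Submodule.Quotient.mk_eq_zero _).2 ⟨x, rfl⟩

/-- The kernel fork. -/
def kerIsLimit (f : M ⟶ N) : IsLimit (KernelFork.ofι (kerι f) (kerι_comp f)) :=
  KernelFork.IsLimit.ofι _ _
    (fun {W} g hg => ⟨g.lin.codRestrict _ (fun x => by
      have := congrArg (fun h : W ⟶ N => h.lin x) hg
      exact this), fun i x h => g.mem i x h⟩)
    (fun g hg => rfl)
    (fun g hg m hm => by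
      ext x
      exact Subtype.ext (congrArg (fun h => Hom.lin h x) hm))

/-- The cokernel cofork. -/
def cokerIsColimit (f : M ⟶ N) : IsColimit (CokernelCofork.ofπ (cokerπ f) (comp_cokerπ f)) :=
  CokernelCofork.IsColimit.ofπ _ _
    (fun {W} g hg => ⟨(LinearMap.range f.lin).liftQ g.lin (by
      rintro _ ⟨x, rfl⟩
      exact congrArg (fun h => Hom.lin h x) hg), by
        rintro i _ ⟨x, hx, rfl⟩
        exact g.mem i x hx⟩)
    (fun g hg => rfl)
    (fun g hg m hm => by
      ext x
      obtain ⟨x, rfl⟩ := (LinearMap.range f.lin).mkQ_surjective x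
      exact congrArg (fun h => Hom.lin h x) hm)

instance : HasKernels (GrMod n) := ⟨fun f => ⟨⟨_, kerIsLimit f⟩⟩⟩
instance : HasCokernels (GrMod n) := ⟨fun f => ⟨⟨_, cokerIsColimit f⟩⟩⟩

lemma injective_of_mono (f : M ⟶ N) [Mono f] : Function.Injective f.lin := by
  rw [injective_iff_map_eq_zero]
  intro x hx
  have h : kerι f = 0 := by
    rw [← cancel_mono f]; simp
  exact congrArg (fun h => Hom.lin h (⟨x, hx⟩ : LinearMap.ker f.lin)) h

lemma surjective_of_epi (f : M ⟶ N) [Epi f] : Function.Surjective f.lin := by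
  intro x
  have h : cokerπ f = 0 := by
    rw [← cancel_epi f]; simp
  have := congrArg (fun h => Hom.lin h x) h
  exact (Submodule.Quotient.mk_eq_zero _).1 this

/-- The zero graded module. -/
def zeroObj (n : ℕ) : GrMod n where
  carrier := PUnit
  deg _ := ⊤
  isInternal := isInternal_of_comp (fun _ => 0) (fun _ _ _ => rfl) (fun _ _ _ _ _ => rfl)
    (by rw [eq_top_iff]; intro x _; exact zero_mem _)
  smul_mem _ _ := trivial

instance : HasZeroObject (GrMod n) :=
  ⟨zeroObj n, by
    rw [IsZero.iff_id_eq_zero]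
    ext x
    rfl⟩

/-- The direct sum of two graded modules. -/
def prod (M N : GrMod n) : GrMod n where
  carrier := M × N
  deg i := (M.deg i).prod (N.deg i)
  isInternal := by
    refine isInternal_of_comp (fun i => (comp M.deg M.isInternal i).prodMap
      (comp N.deg N.isInternal i)) ?_ ?_ ?_
    · rintro i ⟨x, y⟩ ⟨hx, hy⟩
      exact Prod.ext (comp_same M.isInternal hx) (comp_same N.isInternal hy)
    · rintro i j ⟨x, y⟩ ⟨hx, hy⟩ hij
      exact Prod.ext (comp_ne M.isInternal hx hij) (comp_ne N.isInternal hy hij)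
    · rw [eq_top_iff]
      rintro ⟨x, y⟩ -
      rw [← Prod.fst_add_snd (x, y)]
      refine add_mem ?_ ?_
      · refine hom_induction (iSup_eq_top M.isInternal)
          (p := fun x => ((x, 0) : M × N) ∈ iSup _) x ?_ ?_
        · intro i x hx
          exact AddSubgroup.mem_iSup_of_mem i ⟨hx, zero_mem _⟩
        · intro x x' hx hy
          simpa using add_mem hx hy
      · refine hom_induction (iSup_eq_top N.isInternal)
          (p := fun y => ((0, y) : M × N) ∈ iSup _) y ?_ ?_
        · intro i x hx
          exact AddSubgroup.mem_iSup_of_mem i ⟨zero_mem _, hx⟩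
        · intro x x' hx hy
          simpa using add_mem hx hy
  smul_mem ha hx := ⟨M.smul_mem ha hx.1, N.smul_mem ha hx.2⟩

instance : HasBinaryProducts (GrMod n) := by
  refine @hasBinaryProducts_of_hasLimit_pair _ _ (fun {M N} => ⟨⟨⟨BinaryFan.mk (P := prod M N)
    (⟨LinearMap.fst _ _ _, fun _ _ h => h.1⟩ : prod M N ⟶ M)
    (⟨LinearMap.snd _ _ _, fun _ _ h => h.2⟩ : prod M N ⟶ N), ?_⟩⟩⟩)
  refine BinaryFan.IsLimit.mk _ (fun {T} f g => ⟨f.lin.prod g.lin,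
    fun i x h => ⟨f.mem i x h, g.mem i x h⟩⟩) (fun f g => rfl) (fun f g => rfl) ?_
  intro T f g m hf hg
  ext x
  exact Prod.ext (congrArg (fun h => Hom.lin h x) hf) (congrArg (fun h => Hom.lin h x) hg)

instance : HasFiniteProducts (GrMod n) :=
  hasFiniteProducts_of_has_binary_and_terminal

/-- Every monomorphism is the kernel of its cokernel. -/
lemma isNormalMono (f : M ⟶ N) [Mono f] : Nonempty (NormalMono f) := by
  have hinj := injective_of_mono f
  refine ⟨⟨coker f, cokerπ f, comp_cokerπ f, KernelFork.IsLimit.ofι _ _ (fun {W} g hg =>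
    ⟨(LinearEquiv.ofInjective f.lin hinj).symm.toLinearMap ∘ₗ
      g.lin.codRestrict (LinearMap.range f.lin) (fun x =>
        (Submodule.Quotient.mk_eq_zero _).1 (congrArg (fun h => Hom.lin h x) hg)), ?_⟩) ?_ ?_⟩⟩
  · intro i x hx
    have hy := g.mem i x hx
    obtain ⟨y, hy'⟩ := (Submodule.Quotient.mk_eq_zero _).1 (congrArg (fun h => Hom.lin h x) hg)
    have e : ((LinearEquiv.ofInjective f.lin hinj).symm.toLinearMap ∘ₗ
      g.lin.codRestrict (LinearMap.range f.lin) (fun x =>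
        (Submodule.Quotient.mk_eq_zero _).1 (congrArg (fun h => Hom.lin h x) hg))) x = y := by
      apply hinj
      rw [hy', LinearMap.comp_apply]
      exact congrArg Subtype.val ((LinearEquiv.ofInjective f.lin hinj).apply_symm_apply _)
    rw [e]
    have : comp M.deg M.isInternal i y = y := by
      apply hinj
      rw [hom_comp, hy', comp_same N.isInternal hy]
    rw [← this]
    exact comp_mem _ _ _
  · intro W g hg
    ext x
    exact congrArg Subtype.val ((LinearEquiv.ofInjective f.lin hinj).apply_symm_apply _)
  · intro W g hg m hm
    rw [← cancel_mono f, hm]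
    ext x
    exact (congrArg Subtype.val ((LinearEquiv.ofInjective f.lin hinj).apply_symm_apply
      ⟨g.lin x, (Submodule.Quotient.mk_eq_zero _).1 (congrArg (fun h => Hom.lin h x) hg)⟩)).symm

lemma ker_le_ker {f : M ⟶ N} {g : M ⟶ L} (hg : kerι f ≫ g = 0) :
    LinearMap.ker f.lin ≤ LinearMap.ker g.lin := by
  intro x hx
  have := congrArg (fun h => Hom.lin h (⟨x, hx⟩ : LinearMap.ker f.lin)) hg
  exact this

/-- The linear map induced on the target of a surjection. -/
def descLin (f : M ⟶ N) (hsur : Function.Surjective f.lin) (g : M ⟶ L) (hg : kerι f ≫ g = 0) :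
    N →ₗ[A n] L :=
  (LinearMap.ker f.lin).liftQ g.lin (ker_le_ker hg) ∘ₗ
    (f.lin.quotKerEquivOfSurjective hsur).symm.toLinearMap

lemma descLin_apply (f : M ⟶ N) (hsur : Function.Surjective f.lin) (g : M ⟶ L)
    (hg : kerι f ≫ g = 0) (x : M) : descLin f hsur g hg (f.lin x) = g.lin x := by
  rw [descLin, LinearMap.comp_apply, LinearEquiv.coe_coe,
    LinearMap.quotKerEquivOfSurjective_symm_apply]
  rfl

/-- Every epimorphism is the cokernel of its kernel. -/
lemma isNormalEpi (f : M ⟶ N) [Epi f] : Nonempty (NormalEpi f) := by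
  have hsur := surjective_of_epi f
  refine ⟨⟨ker f, kerι f, kerι_comp f, CokernelCofork.IsColimit.ofπ _ _ (fun {W} g hg =>
    ⟨descLin f hsur g hg, ?_⟩) ?_ ?_⟩⟩
  · intro i y hy
    obtain ⟨x, rfl⟩ := hsur y
    rw [← comp_same N.isInternal hy, ← hom_comp, descLin_apply]
    exact g.mem i _ (comp_mem _ _ _)
  · intro W g hg
    ext x
    exact descLin_apply f hsur g hg x
  · intro W g hg m hm
    rw [← cancel_epi f, hm]
    ext x
    exact (descLin_apply f hsur g hg x).symm

instance : Abelian (GrMod n) where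
  normalMonoOfMono f _ := isNormalMono f
  normalEpiOfEpi f _ := isNormalEpi f

lemma exact_iff (S : ShortComplex (GrMod n)) :
    S.Exact ↔ ∀ x, S.g.lin x = 0 → ∃ y, S.f.lin y = x := by
  rw [S.exact_iff_of_forks (kerIsLimit S.g) (cokerIsColimit S.f)]
  constructor
  · intro h x hx
    have := congrArg (fun h => Hom.lin h (⟨x, hx⟩ : LinearMap.ker S.g.lin)) h
    exact (Submodule.Quotient.mk_eq_zero _).1 this
  · intro h
    ext x
    exact (Submodule.Quotient.mk_eq_zero _).2 (h x.1 x.2)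

end GrMod

/-! ### Tensor products over noncommutative rings -/

section Bal

variable {R B N M X : Type} [Ring B] [AddCommGroup N] [Module B N] [AddCommGroup M]
  [AddCommGroup X] (r : R → N →ₗ[B] N) (l : R → M →+ M)

/-- The relations `n a ⊗ m = n ⊗ a m`, where `n a = r a n` and `a m = l a m`. -/
def balRel : Submodule B (N ⊗[ℤ] M) :=
  Submodule.span B {x | ∃ a n m, x = r a n ⊗ₜ m - n ⊗ₜ l a m}

/-- The tensor product `N ⊗_R M` of a bimodule `N`, with left action of `B` and right action `r`
of `R`, and a left `R`-module `M`, with action `l`. It is a left `B`-module. -/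
abbrev Bal : Type := (N ⊗[ℤ] M) ⧸ balRel r l

variable {r l}

/-- The class of `n ⊗ m`. -/
def Bal.tmul (n : N) (m : M) : Bal r l := (balRel r l).mkQ (n ⊗ₜ m)

lemma Bal.smul_tmul (b : B) (n : N) (m : M) :
    b • (Bal.tmul n m : Bal r l) = Bal.tmul (b • n) m := rfl

lemma Bal.add_tmul (n n' : N) (m : M) :
    (Bal.tmul (n + n') m : Bal r l) = Bal.tmul n m + Bal.tmul n' m := by
  simp only [Bal.tmul, TensorProduct.add_tmul, map_add]

lemma Bal.tmul_add (n : N) (m m' : M) :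
    (Bal.tmul n (m + m') : Bal r l) = Bal.tmul n m + Bal.tmul n m' := by
  simp only [Bal.tmul, TensorProduct.tmul_add, map_add]

lemma Bal.rel (a : R) (n : N) (m : M) :
    (Bal.tmul (r a n) m : Bal r l) = Bal.tmul n (l a m) := by
  rw [Bal.tmul, Bal.tmul, ← sub_eq_zero, ← map_sub]
  exact (Submodule.Quotient.mk_eq_zero _).2 (Submodule.subset_span ⟨a, n, m, rfl⟩)

lemma Bal.induction {p : Bal r l → Prop} (x : Bal r l) (tmul : ∀ n m, p (Bal.tmul n m))
    (add : ∀ x y, p x → p y → p (x + y)) : p x := by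
  obtain ⟨x, rfl⟩ := (balRel r l).mkQ_surjective x
  induction x using TensorProduct.induction_on with
  | zero => simpa [Bal.tmul] using tmul 0 0
  | tmul n m => exact tmul n m
  | add x y hx hy => rw [map_add]; exact add _ _ hx hy

lemma balRel_le {x : N ⊗[ℤ] M} (hx : x ∈ balRel r l) :
    x ∈ AddSubgroup.closure {x | ∃ a n m, x = r a n ⊗ₜ[ℤ] m - n ⊗ₜ[ℤ] l a m} := by
  induction hx using Submodule.span_induction with
  | mem x hx => exact AddSubgroup.subset_closure hx
  | zero => exact zero_mem _
  | add x y _ _ hx hy => exact add_mem hx hy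
  | smul c x hx' hx =>
    clear hx'
    induction hx using AddSubgroup.closure_induction with
    | mem x hx =>
      obtain ⟨a, n, m, rfl⟩ := hx
      refine AddSubgroup.subset_closure ⟨a, c • n, m, ?_⟩
      rw [smul_sub, TensorProduct.smul_tmul', TensorProduct.smul_tmul', map_smul]
    | zero => rw [smul_zero]; exact zero_mem _
    | add x y _ _ hx hy => rw [smul_add]; exact add_mem hx hy
    | neg x _ hx => rw [smul_neg]; exact neg_mem hx

/-- The universal property of the tensor product. -/
def Bal.lift (h : N →+ M →+ X) (hh : ∀ a n m, h (r a n) m = h n (l a m)) : Bal r l →+ X :=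
  QuotientAddGroup.lift (balRel r l).toAddSubgroup
    (TensorProduct.liftAddHom h fun c n m => by simp) (by
      intro x hx
      refine (AddSubgroup.closure_le (K := (TensorProduct.liftAddHom h
        fun c n m => by simp).ker)).2 ?_ (balRel_le (show x ∈ balRel r l from hx))
      rintro _ ⟨a, n, m, rfl⟩
      simp [hh])

lemma Bal.lift_tmul (h : N →+ M →+ X) (hh : ∀ a n m, h (r a n) m = h n (l a m)) (n : N) (m : M) :
    Bal.lift h hh (Bal.tmul n m : Bal r l) = h n m := rfl

variable {N' M' : Type} [AddCommGroup N'] [Module B N'] [AddCommGroup M']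
  {r' : R → N' →ₗ[B] N'} {l' : R → M' →+ M'}

/-- The map `f ⊗ g`. -/
def Bal.map (f : N →ₗ[B] N') (g : M →+ M') (hf : ∀ a n, f (r a n) = r' a (f n))
    (hg : ∀ a m, g (l a m) = l' a (g m)) : Bal r l →ₗ[B] Bal r' l' :=
  (balRel r l).mapQ (balRel r' l')
    (TensorProduct.AlgebraTensorModule.map f g.toIntLinearMap) (by
      refine Submodule.span_le.2 ?_
      rintro _ ⟨a, n, m, rfl⟩
      refine Submodule.subset_span ⟨a, f n, g m, ?_⟩
      simp [hf, hg])

lemma Bal.map_tmul (f : N →ₗ[B] N') (g : M →+ M') (hf : ∀ a n, f (r a n) = r' a (f n))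
    (hg : ∀ a m, g (l a m) = l' a (g m)) (n : N) (m : M) :
    Bal.map f g hf hg (Bal.tmul n m : Bal r l) = Bal.tmul (f n) (g m) := rfl

end Bal

/-! ### The functors `𝔓(n)` -/

/-- The right action of `A_n ⊗ A_1` on `A_{n+1}`. -/
def actB (n : ℕ) (s : A n ⊗[ℂ] A 1) : A (n + 1) →ₗ[A (n + 1)] A (n + 1) :=
  LinearMap.toSpanSingleton (A (n + 1)) (A (n + 1)) (incl n s)

/-- The left action of `A_n ⊗ A_1` on `A_n ⊗ ℂ = A_n`. -/
def actA (n : ℕ) (s : A n ⊗[ℂ] A 1) : A n →+ A n := AddMonoidHom.mulLeft (projA n s)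

/-- The bimodule `P(n) = A_{n+1} ⊗_{A_n ⊗ A_1} (A_n ⊗ ℂ)`. -/
abbrev PBim (n : ℕ) : Type := Bal (actB n) (actA n)

lemma actA_mulRight (n : ℕ) (a : A n) (s : A n ⊗[ℂ] A 1) (x : A n) :
    AddMonoidHom.mulRight a (actA n s x) = actA n s (AddMonoidHom.mulRight a x) :=
  mul_assoc (projA n s) x a

/-- The right action of `A_n` on `P(n)`. -/
def PBim.act (n : ℕ) (a : A n) : PBim n →ₗ[A (n + 1)] PBim n :=
  Bal.map LinearMap.id (AddMonoidHom.mulRight a) (fun _ _ => rfl)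
    (actA_mulRight n a)

lemma PBim.act_tmul (n : ℕ) (a a' : A n) (b : A (n + 1)) :
    PBim.act n a (Bal.tmul b a') = Bal.tmul b (a' * a) := rfl

/-- The left action of `A_n` on an `A_n`-module. -/
def actM {n : ℕ} (M : Type) [AddCommGroup M] [Module (A n) M] (a : A n) : M →+ M :=
  DistribSMul.toAddMonoidHom M a

/-- The tensor product `P(n) ⊗_{A_n} M`. -/
abbrev PT {n : ℕ} (M : Type) [AddCommGroup M] [Module (A n) M] : Type :=
  Bal (PBim.act n) (actM M)

section PT

variable {n : ℕ} {M : Type} [AddCommGroup M] [Module (A n) M] {X : Type} [AddCommGroup X]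

/-- The element `(b ⊗ 1) ⊗ x` of `P(n) ⊗_{A_n} M`. -/
def PT.mk (b : A (n + 1)) (x : M) : PT (n := n) M := Bal.tmul (Bal.tmul b 1) x

lemma PT.smul_mk (c b : A (n + 1)) (x : M) : c • PT.mk b x = PT.mk (c * b) x := rfl

lemma PT.add_mk (b b' : A (n + 1)) (x : M) : PT.mk (b + b') x = PT.mk b x + PT.mk b' x := by
  simp only [PT.mk, Bal.add_tmul]

lemma PT.mk_add (b : A (n + 1)) (x y : M) : PT.mk b (x + y) = PT.mk b x + PT.mk b y := by
  simp only [PT.mk, Bal.tmul_add]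

/-- `PT.mk` as a biadditive map. -/
def PT.mkHom : A (n + 1) →+ M →+ PT (n := n) M :=
  AddMonoidHom.mk' (fun b => AddMonoidHom.mk' (PT.mk b) (PT.mk_add b))
    (fun b b' => by ext x; exact PT.add_mk b b' x)

lemma PT.tmul_tmul (b : A (n + 1)) (a : A n) (x : M) :
    (Bal.tmul (Bal.tmul b a) x : PT (n := n) M) = PT.mk b (a • x) := by
  have := Bal.rel (r := PBim.act n) (l := actM M) a (Bal.tmul b 1) x
  rw [PT.mk]
  refine Eq.trans ?_ this
  rw [PBim.act_tmul, one_mul]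

lemma PT.mk_incl (b : A (n + 1)) (s : A n ⊗[ℂ] A 1) (x : M) :
    PT.mk (b * incl n s) x = PT.mk b (projA n s • x) := by
  rw [← PT.tmul_tmul, PT.mk]
  have := Bal.rel (r := actB n) (l := actA n) s b 1
  simp only [actB, actA, LinearMap.toSpanSingleton_apply, smul_eq_mul, AddMonoidHom.coe_mulLeft,
    mul_one] at this
  rw [this]

lemma PT.mk_inclL (b : A (n + 1)) (a : A n) (x : M) :
    PT.mk (b * inclL n a) x = PT.mk b (a • x) := by
  have := PT.mk_incl b (a ⊗ₜ 1) x
  rwa [incl, projA, Algebra.TensorProduct.lift_tmul, Algebra.TensorProduct.lift_tmul, map_one,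
    map_one, mul_one, mul_one] at this

lemma PT.induction {p : PT (n := n) M → Prop} (y : PT (n := n) M) (mk : ∀ b x, p (PT.mk b x))
    (add : ∀ x y, p x → p y → p (x + y)) : p y := by
  induction y using Bal.induction with
  | tmul n m =>
    induction n using Bal.induction with
    | tmul b a => rw [PT.tmul_tmul]; exact mk _ _
    | add x y hx hy => rw [Bal.add_tmul]; exact add _ _ hx hy
  | add x y hx hy => exact add _ _ hx hy

/-- The universal property of `P(n) ⊗_{A_n} M`. -/
def PT.lift (h : A (n + 1) →+ M →+ X)
    (hh : ∀ b s x, h (b * incl n s) x = h b (projA n s • x)) : PT (n := n) M →+ X :=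
  Bal.lift (Bal.lift (AddMonoidHom.mk' (fun b => AddMonoidHom.mk'
      (fun a => (h b).comp (actM M a)) (fun a a' => by ext x; simp [actM, add_smul]))
      (fun b b' => by ext a x; simp [actM]))
    (fun s b a => by
      ext x
      change h (b * incl n s) (a • x) = h b ((projA n s * a) • x)
      rw [hh, mul_smul]))
    (fun a p x => by
      induction p using Bal.induction with
      | tmul b a' =>
        change h b ((a' * a) • x) = h b (a' • a • x)
        rw [mul_smul]
      | add p q hp hq => simp only [map_add, AddMonoidHom.add_apply, hp, hq])

lemma PT.lift_mk (h : A (n + 1) →+ M →+ X)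
    (hh : ∀ b s x, h (b * incl n s) x = h b (projA n s • x)) (b : A (n + 1)) (x : M) :
    PT.lift h hh (PT.mk b x) = h b x := by
  change h b ((1 : A n) • x) = h b x
  rw [one_smul]

end PT

section Coord

variable {n : ℕ}

lemma exists_blockPerm (τ : Equiv.Perm (Fin (n + 1))) (h : τ (Fin.natAdd n 0) = Fin.natAdd n 0) :
    ∃ τ' : Equiv.Perm (Fin n), blockPerm n 1 τ' 1 = τ := by
  have hm : Set.MapsTo (finSumFinEquiv.symm.permCongr τ : Equiv.Perm (Fin n ⊕ Fin 1))
      (Set.range Sum.inl) (Set.range Sum.inl) := by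
    rw [Equiv.Perm.perm_mapsTo_inl_iff_mapsTo_inr]
    rintro _ ⟨i, rfl⟩
    obtain rfl := Subsingleton.elim 0 i
    refine ⟨0, ?_⟩
    rw [Equiv.permCongr_apply, Equiv.symm_symm, finSumFinEquiv_apply_right, h,
      finSumFinEquiv_symm_apply_natAdd]
  obtain ⟨⟨a, b⟩, hab⟩ := Equiv.Perm.mem_sumCongrHom_range_of_perm_mapsTo_inl hm
  refine ⟨a, ?_⟩
  obtain rfl := Subsingleton.elim 1 b
  have hab' : Equiv.sumCongr a (1 : Equiv.Perm (Fin 1)) = finSumFinEquiv.symm.permCongr τ := hab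
  rw [blockPerm, hab']
  ext i
  simp [Equiv.permCongr_apply]

/-- The representatives of `S_{n+1} / S_n`. -/
def rep (k : Fin (n + 1)) : Wr (n + 1) := Wr.perm (Equiv.swap k (Fin.natAdd n 0))

lemma rep_mul_rep (k : Fin (n + 1)) : rep k * rep k = 1 := by
  rw [rep, ← map_mul, Equiv.swap_mul_self, map_one]

/-- The decomposition of `ℕⁿ⁺¹ ⋊ S_{n+1}` in cosets. -/
def cosetMap (n : ℕ) (p : Fin (n + 1) × Wr n × Wr 1) : Wr (n + 1) := rep p.1 * block n 1 p.2

lemma block_injective : Function.Injective (block n 1) := by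
  rintro ⟨v, u⟩ ⟨v', u'⟩ h
  have hm := congrArg Wr.m h
  have hσ := congrArg Wr.σ h
  refine Prod.ext ?_ ?_
  · ext i
    · simpa [block] using congrFun hm (Fin.castAdd 1 i)
    · have := congrArg (fun σ => (σ (Fin.castAdd 1 i)).val) hσ
      simpa [block] using this
  · ext i
    · simpa [block] using congrFun hm (Fin.natAdd n i)
    · simp

lemma cosetMap_bijective (n : ℕ) : Function.Bijective (cosetMap n) := by
  constructor
  · rintro ⟨k, p⟩ ⟨k', p'⟩ h
    have hk : k = k' := by
      have := congrArg (fun w => w.σ (Fin.natAdd n 0)) h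
      have h1 : p.2.σ 0 = 0 := Subsingleton.elim _ _
      have h2 : p'.2.σ 0 = 0 := Subsingleton.elim _ _
      simpa [cosetMap, rep, Wr.perm, block, h1, h2] using this
    subst hk
    have := congrArg (fun w => rep k * w) h
    simp only [cosetMap, ← mul_assoc, rep_mul_rep, one_mul] at this
    rw [block_injective this]
  · intro w
    set w' := rep (w.σ (Fin.natAdd n 0)) * w with hw'
    obtain ⟨τ, hτ⟩ := exists_blockPerm w'.σ (by simp [hw', rep, Wr.perm])
    refine ⟨(w.σ (Fin.natAdd n 0), ⟨fun i => w'.m (Fin.castAdd 1 i), τ⟩,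
      ⟨fun i => w'.m (Fin.natAdd n i), 1⟩), ?_⟩
    have : block n 1 (⟨fun i => w'.m (Fin.castAdd 1 i), τ⟩,
      ⟨fun i => w'.m (Fin.natAdd n i), 1⟩) = w' := by
      ext i
      · refine Fin.addCases (fun i => ?_) (fun i => ?_) i <;> simp [block]
      · simp [block, hτ]
    rw [cosetMap, this, hw', ← mul_assoc, rep_mul_rep, one_mul]

/-- The decomposition of `ℕⁿ⁺¹ ⋊ S_{n+1}` in cosets. -/
def cosets (n : ℕ) : Fin (n + 1) × Wr n × Wr 1 ≃ Wr (n + 1) :=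
  Equiv.ofBijective _ (cosetMap_bijective n)

lemma cosets_mul (p : Fin (n + 1) × Wr n × Wr 1) (v : Wr n) (u : Wr 1) :
    cosets n p * block n 1 (v, u) = cosets n (p.1, p.2.1 * v, p.2.2 * u) := by
  change cosetMap n p * _ = cosetMap n _
  rw [cosetMap, cosetMap, mul_assoc, ← map_mul]
  rfl

/-- The coordinates in `A_n` of an element of `P(n)`. -/
def coord (k : Fin (n + 1)) : A (n + 1) →ₗ[ℂ] A n :=
  (Finsupp.linearCombination ℂ (fun w : Wr (n + 1) =>
    if ((cosets n).symm w).1 = k then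
      proj1 (MonoidAlgebra.of ℂ _ ((cosets n).symm w).2.2) •
        MonoidAlgebra.of ℂ _ ((cosets n).symm w).2.1 else 0)) ∘ₗ
    (MonoidAlgebra.coeffLinearEquiv ℂ).toLinearMap

lemma coord_of (k : Fin (n + 1)) (p : Fin (n + 1) × Wr n × Wr 1) :
    coord k (MonoidAlgebra.of ℂ _ (cosets n p)) =
      if p.1 = k then proj1 (MonoidAlgebra.of ℂ _ p.2.2) • MonoidAlgebra.of ℂ _ p.2.1 else 0 := by
  have : coord k (MonoidAlgebra.of ℂ _ (cosets n p)) = Finsupp.linearCombination ℂ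
    (fun w : Wr (n + 1) => if ((cosets n).symm w).1 = k then
      proj1 (MonoidAlgebra.of ℂ _ ((cosets n).symm w).2.2) •
        MonoidAlgebra.of ℂ _ ((cosets n).symm w).2.1 else 0) (Finsupp.single (cosets n p) 1) := rfl
  rw [this, Finsupp.linearCombination_single, one_smul, Equiv.symm_apply_apply]

lemma A_induction' {p : A (n + 1) → Prop} (a : A (n + 1))
    (of : ∀ q, p (MonoidAlgebra.of ℂ _ (cosets n q)))
    (add : ∀ x y, p x → p y → p (x + y)) (smul : ∀ (c : ℂ) x, p x → p (c • x)) : p a := by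
  refine A_induction a (fun w => ?_) add smul
  obtain ⟨q, rfl⟩ := (cosets n).surjective w
  exact of q

lemma proj1_mul_comm (x y : A 1) : proj1 (x * y) = proj1 y * proj1 x := by
  rw [map_mul, mul_comm]

lemma coord_mul_incl (k : Fin (n + 1)) (b : A (n + 1)) (s : A n ⊗[ℂ] A 1) :
    coord k (b * incl n s) = coord k b * projA n s := by
  induction s using TensorProduct.induction_on with
  | zero => simp
  | add x y hx hy => simp only [map_add, mul_add, hx, hy]
  | tmul x y =>
    rw [incl, projA, Algebra.TensorProduct.lift_tmul, Algebra.TensorProduct.lift_tmul,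
      AlgHom.id_apply, AlgHom.comp_apply, Algebra.ofId_apply]
    induction b using A_induction' with
    | add b b' hb hb' => simp only [add_mul, map_add, hb, hb']
    | smul c b hb => simp only [smul_mul_assoc, map_smul, hb]
    | of q =>
    induction x using A_induction with
    | add x x' hx hx' => simp only [mul_add, add_mul, map_add, hx, hx']
    | smul c x hx => simp only [map_smul, smul_mul_assoc, mul_smul_comm, hx]
    | of v =>
    induction y using A_induction with
    | add y y' hy hy' => simp only [mul_add, map_add, hy, hy']
    | smul c x hx =>
      simp only [map_smul, mul_smul_comm, hx]
      rw [smul_eq_mul, map_mul, ← Algebra.smul_def]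
      simp only [mul_smul_comm]
    | of u =>
      rw [inclL_of, inclR_of, ← map_mul, ← map_mul, ← map_mul (block n 1), Prod.mk_mul_mk, mul_one, one_mul,
        cosets_mul, coord_of, coord_of]
      split_ifs with h
      · rw [map_mul, map_mul, map_mul, ← Algebra.commutes, ← Algebra.smul_def]
        simp only [smul_mul_assoc, mul_smul_comm, smul_smul, mul_comm]
      · simp

lemma coord_mem (k : Fin (n + 1)) {i : ℤ} {b : A (n + 1)} (hb : b ∈ gradA (n + 1) i) :
    coord k b ∈ gradA n i := by
  induction hb using Submodule.span_induction with
  | mem x hx =>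
    obtain ⟨w, hw, rfl⟩ := hx
    obtain ⟨⟨k', v, u⟩, rfl⟩ := (cosets n).surjective w
    rw [coord_of]
    split_ifs
    · by_cases hu : u.m 0 = 0
      · have : i = v.deg := by
          rw [← hw.out]
          change (rep k' * block n 1 (v, u)).deg = _
          rw [Wr.deg_mul, deg_block]
          simp [rep, Wr.perm, Wr.deg, hu]
        rw [this]
        exact Submodule.smul_mem _ _ (of_mem_gradA v)
      · have : proj1 (MonoidAlgebra.of ℂ _ u) = 0 := by
          rw [proj1, MonoidAlgebra.lift_of]
          simp [hu]
        change proj1 (MonoidAlgebra.of ℂ _ u) • _ ∈ _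
        rw [this, zero_smul]
        exact zero_mem _
    · exact zero_mem _
  | zero => simp
  | add x y _ _ hx hy => rw [map_add]; exact add_mem hx hy
  | smul c x _ hx => rw [map_smul]; exact Submodule.smul_mem _ _ hx

variable {M : Type} [AddCommGroup M] [Module (A n) M]

/-- The coordinates of an element of `P(n) ⊗ M`. -/
def PT.coord (k : Fin (n + 1)) : PT (n := n) M →+ M :=
  PT.lift (AddMonoidHom.mk' (fun b => DistribSMul.toAddMonoidHom M (Fock.coord k b))
    (fun b b' => by ext x; simp [add_smul]))
    (fun b s x => by
      change Fock.coord k (b * incl n s) • x = Fock.coord k b • projA n s • x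
      rw [coord_mul_incl, mul_smul])

lemma PT.coord_mk (k : Fin (n + 1)) (b : A (n + 1)) (x : M) :
    PT.coord k (PT.mk b x) = Fock.coord k b • x := PT.lift_mk _ _ _ _

/-- The representatives of the cosets, in `A_{n+1}`. -/
def repA (k : Fin (n + 1)) : A (n + 1) := MonoidAlgebra.of ℂ _ (rep k)

lemma repA_eq (k : Fin (n + 1)) : repA k = MonoidAlgebra.of ℂ _ (cosets n (k, 1, 1)) := by
  change _ = MonoidAlgebra.of ℂ _ (rep k * block n 1 (1 : Wr n × Wr 1))
  rw [map_one, mul_one]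
  rfl

lemma repA_mem (k : Fin (n + 1)) : repA k ∈ gradA (n + 1) 0 := by
  have := of_mem_gradA (rep k)
  have h : (rep k).deg = 0 := by simp [rep, Wr.perm, Wr.deg]
  rwa [h] at this

lemma coord_repA (k l : Fin (n + 1)) : coord k (repA l) = if l = k then (1 : A n) else 0 := by
  rw [repA_eq, coord_of, map_one, map_one, one_smul, map_one]

lemma PT.mk_zero (b : A (n + 1)) : PT.mk b (0 : M) = 0 := map_zero (PT.mkHom b)

lemma PT.mk_algebraMap (c : ℂ) (b : A (n + 1)) (x : M) :
    PT.mk b (algebraMap ℂ (A n) c • x) = algebraMap ℂ (A (n + 1)) c • PT.mk b x := by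
  rw [← PT.mk_inclL, AlgHom.commutes, PT.smul_mk, Algebra.commutes]

lemma PT.sum_coord (y : PT (n := n) M) : ∑ k, PT.mk (repA k) (PT.coord k y) = y := by
  induction y using PT.induction with
  | add x y hx hy => simp only [map_add, PT.mk_add, Finset.sum_add_distrib, hx, hy]
  | mk b x =>
    simp only [PT.coord_mk]
    induction b using A_induction' with
    | add b b' hb hb' =>
      simp only [map_add, add_smul, PT.mk_add, Finset.sum_add_distrib, hb, hb', PT.add_mk]
    | smul c b hb =>
      simp only [map_smul]
      simp only [Algebra.smul_def c, mul_smul, PT.mk_algebraMap, ← PT.smul_mk, ← Finset.smul_sum,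
        hb]
    | of q =>
      simp only [coord_of]
      rw [Finset.sum_eq_single q.1]
      · rw [if_pos rfl]
        have e : MonoidAlgebra.of ℂ _ (cosets n q) = repA q.1 *
            incl n (MonoidAlgebra.of ℂ _ q.2.1 ⊗ₜ MonoidAlgebra.of ℂ _ q.2.2) := by
          rw [incl, Algebra.TensorProduct.lift_tmul, inclL_of, inclR_of, repA, ← map_mul, ← map_mul,
            ← map_mul (block n 1), Prod.mk_mul_mk, mul_one, one_mul]
          rfl
        rw [e, PT.mk_incl, projA, Algebra.TensorProduct.lift_tmul, AlgHom.id_apply,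
          AlgHom.comp_apply, Algebra.ofId_apply, ← Algebra.commutes, ← Algebra.smul_def]
      · intro k _ hk
        rw [if_neg (Ne.symm hk), zero_smul, PT.mk_zero]
      · simp

lemma PT.coord_sum (f : Fin (n + 1) → M) (k : Fin (n + 1)) :
    PT.coord k (∑ l, PT.mk (repA l) (f l)) = f k := by
  simp [PT.coord_mk, coord_repA]

end Coord

/-- The grading of `P(n) ⊗_{A_n} M`: if `b` and `x` are homogeneous of degrees `i` and `j`, then
the class of `b ⊗ x` is homogeneous of degree `i + j`. -/
def PT.deg {n : ℕ} (M : GrMod n) (k : ℤ) : AddSubgroup (PT (n := n) M) :=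
  AddSubgroup.closure {y | ∃ (i j : ℤ) (b : A (n + 1)) (x : M),
    i + j = k ∧ b ∈ gradA (n + 1) i ∧ x ∈ M.deg j ∧ y = PT.mk b x}

lemma PT.mk_mem {n : ℕ} {M : GrMod n} {i j : ℤ} {b : A (n + 1)} {x : M}
    (hb : b ∈ gradA (n + 1) i) (hx : x ∈ M.deg j) : PT.mk b x ∈ PT.deg M (i + j) :=
  AddSubgroup.subset_closure ⟨i, j, b, x, rfl, hb, hx, rfl⟩

lemma PT.coord_mem {n : ℕ} {M : GrMod n} {k : ℤ} (l : Fin (n + 1)) {y : PT (n := n) M}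
    (hy : y ∈ PT.deg M k) : PT.coord l y ∈ M.deg k := by
  induction hy using AddSubgroup.closure_induction with
  | mem y hy =>
    obtain ⟨i, j, b, x, rfl, hb, hx, rfl⟩ := hy
    rw [PT.coord_mk]
    exact M.smul_mem (Fock.coord_mem l hb) hx
  | zero => rw [map_zero]; exact zero_mem _
  | add x y _ _ hx hy => rw [map_add]; exact add_mem hx hy
  | neg x _ hx => rw [map_neg]; exact neg_mem hx

lemma PT.isInternal {n : ℕ} (M : GrMod n) : DirectSum.IsInternal (PT.deg M) := by
  refine isInternal_of_comp (fun k => ∑ l, ((PT.mkHom (repA l)).comp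
    (comp M.deg M.isInternal k)).comp (PT.coord l)) ?_ ?_ ?_
  · intro k y hy
    rw [AddMonoidHom.finsetSum_apply]
    refine Eq.trans (Finset.sum_congr rfl fun l _ => ?_) (PT.sum_coord y)
    change PT.mk (repA l) (comp M.deg M.isInternal k (PT.coord l y)) = _
    rw [comp_same M.isInternal (PT.coord_mem l hy)]
  · intro i j y hy hij
    rw [AddMonoidHom.finsetSum_apply]
    refine Finset.sum_eq_zero fun l _ => ?_
    change PT.mk (repA l) (comp M.deg M.isInternal j (PT.coord l y)) = _
    rw [comp_ne M.isInternal (PT.coord_mem l hy) hij, PT.mk_zero]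
  · rw [eq_top_iff]
    intro y _
    rw [← PT.sum_coord y]
    refine sum_mem fun l _ => ?_
    refine hom_induction (iSup_eq_top M.isInternal)
      (p := fun x => PT.mk (repA l) x ∈ iSup (PT.deg M)) (PT.coord l y) ?_ ?_
    · intro i x hx
      exact AddSubgroup.mem_iSup_of_mem (0 + i) (PT.mk_mem (repA_mem l) hx)
    · intro x y hx hy
      rw [PT.mk_add]
      exact add_mem hx hy

/-- The graded module `P(n) ⊗_{A_n} M`. -/
def PObj {n : ℕ} (M : GrMod n) : GrMod (n + 1) where
  carrier := PT (n := n) M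
  deg := PT.deg M
  isInternal := PT.isInternal M
  smul_mem := by
    intro i j a y ha hy
    induction hy using AddSubgroup.closure_induction with
    | mem y hy =>
      obtain ⟨i', j', b, x, rfl, hb, hx, rfl⟩ := hy
      rw [PT.smul_mk, ← add_assoc]
      exact PT.mk_mem (gradA_mul ha hb) hx
    | zero => rw [smul_zero]; exact zero_mem _
    | add x y _ _ hx hy => rw [smul_add]; exact add_mem hx hy
    | neg x _ hx => rw [smul_neg]; exact neg_mem hx

/-- The element `(b ⊗ 1) ⊗ x` of `P(n) ⊗_{A_n} M`. -/
def PObj.gen {n : ℕ} {M : GrMod n} (b : A (n + 1)) (x : M) : PObj M := PT.mk (M := M) b x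

lemma PObj.induction {n : ℕ} {M : GrMod n} {p : PObj M → Prop} (y : PObj M)
    (gen : ∀ b x, p (PObj.gen b x)) (add : ∀ x y, p x → p y → p (x + y)) : p y :=
  PT.induction (M := M) (p := p) y gen add

lemma PObj.lin_ext {n : ℕ} {M : GrMod n} {N : Type} [AddCommGroup N] [Module (A (n + 1)) N]
    {f g : PObj M →ₗ[A (n + 1)] N} (h : ∀ b (x : M), f (PObj.gen b x) = g (PObj.gen b x)) :
    f = g := by
  ext y
  induction y using PObj.induction with
  | gen b x => exact h b x
  | add x y hx hy => rw [map_add, map_add, hx, hy]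

lemma PObj.lin_mem {n : ℕ} {M : GrMod n} {N : GrMod (n + 1)} (f : PObj M →ₗ[A (n + 1)] N)
    (h : ∀ (i j : ℤ) b (x : M), b ∈ gradA (n + 1) i → x ∈ M.deg j →
      f (PObj.gen b x) ∈ N.deg (i + j))
    (k : ℤ) (y : PObj M) (hy : y ∈ (PObj M).deg k) : f y ∈ N.deg k := by
  refine (AddSubgroup.closure_le (K := (N.deg k).comap f.toAddMonoidHom)).2 ?_ hy
  rintro _ ⟨i', j', b, x, rfl, hb, hx, rfl⟩
  exact h _ _ _ _ hb hx

/-- The map `id ⊗ f : P(n) ⊗ M → P(n) ⊗ N`. -/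
def PMapLin {n : ℕ} {M N : GrMod n} (f : M ⟶ N) : PObj M →ₗ[A (n + 1)] PObj N :=
  Bal.map LinearMap.id f.lin.toAddMonoidHom (fun _ _ => rfl) (fun a x => map_smul f.lin a x)

lemma PMapLin_gen {n : ℕ} {M N : GrMod n} (f : M ⟶ N) (b : A (n + 1)) (x : M) :
    PMapLin f (PObj.gen b x) = PObj.gen b (f.lin x) := rfl

lemma PMapLin_mem {n : ℕ} {M N : GrMod n} (f : M ⟶ N) (k : ℤ) (y : PObj M)
    (hy : y ∈ (PObj M).deg k) : PMapLin f y ∈ (PObj N).deg k := by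
  refine PObj.lin_mem (PMapLin f) (fun i j b x hb hx => ?_) k y hy
  rw [PMapLin_gen]
  exact PT.mk_mem hb (f.mem _ _ hx)

/-- The functor `𝔓(n) = P(n) ⊗_{A_n} -` on graded modules. -/
def P (n : ℕ) : GrMod n ⥤ GrMod (n + 1) where
  obj := PObj
  map f := ⟨PMapLin f, PMapLin_mem f⟩
  map_id _ := GrMod.Hom.ext (PObj.lin_ext fun _ _ => rfl)
  map_comp _ _ := GrMod.Hom.ext (PObj.lin_ext fun _ _ => rfl)

section P

variable {n : ℕ} {M N : GrMod n} {L : GrMod (n + 1)}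

/-- The element `(b ⊗ 1) ⊗ x` of `P(n) ⊗_{A_n} M`. -/
def gen (b : A (n + 1)) (x : M) : (P n).obj M := PObj.gen b x

@[simp] lemma P_map_gen (f : M ⟶ N) (b : A (n + 1)) (x : M) :
    ((P n).map f).lin (gen b x) = gen b (f.lin x) := rfl

lemma P_induction {p : (P n).obj M → Prop} (y : (P n).obj M)
    (gen : ∀ b x, p (gen b x)) (add : ∀ x y, p x → p y → p (x + y)) : p y :=
  PObj.induction y gen add

lemma P_hom_ext {f g : (P n).obj M ⟶ L} (h : ∀ b (x : M), f.lin (gen b x) = g.lin (gen b x)) :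
    f = g := GrMod.Hom.ext (PObj.lin_ext h)

lemma smul_gen (c b : A (n + 1)) (x : M) : c • gen b x = gen (c * b) x := rfl

lemma gen_add (b : A (n + 1)) (x y : M) : gen b (x + y) = gen b x + gen b y := PT.mk_add b x y

lemma add_gen (b c : A (n + 1)) (x : M) : gen (b + c) x = gen b x + gen c x := PT.add_mk b c x

lemma gen_zero (b : A (n + 1)) : gen b (0 : M) = 0 := PT.mk_zero b

lemma gen_incl (b : A (n + 1)) (s : A n ⊗[ℂ] A 1) (x : M) :
    gen b (projA n s • x) = gen (b * incl n s) x := (PT.mk_incl b s x).symm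

lemma gen_smul (b : A (n + 1)) (a : A n) (x : M) :
    gen b (a • x) = gen (b * inclL n a) x := (PT.mk_inclL b a x).symm

lemma gen_inclR (b : A (n + 1)) (f : A 1) (x : M) :
    gen (b * inclR n f) x = algebraMap ℂ (A (n + 1)) (proj1 f) • gen b x := by
  have h := gen_incl b (1 ⊗ₜ f) x
  rw [incl, projA, Algebra.TensorProduct.lift_tmul, Algebra.TensorProduct.lift_tmul, map_one,
    map_one, one_mul, one_mul, AlgHom.comp_apply, Algebra.ofId_apply] at h
  rw [← h]
  exact PT.mk_algebraMap _ _ _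

lemma gen_mem {i j : ℤ} {b : A (n + 1)} {x : M} (hb : b ∈ gradA (n + 1) i) (hx : x ∈ M.deg j) :
    gen b x ∈ ((P n).obj M).deg (i + j) := PT.mk_mem hb hx

lemma gen_algebraMap (c : ℂ) (b : A (n + 1)) (x : M) :
    gen b (algebraMap ℂ (A n) c • x) = algebraMap ℂ (A (n + 1)) c • gen b x :=
  PT.mk_algebraMap c b x

/-- The additive maps out of `P(n) ⊗_{A_n} M`. -/
def P_addLift {X : Type} [AddCommGroup X] (h : A (n + 1) →+ M →+ X)
    (hL : ∀ b a x, h (b * inclL n a) x = h b (a • x))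
    (hR : ∀ b f x, h (b * inclR n f) x = h b (algebraMap ℂ (A n) (proj1 f) • x)) :
    (P n).obj M →+ X :=
  PT.lift (M := M) h (fun b s x => by
    induction s using TensorProduct.induction_on with
    | zero => simp
    | add s t hs ht =>
      simp only [map_add, mul_add, add_smul, AddMonoidHom.add_apply, hs, ht]
    | tmul a f =>
      rw [incl, projA, Algebra.TensorProduct.lift_tmul, Algebra.TensorProduct.lift_tmul,
        ← mul_assoc, hR, hL, mul_smul]
      rfl)

lemma P_addLift_gen {X : Type} [AddCommGroup X] (h : A (n + 1) →+ M →+ X)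
    (hL : ∀ b a x, h (b * inclL n a) x = h b (a • x))
    (hR : ∀ b f x, h (b * inclR n f) x = h b (algebraMap ℂ (A n) (proj1 f) • x))
    (b : A (n + 1)) (x : M) : P_addLift h hL hR (gen b x) = h b x := PT.lift_mk _ _ _ _

/-- The biadditive map `(b, x) ↦ b u(x)`. -/
def liftHom (u : M →+ L) : A (n + 1) →+ M →+ L :=
  AddMonoidHom.mk' (fun b => (DistribSMul.toAddMonoidHom L b).comp u)
    (fun b b' => by ext x; simp [add_smul])

lemma liftHom_L (u : M →+ L) (hL : ∀ a x, u (a • x) = inclL n a • u x) (b : A (n + 1)) (a : A n)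
    (x : M) : liftHom u (b * inclL n a) x = liftHom u b (a • x) := by
  change (b * inclL n a) • u x = b • u (a • x)
  rw [hL, mul_smul]

lemma liftHom_R (u : M →+ L) (hL : ∀ a x, u (a • x) = inclL n a • u x)
    (hR : ∀ f x, inclR n f • u x = algebraMap ℂ (A (n + 1)) (proj1 f) • u x) (b : A (n + 1))
    (f : A 1) (x : M) :
    liftHom u (b * inclR n f) x = liftHom u b (algebraMap ℂ (A n) (proj1 f) • x) := by
  change (b * inclR n f) • u x = b • u _
  rw [hL, mul_smul, hR, AlgHom.commutes]

/-- The linear maps out of `P(n) ⊗_{A_n} M`: this is the extension of scalars of `M ⊗ ℂ`. -/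
def P_liftLin (u : M →+ L) (hL : ∀ a x, u (a • x) = inclL n a • u x)
    (hR : ∀ f x, inclR n f • u x = algebraMap ℂ (A (n + 1)) (proj1 f) • u x) :
    (P n).obj M →ₗ[A (n + 1)] L :=
  { P_addLift (liftHom u) (liftHom_L u hL) (liftHom_R u hL hR) with
    map_smul' := fun c y => by
      change P_addLift _ _ _ (c • y) = c • P_addLift _ _ _ y
      induction y using P_induction with
      | gen b x =>
        rw [smul_gen, P_addLift_gen, P_addLift_gen]
        exact mul_smul c b (u x)
      | add x y hx hy => rw [smul_add, map_add, map_add, hx, hy, smul_add] }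

lemma P_liftLin_gen (u : M →+ L) (hL : ∀ a x, u (a • x) = inclL n a • u x)
    (hR : ∀ f x, inclR n f • u x = algebraMap ℂ (A (n + 1)) (proj1 f) • u x)
    (b : A (n + 1)) (x : M) : P_liftLin u hL hR (gen b x) = b • u x :=
  P_addLift_gen (liftHom u) (liftHom_L u hL) (liftHom_R u hL hR) b x

/-- The morphisms out of `P(n) ⊗_{A_n} M`. -/
def P_lift (u : M →+ L) (hL : ∀ a x, u (a • x) = inclL n a • u x)
    (hR : ∀ f x, inclR n f • u x = algebraMap ℂ (A (n + 1)) (proj1 f) • u x)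
    (hu : ∀ i x, x ∈ M.deg i → u x ∈ L.deg i) : (P n).obj M ⟶ L :=
  ⟨P_liftLin u hL hR, PObj.lin_mem (P_liftLin u hL hR) fun i j b x hb hx => by
    have h := L.smul_mem hb (hu _ _ hx)
    rw [← P_liftLin_gen u hL hR] at h
    exact h⟩

lemma P_lift_gen (u : M →+ L) (hL : ∀ a x, u (a • x) = inclL n a • u x)
    (hR : ∀ f x, inclR n f • u x = algebraMap ℂ (A (n + 1)) (proj1 f) • u x)
    (hu : ∀ i x, x ∈ M.deg i → u x ∈ L.deg i) (b : A (n + 1)) (x : M) :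
    (P_lift u hL hR hu).lin (gen b x) = b • u x :=
  P_liftLin_gen u hL hR b x

/-- The coordinates of an element of `P(n) ⊗_{A_n} M`. -/
def P_coord (M : GrMod n) (l : Fin (n + 1)) : (P n).obj M →+ M := PT.coord (M := M) l

lemma P_coord_gen (l : Fin (n + 1)) (b : A (n + 1)) (x : M) :
    P_coord M l (gen b x) = coord l b • x := PT.coord_mk l b x

lemma P_sum_coord (y : (P n).obj M) : ∑ l, gen (repA l) (P_coord M l y) = y := PT.sum_coord y

lemma P_coord_map (f : M ⟶ N) (l : Fin (n + 1)) (y : (P n).obj M) :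
    P_coord N l (((P n).map f).lin y) = f.lin (P_coord M l y) := by
  induction y using P_induction with
  | gen b x => rw [P_map_gen, P_coord_gen, P_coord_gen, map_smul]
  | add x y hx hy => simp only [map_add, hx, hy]

end P

instance (n : ℕ) : (P n).Additive where
  map_add {M N f g} := P_hom_ext fun b x => by
    rw [GrMod.add_lin, P_map_gen, P_map_gen, P_map_gen, GrMod.add_lin, gen_add]

instance (n : ℕ) : (P n).Linear ℂ where
  map_smul {M N} f c := P_hom_ext fun b x => by
    rw [GrMod.smul_lin, P_map_gen, P_map_gen, GrMod.smul_lin]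
    exact PT.mk_algebraMap _ _ _

/-- The bimodule `P(n)` is flat over `A_n`. -/
lemma P_exact (n : ℕ) (S : ShortComplex (GrMod n)) (hS : S.Exact) : (S.map (P n)).Exact := by
  rw [GrMod.exact_iff] at hS ⊢
  intro (y : (P n).obj S.X₂) hy
  have hy' : ((P n).map S.g).lin y = 0 := hy
  have h : ∀ l, ∃ z, S.f.lin z = P_coord S.X₂ l y := fun l => hS _ (by
    rw [← P_coord_map, hy', map_zero])
  choose z hz using h
  refine ⟨(∑ l, gen (repA l) (z l) : (P n).obj S.X₁), ?_⟩
  have e : ((P n).map S.f).lin (∑ l, gen (repA l) (z l)) = y := by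
    rw [map_sum]
    simp only [P_map_gen, hz]
    exact P_sum_coord y
  exact e

lemma P_preserves (n : ℕ) : PreservesFiniteLimits (P n) ∧ PreservesFiniteColimits (P n) :=
  ((Functor.exact_tfae (P n)).out 1 3).1 (P_exact n)

instance (n : ℕ) : PreservesFiniteLimits (P n) := (P_preserves n).1
instance (n : ℕ) : PreservesFiniteColimits (P n) := (P_preserves n).2

/-! ### The natural transformation `T` -/

/-- The transposition of the two last indices. -/
def swapLast (n : ℕ) : Equiv.Perm (Fin (n + 1 + 1)) :=
  Equiv.swap (Fin.castAdd 1 (Fin.natAdd n 0)) (Fin.natAdd (n + 1) 0)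

@[simp] lemma swapLast_castAdd {n : ℕ} (i : Fin n) :
    swapLast n (Fin.castAdd 1 (Fin.castAdd 1 i)) = Fin.castAdd 1 (Fin.castAdd 1 i) := by
  apply Equiv.swap_apply_of_ne_of_ne
  · simp only [ne_eq, Fin.ext_iff, Fin.val_castAdd, Fin.val_natAdd]; have := i.2; simp; omega
  · simp only [ne_eq, Fin.ext_iff, Fin.val_castAdd, Fin.val_natAdd]; have := i.2; simp; omega

@[simp] lemma swapLast_left {n : ℕ} (i : Fin 1) :
    swapLast n (Fin.castAdd 1 (Fin.natAdd n i)) = Fin.natAdd (n + 1) 0 := by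
  obtain rfl := Subsingleton.elim 0 i
  exact Equiv.swap_apply_left _ _

@[simp] lemma swapLast_right {n : ℕ} (i : Fin 1) :
    swapLast n (Fin.natAdd (n + 1) i) = Fin.castAdd 1 (Fin.natAdd n 0) := by
  obtain rfl := Subsingleton.elim 0 i
  exact Equiv.swap_apply_right _ _

lemma swapLast_inv (n : ℕ) : (swapLast n)⁻¹ = swapLast n := Equiv.swap_inv _ _

/-- The transposition `s_{n+1}` of the two last indices, as an element of `A_{n+2}`. -/
def sLast (n : ℕ) : A (n + 1 + 1) := MonoidAlgebra.of ℂ _ (Wr.perm (swapLast n))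

lemma perm_mem {n : ℕ} (σ : Equiv.Perm (Fin n)) :
    MonoidAlgebra.of ℂ _ (Wr.perm σ) ∈ gradA n 0 := by
  have := of_mem_gradA (Wr.perm σ)
  have h : (Wr.perm σ).deg = 0 := by simp [Wr.perm, Wr.deg]
  rwa [h] at this

lemma inclL_mem {n : ℕ} {i : ℤ} {a : A n} (ha : a ∈ gradA n i) : inclL n a ∈ gradA (n + 1) i := by
  induction ha using Submodule.span_induction with
  | mem x hx =>
    obtain ⟨w, hw, rfl⟩ := hx
    rw [inclL_of]
    have := of_mem_gradA (block n 1 (w, 1))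
    rw [deg_block] at this
    rw [← hw.out]
    simpa [Wr.deg] using this
  | zero => simp
  | add x y _ _ hx hy => rw [map_add]; exact add_mem hx hy
  | smul c x _ hx => rw [map_smul]; exact Submodule.smul_mem _ _ hx

/-- `s_{n+1}` commutes with `A_n`. -/
lemma sLast_comm {n : ℕ} (a : A n) :
    inclL (n + 1) (inclL n a) * sLast n = sLast n * inclL (n + 1) (inclL n a) := by
  induction a using A_induction with
  | of v =>
    rw [inclL_of, inclL_of, sLast, ← map_mul, ← map_mul]
    congr 1
    ext i
    · refine Fin.addCases (fun i => Fin.addCases (fun i => ?_) (fun i => ?_) i) (fun i => ?_) i <;>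
        simp [block, Wr.perm, swapLast_inv]
    · refine congrArg Fin.val ?_
      refine Fin.addCases (fun i => Fin.addCases (fun i => ?_) (fun i => ?_) i) (fun i => ?_) i <;>
        simp [block, Wr.perm]
  | add x y hx hy => simp only [map_add, add_mul, mul_add, hx, hy]
  | smul c x hx => simp only [map_smul, smul_mul_assoc, mul_smul_comm, hx]

/-- `x_{n+2} s_{n+1} = s_{n+1} x_{n+1}`. -/
lemma sLast_inclR {n : ℕ} (f : A 1) :
    inclR (n + 1) f * sLast n = sLast n * inclL (n + 1) (inclR n f) := by
  induction f using A_induction with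
  | of v =>
    rw [inclR_of, inclR_of, inclL_of, sLast, ← map_mul, ← map_mul]
    have hv : v.σ = 1 := Subsingleton.elim _ _
    congr 1
    ext i
    · refine Fin.addCases (fun i => Fin.addCases (fun i => ?_) (fun i => ?_) i) (fun i => ?_) i <;>
        first
        | (obtain rfl := Subsingleton.elim 0 i; simp [block, Wr.perm, swapLast_inv])
        | simp [block, Wr.perm, swapLast_inv]
    · refine congrArg Fin.val ?_
      simp [block, Wr.perm, hv]
  | add x y hx hy => simp only [map_add, add_mul, mul_add, hx, hy]
  | smul c x hx => simp only [map_smul, smul_mul_assoc, mul_smul_comm, hx]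

lemma sLast_sq (n : ℕ) : sLast n * sLast n = 1 := by
  rw [sLast, ← map_mul, ← map_mul, swapLast, Equiv.swap_mul_self, map_one, map_one]

lemma sLast_inclR' {n : ℕ} (f : A 1) :
    inclL (n + 1) (inclR n f) * sLast n = sLast n * inclR (n + 1) f := by
  calc _ = sLast n * (sLast n * inclL (n + 1) (inclR n f)) * sLast n := by
        rw [← mul_assoc, sLast_sq, one_mul]
    _ = _ := by rw [← sLast_inclR, mul_assoc, mul_assoc, sLast_sq, mul_one]

lemma gen_gen_smul {n : ℕ} {M : GrMod n} (b : A (n + 1 + 1)) (a : A n) (x : M) :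
    gen (b * inclL (n + 1) (inclL n a)) (gen (1 : A (n + 1)) x) =
      gen b (gen (1 : A (n + 1)) (a • x)) := by
  rw [gen_smul, one_mul, ← gen_smul b, smul_gen, mul_one]

/-- The map `b ⊗ x ↦ b s_{n+1} ⊗ (1 ⊗ x)`, for `b ∈ A_{n+1}`. -/
def TPre {n : ℕ} (M : GrMod n) : (P n).obj M →+ (P (n + 1)).obj ((P n).obj M) :=
  P_addLift (AddMonoidHom.mk' (fun b => AddMonoidHom.mk'
      (fun x => gen (inclL (n + 1) b * sLast n) (gen (1 : A (n + 1)) x))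
      (fun x y => by rw [gen_add, gen_add]))
      (fun b b' => by
        ext x
        change gen _ _ = gen _ _ + gen _ _
        rw [map_add, add_mul, add_gen]))
    (fun b a x => by
      change gen (inclL (n + 1) (b * inclL n a) * sLast n) _ = gen (inclL (n + 1) b * sLast n) _
      rw [map_mul, mul_assoc, sLast_comm, ← mul_assoc, gen_gen_smul])
    (fun b f x => by
      change gen (inclL (n + 1) (b * inclR n f) * sLast n) _ = gen (inclL (n + 1) b * sLast n) _
      rw [map_mul, mul_assoc, sLast_inclR', ← mul_assoc, gen_inclR, gen_algebraMap,
        gen_algebraMap])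

lemma TPre_gen {n : ℕ} {M : GrMod n} (b : A (n + 1)) (x : M) :
    TPre M (gen b x) = gen (inclL (n + 1) b * sLast n) (gen (1 : A (n + 1)) x) :=
  P_addLift_gen _ _ _ _ _

/-- The natural transformation `T : 𝔓𝔓 → 𝔓𝔓` is given on
`A_{n+2} ⊗_{A_n ⊗ A_1 ⊗ A_1} (M ⊗ ℂ ⊗ ℂ)` by `1 ⊗ x ↦ s_{n+1} ⊗ x`. -/
def TApp {n : ℕ} (M : GrMod n) :
    (P (n + 1)).obj ((P n).obj M) ⟶ (P (n + 1)).obj ((P n).obj M) :=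
  P_lift (TPre M)
    (fun a y => by
      induction y using P_induction with
      | gen b x => rw [smul_gen, TPre_gen, TPre_gen, smul_gen, map_mul, mul_assoc]
      | add x y hx hy => rw [smul_add, map_add, map_add, smul_add, hx, hy])
    (fun f y => by
      induction y using P_induction with
      | gen b x =>
        rw [TPre_gen, smul_gen, ← mul_assoc, ← (incl_commute b f).eq, mul_assoc, sLast_inclR,
          ← mul_assoc, ← gen_smul (inclL (n + 1) b * sLast n), smul_gen, mul_one,
          ← one_mul (inclR n f), gen_inclR, gen_algebraMap]
      | add x y hx hy => rw [map_add, smul_add, smul_add, hx, hy])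
    (fun k y hy => by
      refine (AddSubgroup.closure_le (K := (GrMod.deg _ k).comap (TPre M))).2 ?_ hy
      rintro _ ⟨i, j, b, x, rfl, hb, hx, rfl⟩
      have h1 := gen_mem (gradA_one (n + 1)) hx
      have h2 := gen_mem (gradA_mul (inclL_mem hb) (perm_mem (swapLast n))) h1
      rw [zero_add, add_zero] at h2
      have h3 : TPre M (gen b x) ∈ ((P (n + 1)).obj ((P n).obj M)).deg (i + j) := by
        rw [TPre_gen]; exact h2
      exact h3)

lemma TApp_gen {n : ℕ} {M : GrMod n} (c : A (n + 1 + 1)) (b : A (n + 1)) (x : M) :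
    (TApp M).lin (gen c (gen b x)) =
      gen (c * inclL (n + 1) b * sLast n) (gen (1 : A (n + 1)) x) := by
  refine (P_lift_gen (TPre M) _ _ _ c (gen b x)).trans ?_
  rw [TPre_gen, smul_gen, mul_assoc]

/-- The natural transformation `T : 𝔓𝔓 → 𝔓𝔓`. -/
def T (n : ℕ) : P n ⋙ P (n + 1) ⟶ P n ⋙ P (n + 1) where
  app M := TApp M
  naturality M N f := P_hom_ext fun c y => by
    induction y using P_induction with
    | gen b x =>
      change (TApp N).lin (gen c (gen b (f.lin x))) =
        ((P (n + 1)).map ((P n).map f)).lin ((TApp M).lin (gen c (gen b x)))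
      rw [TApp_gen, TApp_gen]
      rfl
    | add x y hx hy =>
      rw [gen_add]
      exact (map_add (GrMod.Hom.lin _) _ _).trans ((congrArg₂ _ hx hy).trans
        (map_add (GrMod.Hom.lin _) _ _).symm)

/-! ### The functors `𝔓ⁿ` and their summands `𝔓_n` -/

/-- The functor `𝔓^m`, from graded `A_d`-modules to graded `A_{d+m}`-modules. -/
def PPow (d : ℕ) : (m : ℕ) → GrMod d ⥤ GrMod (d + m)
  | 0 => 𝟭 _
  | m + 1 => PPow d m ⋙ P (d + m)

/-- The endomorphism of `𝔓^m` given by `T` on the factors of indices `i` and `i + 1`, if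
`i + 1 < m`; the indices start with `0`, at the factor which is applied first. -/
def crossing (d : ℕ) : (m : ℕ) → (i : ℕ) → (PPow d m ⟶ PPow d m)
  | 0, _ => 𝟙 _
  | 1, _ => 𝟙 _
  | m + 2, i => if i = m then Functor.whiskerLeft (PPow d m) (T (d + m))
      else Functor.whiskerRight (crossing d (m + 1) i) (P (d + (m + 1)))

/-- The transposition of `i` and `i + 1`, if `i + 1 < m`. -/
def adj (m i : ℕ) : Equiv.Perm (Fin m) :=
  if h : i + 1 < m then Equiv.swap ⟨i, by omega⟩ ⟨i + 1, h⟩ else 1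

lemma exists_word {m : ℕ} (σ : Equiv.Perm (Fin m)) : ∃ l : List ℕ, (l.map (adj m)).prod = σ := by
  rcases m with _ | m
  · exact ⟨[], Subsingleton.elim _ _⟩
  have h : σ ∈ Submonoid.closure (Set.range fun i : Fin m => Equiv.swap i.castSucc i.succ) := by
    rw [Equiv.Perm.mclosure_swap_castSucc_succ]; trivial
  induction h using Submonoid.closure_induction with
  | mem x hx =>
    obtain ⟨i, rfl⟩ := hx
    refine ⟨[i], ?_⟩
    rw [List.map_singleton, List.prod_singleton, adj, dif_pos (by omega)]
    rfl
  | one => exact ⟨[], rfl⟩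
  | mul x y _ _ hx hy =>
    obtain ⟨l, rfl⟩ := hx
    obtain ⟨l', rfl⟩ := hy
    exact ⟨l ++ l', by simp⟩

/-- The composition of the crossings in a word. -/
def crossingWord (d m : ℕ) : List ℕ → (PPow d m ⟶ PPow d m)
  | [] => 𝟙 _
  | i :: l => crossing d m i ≫ crossingWord d m l

/-- The action of the permutation `σ` on `𝔓^m`, through any expression of `σ` as a product of
simple transpositions. -/
def permAct (d m : ℕ) (σ : Equiv.Perm (Fin m)) : PPow d m ⟶ PPow d m :=
  crossingWord d m (exists_word σ).choose

/-- The endomorphism `e_{(m)} = (1 / m!) ∑ σ` of `𝔓^m`. -/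
def symmetrizer (d m : ℕ) : PPow d m ⟶ PPow d m :=
  (m.factorial : ℂ)⁻¹ • ∑ σ : Equiv.Perm (Fin m), permAct d m σ

/-! ### The symmetrizer is idempotent -/

/-- The element `b ⊗ x` of `𝔓^m(M) = A_{d+m} ⊗ M`. -/
def genPow (d : ℕ) {M : GrMod d} : (m : ℕ) → (b : A (d + m)) → (x : M) → (PPow d m).obj M
  | 0, b, x => (b • x : M)
  | m + 1, b, x => gen (M := (PPow d m).obj M) b (genPow d m 1 x)

lemma smul_genPow {d : ℕ} {M : GrMod d} {m : ℕ} (c b : A (d + m)) (x : M) :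
    c • genPow d m b x = genPow d m (c * b) x := by
  cases m with
  | zero => exact (mul_smul (c : A d) b x).symm
  | succ m => exact smul_gen (M := (PPow d m).obj M) c b _

lemma gen_genPow {d : ℕ} {M : GrMod d} {m : ℕ} (b : A (d + m + 1)) (c : A (d + m)) (x : M) :
    gen (M := (PPow d m).obj M) b (genPow d m c x) =
      genPow d (m + 1) (b * inclL (d + m) c) x := by
  have h : genPow d m c x = c • genPow d m 1 x := by rw [smul_genPow, mul_one]
  rw [h, gen_smul]
  rfl

lemma genPow_induction {d : ℕ} {M : GrMod d} {m : ℕ} {p : (PPow d m).obj M → Prop}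
    (y : (PPow d m).obj M) (gen : ∀ b x, p (genPow d m b x))
    (add : ∀ x y, p x → p y → p (x + y)) : p y := by
  induction m with
  | zero =>
    have := gen 1 y
    exact (congrArg p (show genPow d 0 1 y = y from one_smul (A d) y)).mp this
  | succ m ih =>
    refine P_induction (M := (PPow d m).obj M) (p := p) y (fun b z => ?_) add
    refine ih (p := fun z => p (Fock.gen (M := (PPow d m).obj M) b z)) z (fun c x => ?_)
      (fun x y hx hy => ?_)
    · rw [gen_genPow]; exact gen _ _
    · rw [gen_add]; exact add _ _ hx hy

lemma PPow_ext {d m : ℕ} {F G : PPow d m ⟶ PPow d m}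
    (h : ∀ (M : GrMod d) (b : A (d + m)) (x : M),
      (F.app M).lin (genPow d m b x) = (G.app M).lin (genPow d m b x)) : F = G := by
  ext M y
  induction y using genPow_induction with
  | gen b x => exact h M b x
  | add x y hx hy => rw [map_add, map_add, hx, hy]

/-- The permutation `σ` of the last `m` indices, as an element of `A_{d+m}`. -/
def permEl (d m : ℕ) : Equiv.Perm (Fin m) →* A (d + m) :=
  (MonoidAlgebra.of ℂ (Wr (d + m))).comp (Wr.perm.comp
    { toFun := fun σ => blockPerm d m 1 σ
      map_one' := blockPerm_one d m
      map_mul' := fun σ τ => by rw [← blockPerm_mul, one_mul] })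

lemma permEl_last (d m : ℕ) : permEl d (m + 2) (adj (m + 2) m) = sLast (d + m) := by
  have : blockPerm d (m + 2) 1 (adj (m + 2) m) = swapLast (d + m) := by
    ext i
    rw [adj, dif_pos (by omega), swapLast]
    refine Fin.addCases (fun i => ?_) (fun i => ?_) i
    · rw [blockPerm_castAdd, Equiv.swap_apply_of_ne_of_ne]
      · rfl
      · intro h; have := congrArg Fin.val h; have := i.2; simp at *; omega
      · intro h; have := congrArg Fin.val h; have := i.2; simp at *; omega
    · rw [blockPerm_natAdd, Equiv.swap_apply_def, Equiv.swap_apply_def]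
      simp only [Fin.ext_iff, Fin.val_natAdd, Fin.val_castAdd]
      split_ifs <;> simp at * <;> omega
  change MonoidAlgebra.of ℂ _ (Wr.perm (blockPerm d (m + 2) 1 (adj (m + 2) m))) = _
  rw [this]
  rfl

lemma permEl_succ (d m i : ℕ) (hi : i ≠ m) :
    permEl d (m + 2) (adj (m + 2) i) = inclL (d + (m + 1)) (permEl d (m + 1) (adj (m + 1) i)) := by
  have : block (d + (m + 1)) 1 (Wr.perm (blockPerm d (m + 1) 1 (adj (m + 1) i)), 1) =
      Wr.perm (blockPerm d (m + 2) 1 (adj (m + 2) i)) := by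
    ext j
    · refine Fin.addCases (fun i => ?_) (fun i => ?_) j <;> simp [block, Wr.perm]
    · change (blockPerm (d + (m + 1)) 1 (blockPerm d (m + 1) 1 (adj (m + 1) i)) 1 j).val =
        (blockPerm d (m + 2) 1 (adj (m + 2) i) j).val
      have key : ∀ k : Fin (m + 1), (adj (m + 2) i (Fin.castSucc k)).val =
          (adj (m + 1) i k).val := by
        intro k
        unfold adj
        by_cases h : i + 1 < m + 1
        · rw [dif_pos h, dif_pos (by omega), Equiv.swap_apply_def, Equiv.swap_apply_def]
          simp only [Fin.ext_iff]
          split_ifs <;> simp at * <;> omega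
        · rw [dif_neg h, dif_neg (by omega)]; rfl
      have key' : adj (m + 2) i (Fin.last (m + 1)) = Fin.last (m + 1) := by
        unfold adj
        split_ifs with h
        · apply Equiv.swap_apply_of_ne_of_ne <;> intro h <;> have := congrArg Fin.val h <;>
            simp at this <;> omega
        · rfl
      refine Fin.addCases (fun k => ?_) (fun k => ?_) j
      · rw [blockPerm_castAdd]
        refine Fin.addCases (fun k => ?_) (fun k => ?_) k
        · have e : Fin.castAdd 1 (Fin.castAdd (m + 1) k) = Fin.castAdd (m + 2) k := rfl
          rw [blockPerm_castAdd]
          erw [e, blockPerm_castAdd]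
          rfl
        · have e : Fin.castAdd 1 (Fin.natAdd d k) = Fin.natAdd d (Fin.castSucc k) := rfl
          rw [blockPerm_natAdd]
          erw [e, blockPerm_natAdd]
          simp [key]
      · obtain rfl := Subsingleton.elim 0 k
        have e : Fin.natAdd (d + (m + 1)) (0 : Fin 1) = Fin.natAdd d (Fin.last (m + 1)) := by
          ext; simp
        rw [blockPerm_natAdd]
        erw [e, blockPerm_natAdd]
        rw [key']
  change MonoidAlgebra.of ℂ _ (Wr.perm (blockPerm d (m + 2) 1 (adj (m + 2) i))) =
    inclL (d + (m + 1)) (MonoidAlgebra.of ℂ _ (Wr.perm (blockPerm d (m + 1) 1 (adj (m + 1) i))))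
  rw [inclL_of, this]
  rfl

lemma crossing_last (d m : ℕ) :
    crossing d (m + 2) m = Functor.whiskerLeft (PPow d m) (T (d + m)) := if_pos rfl

lemma crossing_succ (d m i : ℕ) (hi : i ≠ m) : crossing d (m + 2) i =
    Functor.whiskerRight (crossing d (m + 1) i) (P (d + (m + 1))) := if_neg hi

lemma crossing_genPow {d m : ℕ} (i : ℕ) (M : GrMod d) (b : A (d + m)) (x : M) :
    ((crossing d m i).app M).lin (genPow d m b x) =
      genPow d m (b * permEl d m (adj m i)) x := by
  induction m with
  | zero =>
    rw [Subsingleton.elim (adj 0 i) 1, map_one, mul_one]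
    rfl
  | succ m ih =>
    cases m with
    | zero =>
      rw [show adj (0 + 1) i = 1 from Subsingleton.elim (α := Equiv.Perm (Fin 1)) _ _, map_one, mul_one]
      rfl
    | succ m =>
      by_cases hi : i = m
      · subst hi
        rw [permEl_last, crossing_last]
        have := TApp_gen (M := (PPow d i).obj M) b 1 (genPow d i 1 x)
        rw [map_one, mul_one] at this
        exact this
      · have h := ih 1
        rw [one_mul] at h
        rw [permEl_succ _ _ _ hi, crossing_succ _ _ _ hi]
        refine Eq.trans ?_ (gen_genPow (m := m + 1) b (permEl d (m + 1) (adj (m + 1) i)) x)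
        rw [← h]
        rfl

lemma crossingWord_genPow {d m : ℕ} (l : List ℕ) (M : GrMod d) (b : A (d + m)) (x : M) :
    ((crossingWord d m l).app M).lin (genPow d m b x) =
      genPow d m (b * permEl d m (l.map (adj m)).prod) x := by
  induction l generalizing b with
  | nil => rw [List.map_nil, List.prod_nil, map_one, mul_one]; rfl
  | cons i l ih =>
    rw [crossingWord, NatTrans.comp_app, GrMod.comp_lin, crossing_genPow, ih, List.map_cons,
      List.prod_cons, map_mul, mul_assoc]

lemma permAct_genPow {d m : ℕ} (σ : Equiv.Perm (Fin m)) (M : GrMod d) (b : A (d + m)) (x : M) :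
    ((permAct d m σ).app M).lin (genPow d m b x) = genPow d m (b * permEl d m σ) x := by
  rw [permAct, crossingWord_genPow, (exists_word σ).choose_spec]

lemma permAct_comp {d m : ℕ} (σ τ : Equiv.Perm (Fin m)) :
    permAct d m σ ≫ permAct d m τ = permAct d m (σ * τ) :=
  PPow_ext fun M b x => by
    rw [NatTrans.comp_app, GrMod.comp_lin, permAct_genPow, permAct_genPow, permAct_genPow,
      map_mul, mul_assoc]

lemma permAct_one (d m : ℕ) : permAct d m 1 = 𝟙 _ :=
  PPow_ext fun M b x => by
    rw [permAct_genPow, map_one, mul_one]; rfl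

lemma symmetrizer_comp (d m : ℕ) :
    symmetrizer d m ≫ symmetrizer d m = symmetrizer d m := by
  have h : ∀ σ : Equiv.Perm (Fin m), permAct d m σ ≫ ∑ τ, permAct d m τ = ∑ τ, permAct d m τ := by
    intro σ
    rw [Preadditive.comp_sum]
    simp only [permAct_comp]
    exact Equiv.sum_comp (Equiv.mulLeft σ) (permAct d m)
  have hm : (m.factorial : ℂ) ≠ 0 := Nat.cast_ne_zero.2 m.factorial_ne_zero
  rw [symmetrizer, Linear.smul_comp, Linear.comp_smul, Preadditive.sum_comp,
    Finset.sum_congr rfl (fun σ _ => h σ), Finset.sum_const, Finset.card_univ,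
    Fintype.card_perm, Fintype.card_fin, ← Nat.cast_smul_eq_nsmul ℂ, smul_smul, smul_smul,
    mul_assoc, inv_mul_cancel₀ hm, mul_one]

/-! ### Passage to the derived categories -/

instance (d m : ℕ) : (PPow d m).Additive := by
  induction m with
  | zero => exact inferInstanceAs (𝟭 (GrMod d)).Additive
  | succ m ih => exact inferInstanceAs (PPow d m ⋙ P (d + m)).Additive

instance (d m : ℕ) : PreservesFiniteLimits (PPow d m) := by
  induction m with
  | zero => exact inferInstanceAs (PreservesFiniteLimits (𝟭 (GrMod d)))
  | succ m ih => exact comp_preservesFiniteLimits (PPow d m) (P (d + m))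

instance (d m : ℕ) : PreservesFiniteColimits (PPow d m) := by
  induction m with
  | zero => exact inferInstanceAs (PreservesFiniteColimits (𝟭 (GrMod d)))
  | succ m ih => exact comp_preservesFiniteColimits (PPow d m) (P (d + m))

instance (n : ℕ) : HasDerivedCategory (GrMod n) := HasDerivedCategory.standard _

/-- A graded `A_n`-module is finite dimensional over `ℂ`. -/
def FinDim {n : ℕ} (M : GrMod n) : Prop :=
  letI : Module ℂ M := Module.compHom M (algebraMap ℂ (A n))
  FiniteDimensional ℂ M

lemma FinDim.of_injective {n : ℕ} {M N : GrMod n} (f : M ⟶ N) (hf : Function.Injective f.lin)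
    (h : FinDim N) : FinDim M := by
  let : Module ℂ M := Module.compHom M (algebraMap ℂ (A n))
  let : Module ℂ N := Module.compHom N (algebraMap ℂ (A n))
  have h : FiniteDimensional ℂ N := h
  let l : M →ₗ[ℂ] N :=
    { toFun := f.lin
      map_add' := map_add f.lin
      map_smul' := fun c x => map_smul f.lin (algebraMap ℂ (A n) c) x }
  exact Module.Finite.of_injective l hf

lemma FinDim.P {n : ℕ} {M : GrMod n} (h : FinDim M) : FinDim ((P n).obj M) := by
  let : Module ℂ M := Module.compHom M (algebraMap ℂ (A n))
  let : Module ℂ ((Fock.P n).obj M) := Module.compHom _ (algebraMap ℂ (A (n + 1)))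
  have h : FiniteDimensional ℂ M := h
  let l : (Fin (n + 1) → M) →ₗ[ℂ] ((Fock.P n).obj M) :=
    { toFun := fun y => ∑ i, gen (repA i) (y i)
      map_add' := fun x y => by
        rw [← Finset.sum_add_distrib]
        exact Finset.sum_congr rfl fun i _ => gen_add _ _ _
      map_smul' := fun c x => by
        rw [Finset.smul_sum]
        exact Finset.sum_congr rfl fun i _ => gen_algebraMap _ _ _ }
  exact Module.Finite.of_surjective l fun y => ⟨fun i => P_coord M i y, P_sum_coord y⟩

lemma FinDim.PPow {d : ℕ} {M : GrMod d} (h : FinDim M) (m : ℕ) : FinDim ((PPow d m).obj M) := by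
  induction m with
  | zero => exact h
  | succ m ih => exact ih.P

instance (n : ℕ) : HasFiniteBiproducts (GrMod n) := Abelian.hasFiniteBiproducts

lemma FinDim.biproduct {n : ℕ} {J : Type} [Finite J] (M : J → GrMod n) (h : ∀ j, FinDim (M j)) :
    FinDim (⨁ M) := by
  have := Fintype.ofFinite J
  let : ∀ j, Module ℂ (M j) := fun j => Module.compHom (M j) (algebraMap ℂ (A n))
  let : Module ℂ (⨁ M : GrMod n) := Module.compHom _ (algebraMap ℂ (A n))
  have h : ∀ j, FiniteDimensional ℂ (M j) := h
  let l : (⨁ M : GrMod n) →ₗ[ℂ] (∀ j, M j) :=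
    { toFun := fun x j => (biproduct.π M j).lin x
      map_add' := fun x y => funext fun j => map_add (biproduct.π M j).lin x y
      map_smul' := fun c x => funext fun j =>
        map_smul (biproduct.π M j).lin (algebraMap ℂ (A n) c) x }
  refine Module.Finite.of_injective l fun x y hxy => ?_
  have key : ∀ z : (⨁ M : GrMod n),
      z = ∑ j, (biproduct.ι M j).lin ((biproduct.π M j).lin z) := by
    intro z
    have e := congrArg (fun f : (⨁ M) ⟶ (⨁ M) => f.lin z) (biproduct.total (f := M))
    rw [GrMod.id_lin] at e
    refine e.symm.trans ?_
    let φ : ((⨁ M) ⟶ (⨁ M)) →+ (⨁ M : GrMod n) :=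
      { toFun := fun f => f.lin z, map_zero' := rfl, map_add' := fun _ _ => rfl }
    exact map_sum φ _ _
  rw [key x, key y]
  exact Finset.sum_congr rfl fun j _ => congrArg _ (congrFun hxy j)

/-- The objects of the derived category of graded `A_n`-modules which are represented by bounded
complexes of finite dimensional graded `A_n`-modules. -/
def bounded (n : ℕ) : ObjectProperty (DerivedCategory (GrMod n)) := fun X =>
  ∃ K : CochainComplex (GrMod n) ℤ,
    (∃ a b : ℤ, ∀ i, i < a ∨ b < i → IsZero (K.X i)) ∧ (∀ i, FinDim (K.X i)) ∧
      Nonempty (X ≅ DerivedCategory.Q.obj K)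

/-- The bounded derived category `D(A_n-gmod)` of finite dimensional graded `A_n`-modules, as a full
subcategory of the derived category of all graded `A_n`-modules. -/
abbrev D (n : ℕ) : Type 1 := (bounded n).FullSubcategory

lemma bounded_map {d m : ℕ} {X : DerivedCategory (GrMod d)} (h : bounded d X) :
    bounded (d + m) ((PPow d m).mapDerivedCategory.obj X) := by
  obtain ⟨K, ⟨a, b, hab⟩, hK, ⟨e⟩⟩ := h
  exact ⟨((PPow d m).mapHomologicalComplex _).obj K,
    ⟨a, b, fun i hi => (PPow d m).map_isZero (hab i hi)⟩, fun i => (hK i).PPow m,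
    ⟨(PPow d m).mapDerivedCategory.mapIso e ≪≫ (PPow d m).mapDerivedCategoryFactors.app K⟩⟩

/-- The functor `𝔓^m : D(A_d-gmod) → D(A_{d+m}-gmod)`. -/
def DPow (d m : ℕ) : D d ⥤ D (d + m) :=
  (bounded (d + m)).lift ((bounded d).ι ⋙ (PPow d m).mapDerivedCategory)
    fun X => bounded_map X.property

/-- The endomorphism of the derived functor of `𝔓^m` induced by an endomorphism of `𝔓^m`, on the
derived category of all graded modules. -/
def derivedHom {d m : ℕ} (τ : PPow d m ⟶ PPow d m) :
    (PPow d m).mapDerivedCategory ⟶ (PPow d m).mapDerivedCategory :=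
  Localization.liftNatTrans DerivedCategory.Q
    (HomologicalComplex.quasiIso (GrMod d) (ComplexShape.up ℤ))
    ((PPow d m).mapHomologicalComplex _ ⋙ DerivedCategory.Q)
    ((PPow d m).mapHomologicalComplex _ ⋙ DerivedCategory.Q)
    (PPow d m).mapDerivedCategory (PPow d m).mapDerivedCategory
    (Functor.whiskerRight (NatTrans.mapHomologicalComplex τ _) DerivedCategory.Q)

lemma derivedHom_comp {d m : ℕ} (τ τ' : PPow d m ⟶ PPow d m) :
    derivedHom τ ≫ derivedHom τ' = derivedHom (τ ≫ τ') := by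
  rw [derivedHom, derivedHom, derivedHom, NatTrans.mapHomologicalComplex_comp,
    Functor.whiskerRight_comp]
  exact Localization.comp_liftNatTrans _ _ _ _ _ _ _ _ _ _

/-- The endomorphism of the functor `𝔓^m : D(A_d-gmod) → D(A_{d+m}-gmod)` induced by an endomorphism
of the functor `𝔓^m` on graded modules. -/
def DHom {d m : ℕ} (τ : PPow d m ⟶ PPow d m) : DPow d m ⟶ DPow d m where
  app X := ObjectProperty.homMk ((derivedHom τ).app X.obj)
  naturality _ _ f := ObjectProperty.hom_ext _ ((derivedHom τ).naturality f.hom)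

lemma DHom_comp {d m : ℕ} (τ τ' : PPow d m ⟶ PPow d m) : DHom τ ≫ DHom τ' = DHom (τ ≫ τ') := by
  ext X
  exact congrArg (fun f => NatTrans.app f X.obj) (derivedHom_comp τ τ')

/-- The image `𝔓_m = j(P_m) = (𝔓^m, e_{(m)})` of `P_m` under the Fock functor `j`, as an object of
the Karoubi envelope of the category of functors from `D(A_d-gmod)` to `D(A_{d+m}-gmod)`. -/
def jP (d m : ℕ) : Idempotents.Karoubi (D d ⥤ D (d + m)) where
  X := DPow d m
  p := DHom (symmetrizer d m)
  idem := by rw [DHom_comp, symmetrizer_comp]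

/-- The image under `j` of `Γ̃_-(z) = ∑ P_m z^m`. It sends an object of `D(A_d-gmod)` to a formal
power series in `z`, given by the family of its coefficients; the coefficient of `z^m` is in the
Karoubi envelope of `D(A_{d+m}-gmod)`. -/
def gammaMinus (d : ℕ) : D d ⥤ (∀ m : ℕ, Idempotents.Karoubi (D (d + m))) :=
  Functor.pi' fun m =>
    (Idempotents.karoubiFunctorCategoryEmbedding (D d) (D (d + m))).obj (jP d m)

/-- A finite dimensional graded `A_n`-module, as an object of `D(A_n-gmod)` in cohomological
degree `0`. -/
def single {n : ℕ} (M : GrMod n) (hM : FinDim M) : D n where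
  obj := (DerivedCategory.singleFunctor (GrMod n) 0).obj M
  property := by
    have hz : ∀ i : ℤ, i ≠ 0 →
        IsZero (((HomologicalComplex.single (GrMod n) (ComplexShape.up ℤ) 0).obj M).X i) :=
      fun i hi => HomologicalComplex.isZero_single_obj_X _ _ _ _ hi
    refine ⟨(HomologicalComplex.single (GrMod n) (ComplexShape.up ℤ) 0).obj M,
      ⟨0, 0, fun i hi => hz i (by omega)⟩, fun i => ?_,
      ⟨(DerivedCategory.singleFunctorIsoCompQ (GrMod n) 0).app M⟩⟩
    by_cases hi : i = 0
    · subst hi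
      have e := HomologicalComplex.singleObjXSelf (ComplexShape.up ℤ) 0 M
      exact FinDim.of_injective e.hom (GrMod.injective_of_mono _) hM
    · have := (hz i hi).mono (0 : _ ⟶ M)
      exact FinDim.of_injective (0 : _ ⟶ M) (GrMod.injective_of_mono _) hM

/-! ### The irreducible representations of the symmetric groups -/

/-- The sum `a_λ` of the permutations preserving the rows of the tableau `t`. -/
def rowSum {d : ℕ} (lam : YoungDiagram) (t : lam.cells ≃ Fin d) :
    MonoidAlgebra ℂ (Equiv.Perm (Fin d)) :=
  open Classical in
  ∑ g ∈ Finset.univ.filter fun g : Equiv.Perm (Fin d) =>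
    ∀ i, (t.symm (g i)).1.1 = (t.symm i).1.1, MonoidAlgebra.of ℂ _ g

/-- The signed sum `b_λ` of the permutations preserving the columns of the tableau `t`. -/
def colSum {d : ℕ} (lam : YoungDiagram) (t : lam.cells ≃ Fin d) :
    MonoidAlgebra ℂ (Equiv.Perm (Fin d)) :=
  open Classical in
  ∑ g ∈ Finset.univ.filter fun g : Equiv.Perm (Fin d) =>
    ∀ i, (t.symm (g i)).1.2 = (t.symm i).1.2,
      ((Equiv.Perm.sign g : ℤ) : ℂ) • MonoidAlgebra.of ℂ _ g

/-- The left ideal `ℂ[S_d] e_λ`, for the Young symmetrizer `e_λ = a_λ b_λ / n_λ` of the tableau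
`t`. Since `n_λ` is a non-zero scalar, this is the left ideal generated by `a_λ b_λ`. -/
def specht {d : ℕ} (lam : YoungDiagram) (t : lam.cells ≃ Fin d) :
    Submodule (MonoidAlgebra ℂ (Equiv.Perm (Fin d))) (MonoidAlgebra ℂ (Equiv.Perm (Fin d))) :=
  Submodule.span _ {rowSum lam t * colSum lam t}

/-- The homomorphism `A_d → ℂ[S_d]` which sends the variables to `0`. -/
def augment (d : ℕ) : A d →ₐ[ℂ] MonoidAlgebra ℂ (Equiv.Perm (Fin d)) :=
  MonoidAlgebra.lift ℂ _ (Wr d)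
    { toFun := fun w => open Classical in
        if ∀ i, w.m i = 0 then MonoidAlgebra.of ℂ _ w.σ else 0
      map_one' := by simp [MonoidAlgebra.one_def]
      map_mul' := fun v w => by
        by_cases hv : ∀ i, v.m i = 0
        · by_cases hw : ∀ i, w.m i = 0
          · simp [hv, hw, MonoidAlgebra.single_mul_single]
          · have : ¬ ∀ i, (v * w).m i = 0 := fun h => hw fun i => by
              have := h (v.σ i); simp at this; exact this.2
            rw [if_neg this, if_neg hw, mul_zero]
        · have : ¬ ∀ i, (v * w).m i = 0 := fun h => hv fun i => by
            have := h i; simp at this; exact this.1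
          rw [if_neg this, if_neg hv, zero_mul] }

lemma augment_of_deg {d : ℕ} {i : ℤ} {a : A d} (ha : a ∈ gradA d i) (hi : i ≠ 0) :
    augment d a = 0 := by
  induction ha using Submodule.span_induction with
  | mem x hx =>
    obtain ⟨w, hw, rfl⟩ := hx
    have hw : w.deg = i := hw
    have : ¬ ∀ j, w.m j = 0 := fun h => hi (by rw [← hw]; simp [Wr.deg, h])
    rw [augment, MonoidAlgebra.lift_of]
    exact if_neg this
  | zero => exact map_zero _
  | add x y _ _ hx hy => rw [map_add, hx, hy, add_zero]
  | smul c x _ hx => rw [map_smul, hx, smul_zero]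

/-- The irreducible representation `V_λ` of `S_d`, as a graded `A_d`-module in degree `0` on which
the variables act as `0`. -/
def V {d : ℕ} (lam : YoungDiagram) (t : lam.cells ≃ Fin d) : GrMod d where
  carrier := specht lam t
  grp := inferInstance
  mod := Module.compHom (specht lam t) (augment d).toRingHom
  deg i := if i = 0 then ⊤ else ⊥
  isInternal := by
    refine isInternal_of_comp (fun i => if i = 0 then AddMonoidHom.id _ else 0) ?_ ?_ ?_
    · intro i x hx
      split_ifs at hx ⊢ with h
      · rfl
      · exact ((AddSubgroup.mem_bot).1 hx).symm
    · intro i j x hx hij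
      by_cases hi : i = 0
      · have hj : j ≠ 0 := fun h => hij (hi.trans h.symm)
        rw [if_neg hj]; rfl
      · rw [if_neg hi] at hx
        rw [(AddSubgroup.mem_bot).1 hx, map_zero]
    · rw [eq_top_iff]
      exact le_iSup_of_le 0 (by rw [if_pos rfl])
  smul_mem := by
    intro i j a x ha hx
    by_cases hj : j = 0
    · by_cases hi : i = 0
      · rw [if_pos (by omega)]; trivial
      · have h : augment d a • x = 0 := by rw [augment_of_deg ha hi, zero_smul]
        have h' : (augment d a • x : specht lam t) ∈
          (if i + j = 0 then ⊤ else ⊥ : AddSubgroup (specht lam t)) := by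
          rw [h]; exact zero_mem _
        exact h'
    · rw [if_neg hj] at hx
      rw [(AddSubgroup.mem_bot).1 hx]
      have h : augment d a • (0 : specht lam t) = 0 := smul_zero _
      have h' : (augment d a • 0 : specht lam t) ∈
        (if i + j = 0 then ⊤ else ⊥ : AddSubgroup (specht lam t)) := by
        rw [h]; exact zero_mem _
      exact h'

lemma finDim_V {d : ℕ} (lam : YoungDiagram) (t : lam.cells ≃ Fin d) : FinDim (V lam t) := by
  let : Module ℂ (V lam t) := Module.compHom _ (algebraMap ℂ (A d))
  let l : V lam t →ₗ[ℂ] MonoidAlgebra ℂ (Equiv.Perm (Fin d)) :=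
    { toFun := fun x => (specht lam t).subtype x
      map_add' := fun _ _ => rfl
      map_smul' := fun c x => by
        change augment d (algebraMap ℂ (A d) c) * (specht lam t).subtype x = _
        rw [AlgHom.commutes, ← Algebra.smul_def]
        rfl }
  have : FiniteDimensional ℂ (MonoidAlgebra ℂ (Equiv.Perm (Fin d))) :=
    Module.Finite.equiv (MonoidAlgebra.coeffLinearEquiv ℂ).symm
  exact Module.Finite.of_injective l Subtype.val_injective

/-! ### Interlacing partitions -/

/-- `mu ≻ lam`, that is `mu₁ ≥ lam₁ ≥ mu₂ ≥ lam₂ ≥ …`. -/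
def Interlaces (mu lam : YoungDiagram) : Prop :=
  ∀ i : ℕ, lam.rowLen i ≤ mu.rowLen i ∧ mu.rowLen (i + 1) ≤ lam.rowLen i

/-- The partitions `mu` of `k` such that `mu ≻ lam`. -/
abbrev Interlacing (lam : YoungDiagram) (k : ℕ) : Type :=
  {mu : YoungDiagram // Interlaces mu lam ∧ mu.card = k}

instance (lam : YoungDiagram) (k : ℕ) : Finite (Interlacing lam k) := by
  have hf : Finite {s : Finset (ℕ × ℕ) // s ⊆ Finset.range k ×ˢ Finset.range k} :=
    Finite.of_equiv ((Finset.range k ×ˢ Finset.range k).powerset)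
      (Equiv.subtypeEquivRight fun s => Finset.mem_powerset)
  refine Finite.of_injective (β := {s : Finset (ℕ × ℕ) // s ⊆ Finset.range k ×ˢ Finset.range k})
    (fun mu => ⟨mu.1.cells, fun c hc => ?_⟩) fun mu nu h => ?_
  · obtain ⟨i, j⟩ := c
    have hc : (i, j) ∈ mu.1 := hc
    have hk : mu.1.cells.card = k := mu.2.2
    have h1 : (Finset.range (i + 1)).image (fun a => (a, j)) ⊆ mu.1.cells := by
      intro x hx
      obtain ⟨a, ha, rfl⟩ := Finset.mem_image.1 hx
      exact mu.1.up_left_mem (Nat.lt_succ_iff.1 (Finset.mem_range.1 ha)) le_rfl hc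
    have h2 : (Finset.range (j + 1)).image (fun a => (i, a)) ⊆ mu.1.cells := by
      intro x hx
      obtain ⟨a, ha, rfl⟩ := Finset.mem_image.1 hx
      exact mu.1.up_left_mem le_rfl (Nat.lt_succ_iff.1 (Finset.mem_range.1 ha)) hc
    have c1 := Finset.card_le_card h1
    have c2 := Finset.card_le_card h2
    rw [Finset.card_image_of_injective _ (fun a b h => (Prod.ext_iff.1 h).1),
      Finset.card_range] at c1
    rw [Finset.card_image_of_injective _ (fun a b h => (Prod.ext_iff.1 h).2),
      Finset.card_range] at c2
    simp only [Finset.mem_product, Finset.mem_range]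
    omega
  · exact Subtype.ext (YoungDiagram.ext (congrArg Subtype.val h))

/-- The direct sum of the `V_μ`, over the partitions `μ` of `k` such that `μ ≻ λ`, as an object
of `D(A_k-gmod)`; the representation `V_μ` is constructed from the tableau `u μ`. -/
def sumV (lam : YoungDiagram) (k : ℕ) (u : ∀ mu : Interlacing lam k, mu.1.cells ≃ Fin k) : D k :=
  single (⨁ fun mu : Interlacing lam k => V mu.1 (u mu))
    (FinDim.biproduct _ fun mu => finDim_V mu.1 (u mu))

end Fock

end

noncomputable section

namespace Fock

/-! ### Group algebras of symmetric groups -/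

/-! The statement is Pieri's rule. The variables act by zero on `V_λ`, and `𝔓^n V_λ` stays in
internal degree `0`, so it is the representation of `S_{d+n}` induced from `S_d`. The
transformations `T` act on it by right multiplication by permutations of the last `n` labels. The
image of `e_(n)` is therefore the representation induced from `V_λ ⊗ triv` on `S_d × S_n`, and it
has to be identified with the sum of the `V_μ`, `μ / λ` a horizontal strip.

The identification is a dimension count, without characters and without the classification of the
irreducible representations.

Lower bound. If `u` is a tableau of shape `μ` extending `t`, the component of its Young symmetrizer
on the Young subgroup `S_d × S_n`, pushed to `ℂ[S_d]`, is a nonzero multiple of the symmetrizer of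
`t` (`Extends.blockProj_young`). The reason is that the boxes of a horizontal strip lie at the
bottom of their columns (`Extends.exists_block`). So each `V_μ` maps nontrivially to the image of
`e_(n)`. The sum of these maps is injective (`eq_zero_of_sum_smul`), because symmetrizers of
distinct shapes annihilate each other, those of one shape are quasi-idempotent, and the group
algebra is semiprime.

Upper bound. The image of `e_(n)` is spanned by translates of `V_λ` indexed by the cosets of `S_d ×
S_n`, so its dimension is at most `(d+n).choose d * dimV lam` (`finrank_symmetrizer_le`).

The two bounds agree. The lower bound for `n = 1` against the upper bound, and the analogous
injection for the restriction of `V_μ` to `S_{d-1}`, where `d = |μ|`, give two branching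
inequalities (`sum_dimV_up`, `sum_dimV_down`). A commutation relation in Young's lattice
(`card_commutation`) forces both to be equalities (`sum_down_eq`), and then yields the sum of the
`dimV mu` over all horizontal strips of a given size by Pascal's rule (`sum_strips_eq`).

Hence `e_(n)` splits through the sum of the `V_μ` already among graded modules (`sumProj_sumHom`,
`sumHom_sumProj`). By `derivedHom_single` the derived idempotent is the image of the idempotent of
modules, so the splitting passes to the derived category and is an isomorphism in the Karoubi
envelope. -/

/-- The group algebra of `S_d`. -/
abbrev B (d : ℕ) : Type := MonoidAlgebra ℂ (Equiv.Perm (Fin d))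

instance (d : ℕ) : FiniteDimensional ℂ (B d) :=
  Module.Finite.equiv (MonoidAlgebra.coeffLinearEquiv ℂ).symm

lemma eq_zero_of_eq_neg {d : ℕ} {x : B d} (h : x = -x) : x = 0 := by
  have h2 : (2 : ℂ) • x = 0 := by
    rw [two_smul]
    nth_rewrite 2 [h]
    exact add_neg_cancel x
  exact (smul_eq_zero.1 h2).resolve_left two_ne_zero

/-- In the basis of group elements every diagonal entry is the coefficient of `g` in `y g`, which is
the coefficient of `1` in `y`. -/
lemma trace_mulLeft {d : ℕ} (y : B d) :
    LinearMap.trace ℂ (B d) (LinearMap.mulLeft ℂ y) = d.factorial * y.coeff 1 := by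
  classical
  let b : Module.Basis (Equiv.Perm (Fin d)) ℂ (B d) := .ofRepr (MonoidAlgebra.coeffLinearEquiv ℂ)
  have hb : ∀ g, b g = MonoidAlgebra.single g 1 := fun g => by
    change (MonoidAlgebra.coeffLinearEquiv ℂ).symm (Finsupp.single g 1) = _
    rw [LinearEquiv.symm_apply_eq]
    rfl
  rw [LinearMap.trace_eq_matrix_trace ℂ b, Matrix.trace]
  have : ∀ g, Matrix.diag (LinearMap.toMatrix b b (LinearMap.mulLeft ℂ y)) g = y.coeff 1 := by
    intro g
    rw [Matrix.diag_apply, LinearMap.toMatrix_apply, LinearMap.mulLeft_apply, hb]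
    change (y * MonoidAlgebra.single g 1).coeff g = _
    rw [MonoidAlgebra.coeff_mul_single_apply]
    simp
  rw [Finset.sum_congr rfl fun g _ => this g, Finset.sum_const, Finset.card_univ,
    Fintype.card_perm, Fintype.card_fin, nsmul_eq_mul]

/-- Left multiplication by `y` is nilpotent, hence of trace zero, and the trace is `d!` times this
coefficient. -/
lemma coeff_one_of_sq {d : ℕ} (y : B d) (h : y * y = 0) : y.coeff 1 = 0 := by
  have hn : IsNilpotent (LinearMap.mulLeft ℂ y) := ⟨2, by
    rw [pow_two]
    refine LinearMap.ext fun x => ?_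
    rw [Module.End.mul_apply, LinearMap.mulLeft_apply, LinearMap.mulLeft_apply, ← mul_assoc, h,
      zero_mul]
    rfl⟩
  have h1 := (LinearMap.isNilpotent_trace_of_isNilpotent hn).eq_zero
  rw [trace_mulLeft] at h1
  exact (mul_eq_zero.1 h1).resolve_left (Nat.cast_ne_zero.2 d.factorial_ne_zero)

/-- The group algebra of `S_d` is semiprime. -/
lemma eq_zero_of_mul_mul {d : ℕ} (x : B d)
    (h : ∀ g, x * MonoidAlgebra.of ℂ _ g * x = 0) : x = 0 := by
  ext g
  -- The element `x g⁻¹` has square `(x g⁻¹ x) g⁻¹ = 0`, and its coefficient at `1` is that of `x`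
  -- at `g`.
  have := coeff_one_of_sq (x * MonoidAlgebra.of ℂ _ g⁻¹) (by rw [← mul_assoc, h, zero_mul])
  rw [MonoidAlgebra.of_apply, MonoidAlgebra.coeff_mul_single_apply] at this
  simpa using this

/-! ### Row and column stabilizers -/

section Tableau

variable {d : ℕ} {lam mu : YoungDiagram} (t : lam.cells ≃ Fin d) (s : mu.cells ≃ Fin d)

/-- The row of the label `x` in the tableau `t`. -/
def row (x : Fin d) : ℕ := (t.symm x).1.1

/-- The column of the label `x` in the tableau `t`. -/
def col (x : Fin d) : ℕ := (t.symm x).1.2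

/-- The permutation `g` preserves the rows of `t`. -/
def IsRow (g : Equiv.Perm (Fin d)) : Prop := ∀ i, row t (g i) = row t i

/-- The permutation `g` preserves the columns of `t`. -/
def IsCol (g : Equiv.Perm (Fin d)) : Prop := ∀ i, col t (g i) = col t i

/-- The Young symmetrizer `a_λ b_λ`. -/
def young : B d := rowSum lam t * colSum lam t

variable {t}

lemma row_col_inj {x y : Fin d} (h : row t x = row t y) (h' : col t x = col t y) : x = y :=
  t.symm.injective (Subtype.ext (Prod.ext h h'))

lemma mem_row_col (x : Fin d) : (row t x, col t x) ∈ lam := (t.symm x).2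

lemma row_apply (c : lam.cells) : row t (t c) = c.1.1 := by simp [row]

lemma col_apply (c : lam.cells) : col t (t c) = c.1.2 := by simp [col]

lemma IsRow.mul {g h : Equiv.Perm (Fin d)} (hg : IsRow t g) (hh : IsRow t h) : IsRow t (g * h) :=
  fun i => (hg _).trans (hh i)

lemma IsRow.inv {g : Equiv.Perm (Fin d)} (hg : IsRow t g) : IsRow t g⁻¹ := fun i => by
  simpa using (hg (g⁻¹ i)).symm

lemma IsCol.mul {g h : Equiv.Perm (Fin d)} (hg : IsCol t g) (hh : IsCol t h) : IsCol t (g * h) :=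
  fun i => (hg _).trans (hh i)

lemma IsCol.inv {g : Equiv.Perm (Fin d)} (hg : IsCol t g) : IsCol t g⁻¹ := fun i => by
  simpa using (hg (g⁻¹ i)).symm

lemma eq_one_of_isRow_isCol {g : Equiv.Perm (Fin d)} (hr : IsRow t g) (hc : IsCol t g) : g = 1 :=
  Equiv.ext fun i => row_col_inj (hr i) (hc i)

variable (t)

open Classical in
lemma rowSum_eq : rowSum lam t =
    ∑ g ∈ Finset.univ.filter (IsRow t), MonoidAlgebra.of ℂ _ g :=
  Finset.sum_congr (Finset.ext fun g => by simp [IsRow, row]) fun _ _ => rfl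

open Classical in
lemma colSum_eq : colSum lam t = ∑ g ∈ Finset.univ.filter (IsCol t),
    ((Equiv.Perm.sign g : ℤ) : ℂ) • MonoidAlgebra.of ℂ _ g :=
  Finset.sum_congr (Finset.ext fun g => by simp [IsCol, col]) fun _ _ => rfl

open Classical in
lemma coeff_rowSum (g : Equiv.Perm (Fin d)) :
    (rowSum lam t).coeff g = if IsRow t g then 1 else 0 := by
  rw [rowSum_eq, MonoidAlgebra.coeff_sum, Finsupp.finsetSum_apply]
  simp [Finsupp.single_apply, Finset.sum_ite_eq']

open Classical in
lemma coeff_colSum (g : Equiv.Perm (Fin d)) :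
    (colSum lam t).coeff g = if IsCol t g then ((Equiv.Perm.sign g : ℤ) : ℂ) else 0 := by
  rw [colSum_eq, MonoidAlgebra.coeff_sum, Finsupp.finsetSum_apply]
  simp [Finsupp.single_apply, Finset.sum_ite_eq']

variable {t}

lemma of_mul_rowSum {p : Equiv.Perm (Fin d)} (hp : IsRow t p) :
    MonoidAlgebra.of ℂ _ p * rowSum lam t = rowSum lam t := by
  ext g
  rw [MonoidAlgebra.of_apply, MonoidAlgebra.coeff_single_mul_apply, one_mul, coeff_rowSum,
    coeff_rowSum]
  congr 1
  exact propext ⟨fun h => by simpa using hp.mul h, fun h => hp.inv.mul h⟩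

lemma rowSum_mul_of {p : Equiv.Perm (Fin d)} (hp : IsRow t p) :
    rowSum lam t * MonoidAlgebra.of ℂ _ p = rowSum lam t := by
  ext g
  rw [MonoidAlgebra.of_apply, MonoidAlgebra.coeff_mul_single_apply, mul_one, coeff_rowSum,
    coeff_rowSum]
  congr 1
  exact propext ⟨fun h => by simpa using h.mul hp, fun h => h.mul hp.inv⟩

lemma of_mul_colSum {q : Equiv.Perm (Fin d)} (hq : IsCol t q) :
    MonoidAlgebra.of ℂ _ q * colSum lam t = ((Equiv.Perm.sign q : ℤ) : ℂ) • colSum lam t := by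
  ext g
  rw [MonoidAlgebra.of_apply, MonoidAlgebra.coeff_single_mul_apply, one_mul, coeff_colSum,
    MonoidAlgebra.coeff_smul_apply, coeff_colSum]
  have : IsCol t (q⁻¹ * g) ↔ IsCol t g := ⟨fun h => by simpa using hq.mul h, fun h => hq.inv.mul h⟩
  by_cases h : IsCol t g <;> simp [h, this.not.2, this.2]

lemma colSum_mul_of {q : Equiv.Perm (Fin d)} (hq : IsCol t q) :
    colSum lam t * MonoidAlgebra.of ℂ _ q = ((Equiv.Perm.sign q : ℤ) : ℂ) • colSum lam t := by
  ext g
  rw [MonoidAlgebra.of_apply, MonoidAlgebra.coeff_mul_single_apply, mul_one, coeff_colSum,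
    MonoidAlgebra.coeff_smul_apply, coeff_colSum]
  have : IsCol t (g * q⁻¹) ↔ IsCol t g := ⟨fun h => by simpa using h.mul hq, fun h => h.mul hq.inv⟩
  by_cases h : IsCol t g <;> simp [h, this.not.2, this.2, mul_comm]

lemma isRow_swap {x y : Fin d} (h : row t x = row t y) : IsRow t (Equiv.swap x y) := fun i => by
  rw [Equiv.swap_apply_def]
  split_ifs with h1 h2
  · rw [h1, h]
  · rw [h2, h]
  · rfl

lemma isCol_swap {x y : Fin d} (h : col t x = col t y) : IsCol t (Equiv.swap x y) := fun i => by
  rw [Equiv.swap_apply_def]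
  split_ifs with h1 h2
  · rw [h1, h]
  · rw [h2, h]
  · rfl

/-- The transposition of `x` and `y` is absorbed by the row sum and changes the sign of the column
sum, so inserting it shows that the product is its own negative. -/
lemma rowSum_mul_colSum_eq_zero {x y : Fin d} (hxy : x ≠ y) (hr : row t x = row t y)
    (hc : col s x = col s y) : rowSum lam t * colSum mu s = 0 := by
  have h : rowSum lam t * colSum mu s = -(rowSum lam t * colSum mu s) := by
    conv_lhs => rw [← rowSum_mul_of (isRow_swap hr), mul_assoc, of_mul_colSum (isCol_swap hc),
      Equiv.Perm.sign_swap hxy]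
    simp
  exact eq_zero_of_eq_neg h

lemma colSum_mul_rowSum_eq_zero {x y : Fin d} (hxy : x ≠ y) (hr : row t x = row t y)
    (hc : col s x = col s y) : colSum mu s * rowSum lam t = 0 := by
  have h : colSum mu s * rowSum lam t = -(colSum mu s * rowSum lam t) := by
    conv_lhs => rw [← of_mul_rowSum (isRow_swap hr), ← mul_assoc, colSum_mul_of (isCol_swap hc),
      Equiv.Perm.sign_swap hxy]
    simp
  exact eq_zero_of_eq_neg h

variable (t)

/-- Relabelling a tableau by `g` conjugates its row group by `g`. This form lets a group element be
moved past a row sum at the cost of relabelling. -/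
lemma rowSum_trans (g : Equiv.Perm (Fin d)) :
    rowSum lam (t.trans g) * MonoidAlgebra.of ℂ _ g = MonoidAlgebra.of ℂ _ g * rowSum lam t := by
  ext h
  rw [MonoidAlgebra.of_apply, MonoidAlgebra.coeff_mul_single_apply,
    MonoidAlgebra.coeff_single_mul_apply, mul_one, one_mul, coeff_rowSum, coeff_rowSum]
  congr 1
  refine propext ⟨fun H i => ?_, fun H i => ?_⟩
  · simpa [row] using H (g i)
  · simpa [row] using H (g⁻¹ i)

lemma colSum_trans (g : Equiv.Perm (Fin d)) :
    colSum lam (t.trans g) * MonoidAlgebra.of ℂ _ g = MonoidAlgebra.of ℂ _ g * colSum lam t := by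
  ext h
  rw [MonoidAlgebra.of_apply, MonoidAlgebra.coeff_mul_single_apply,
    MonoidAlgebra.coeff_single_mul_apply, mul_one, one_mul, coeff_colSum, coeff_colSum]
  have : IsCol (t.trans g) (h * g⁻¹) ↔ IsCol t (g⁻¹ * h) := by
    refine ⟨fun H i => ?_, fun H i => ?_⟩
    · simpa [col] using H (g i)
    · simpa [col] using H (g⁻¹ i)
  by_cases h' : IsCol t (g⁻¹ * h) <;> simp [h', this.not.2, this.2, mul_comm]

lemma young_trans (g : Equiv.Perm (Fin d)) :
    young (t.trans g) * MonoidAlgebra.of ℂ _ g = MonoidAlgebra.of ℂ _ g * young t := by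
  rw [young, young, mul_assoc, colSum_trans, ← mul_assoc, rowSum_trans, mul_assoc]

/-! ### Dominance -/

/-- By `hinj`, a column of `s` contains at most one label from each row of `t`, so at most `r`
labels from the first `r` rows, and never more than its length. The first `r` rows of `s` meet that
column in the minimum of these two numbers. -/
lemma card_col_le (hinj : ∀ x y, row t x = row t y → col s x = col s y → x = y) (c r : ℕ) :
    (Finset.univ.filter fun x => row t x < r ∧ col s x = c).card ≤
      (Finset.univ.filter fun x => row s x < r ∧ col s x = c).card := by
  by_cases hr : ∀ i < r, (i, c) ∈ mu
  · calc _ ≤ (Finset.range r).card := by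
          refine Finset.card_le_card_of_injOn (row t) (fun x hx => ?_) (fun x hx y hy h => ?_)
          · simp at hx ⊢; exact hx.1
          · simp at hx hy; exact hinj x y h (hx.2.trans hy.2.symm)
      _ ≤ _ := by
          refine Finset.card_le_card_of_surjOn (row s) fun i hi => ?_
          have hi : i < r := by simpa using hi
          refine ⟨s ⟨(i, c), hr i hi⟩, ?_, row_apply _⟩
          simp [row_apply, col_apply, hi]
  · push Not at hr
    obtain ⟨i, hi, hic⟩ := hr
    refine Finset.card_le_card fun x hx => ?_
    simp only [Finset.mem_filter, Finset.mem_univ, true_and] at hx ⊢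
    refine ⟨?_, hx.2⟩
    by_contra hlt
    have := mem_row_col (t := s) x
    rw [hx.2] at this
    exact hic (mu.up_left_mem (by omega) le_rfl this)

lemma card_row_eq_sum (r : ℕ) : (Finset.univ.filter fun x => row t x < r).card =
    ∑ c ∈ Finset.univ.image (col s),
      (Finset.univ.filter fun x => row t x < r ∧ col s x = c).card := by
  rw [Finset.card_eq_sum_card_fiberwise (f := col s) (t := Finset.univ.image (col s))
    (fun x _ => Finset.mem_coe.2 (Finset.mem_image_of_mem _ (Finset.mem_univ x)))]
  simp only [Finset.filter_filter]

/-- Summing over the columns of `s` yields the dominance order: the shape of `t` is dominated by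
that of `s`. -/
lemma card_row_le (hinj : ∀ x y, row t x = row t y → col s x = col s y → x = y) (r : ℕ) :
    (Finset.univ.filter fun x => row t x < r).card ≤
      (Finset.univ.filter fun x => row s x < r).card := by
  rw [card_row_eq_sum t s, card_row_eq_sum s s]
  exact Finset.sum_le_sum fun c _ => card_col_le t s hinj c r

lemma card_row_eq (r : ℕ) : (Finset.univ.filter fun x => row t x < r).card =
    (lam.cells.filter fun c => c.1 < r).card := by
  refine Finset.card_bij (fun x _ => (t.symm x).1) (fun x hx => ?_) (fun x _ y _ h => ?_)
    (fun c hc => ?_)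
  · exact Finset.mem_filter.2 ⟨(t.symm x).2, (Finset.mem_filter.1 hx).2⟩
  · exact t.symm.injective (Subtype.ext h)
  · rw [Finset.mem_filter] at hc
    exact ⟨t ⟨c, hc.1⟩, Finset.mem_filter.2 ⟨Finset.mem_univ _, by rw [row_apply]; exact hc.2⟩, by simp⟩

/-- Antisymmetry of dominance: row lengths are the differences of consecutive partial sums. -/
lemma eq_of_card_row (h : ∀ r, (lam.cells.filter fun c => c.1 < r).card =
    (mu.cells.filter fun c => c.1 < r).card) : lam = mu := by
  have key : ∀ (nu : YoungDiagram) r, (nu.cells.filter fun c => c.1 < r + 1).card =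
      (nu.cells.filter fun c => c.1 < r).card + nu.rowLen r := by
    intro nu r
    rw [YoungDiagram.rowLen_eq_card, YoungDiagram.row, ← Finset.card_union_of_disjoint]
    · congr 1
      ext c
      simp only [Finset.mem_filter, Finset.mem_union]
      rw [← and_or_left, Nat.lt_succ_iff_lt_or_eq]
    · rw [Finset.disjoint_filter]
      intro c _ h; omega
  have hrow : ∀ r, lam.rowLen r = mu.rowLen r := fun r => by
    have h1 := key lam r
    have h2 := key mu r
    rw [h, h] at h1
    omega
  ext ⟨i, j⟩
  rw [YoungDiagram.mem_cells, YoungDiagram.mem_cells, YoungDiagram.mem_iff_lt_rowLen,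
    YoungDiagram.mem_iff_lt_rowLen, hrow]

variable {t s}

lemma exists_row_col (h : ¬ ∀ r, (lam.cells.filter fun c => c.1 < r).card ≤
    (mu.cells.filter fun c => c.1 < r).card) : ∃ x y, x ≠ y ∧ row t x = row t y ∧
      col s x = col s y := by
  by_contra hcon
  push Not at hcon
  refine h fun r => ?_
  rw [← card_row_eq t, ← card_row_eq s]
  exact card_row_le t s (fun x y hr hc => by_contra fun hxy => hcon x y hxy hr hc) r

/-- For a group element `x = g`, moving `g` past the column sum turns `s` into `s.trans g`. Failure
of dominance depends on the shapes alone, so a pair of labels sharing a row and a column still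
exists. -/
lemma rowSum_mul_mul_colSum (h : ¬ ∀ r, (lam.cells.filter fun c => c.1 < r).card ≤
    (mu.cells.filter fun c => c.1 < r).card) (x : B d) :
    rowSum lam t * x * colSum mu s = 0 := by
  induction x using MonoidAlgebra.induction_on with
  | of g =>
    obtain ⟨x, y, hxy, hr, hc⟩ := exists_row_col (t := t) (s := s.trans g) h
    rw [mul_assoc, ← colSum_trans, ← mul_assoc, rowSum_mul_colSum_eq_zero _ hxy hr hc, zero_mul]
  | add x y hx hy => rw [mul_add, add_mul, hx, hy, add_zero]
  | smul c x hx => rw [mul_smul_comm, smul_mul_assoc, hx, smul_zero]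

lemma colSum_mul_mul_rowSum (h : ¬ ∀ r, (lam.cells.filter fun c => c.1 < r).card ≤
    (mu.cells.filter fun c => c.1 < r).card) (x : B d) :
    colSum mu s * x * rowSum lam t = 0 := by
  induction x using MonoidAlgebra.induction_on with
  | of g =>
    obtain ⟨x, y, hxy, hr, hc⟩ := exists_row_col (t := t.trans g) (s := s) h
    rw [mul_assoc, ← rowSum_trans, ← mul_assoc, colSum_mul_rowSum_eq_zero _ hxy hr hc, zero_mul]
  | add x y hx hy => rw [mul_add, add_mul, hx, hy, add_zero]
  | smul c x hx => rw [mul_smul_comm, smul_mul_assoc, hx, smul_zero]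

/-- The two-sided ideals of distinct partitions annihilate each other. -/
lemma young_mul_mul_young (h : lam ≠ mu) (x : B d) : young t * x * young s = 0 := by
  -- Distinct shapes cannot dominate each other. If `mu` is not dominated by `lam`, the inner factor
  -- `b_λ x a_μ` vanishes; if `lam` is not dominated by `mu`, the outer factors `a_λ ⋯ b_μ` give
  -- zero.
  by_cases h1 : ∀ r, (lam.cells.filter fun c => c.1 < r).card ≤
    (mu.cells.filter fun c => c.1 < r).card
  · have h2 : ¬ ∀ r, (mu.cells.filter fun c => c.1 < r).card ≤
      (lam.cells.filter fun c => c.1 < r).card := fun h2 =>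
        h (eq_of_card_row fun r => le_antisymm (h1 r) (h2 r))
    have := colSum_mul_mul_rowSum (t := s) (s := t) h2 x
    rw [young, young, mul_assoc, mul_assoc, ← mul_assoc x, ← mul_assoc (colSum lam t),
      ← mul_assoc (colSum lam t), this, zero_mul, mul_zero]
  · have := rowSum_mul_mul_colSum (t := t) (s := s) h1 (colSum lam t * x * rowSum mu s)
    rw [young, young, ← this]
    simp only [mul_assoc]

/-! ### Young symmetrizers are quasi-idempotent -/

/-- Von Neumann's lemma: each label can be slid along its row of `t` to the column which it occupies
in `t.trans g`, and this sliding is the inverse of the row factor. -/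
lemma exists_isRow_mul_isCol (g : Equiv.Perm (Fin d))
    (hinj : ∀ x y, row t x = row t y → col (t.trans g) x = col (t.trans g) y → x = y) :
    ∃ p q, IsRow t p ∧ IsCol t q ∧ g = p * q := by
  -- Both tableaux have the same shape, so the inequalities of `card_col_le` have equal sums over
  -- the columns; hence each of them is an equality.
  have hcard : ∀ c r, (Finset.univ.filter fun x => row t x < r ∧ col (t.trans g) x = c).card =
      (Finset.univ.filter fun x => row (t.trans g) x < r ∧ col (t.trans g) x = c).card := by
    intro c r
    by_cases hc : c ∈ Finset.univ.image (col (t.trans g))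
    · refine (Finset.sum_eq_sum_iff_of_le fun c _ => card_col_le t (t.trans g) hinj c r).1 ?_ c hc
      rw [← card_row_eq_sum, ← card_row_eq_sum, card_row_eq, card_row_eq]
    · have : ∀ x, col (t.trans g) x ≠ c := fun x hx =>
        hc (Finset.mem_image.2 ⟨x, Finset.mem_univ x, hx⟩)
      simp [this]
  -- Because of `x` itself, the count on the side of `t` increases when the row of `x` is included.
  -- By `hcard` so does the count for `t.trans g`, whose column thus has a box in that row.
  have hmem : ∀ x, (row t x, col (t.trans g) x) ∈ lam := by
    intro x
    have h1 : (Finset.univ.filter fun y => row t y < row t x ∧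
        col (t.trans g) y = col (t.trans g) x).card < (Finset.univ.filter fun y =>
          row t y < row t x + 1 ∧ col (t.trans g) y = col (t.trans g) x).card := by
      refine Finset.card_lt_card ⟨fun y hy => ?_, fun hsub => ?_⟩
      · simp only [Finset.mem_filter, Finset.mem_univ, true_and] at hy ⊢
        exact ⟨by omega, hy.2⟩
      · have := hsub (Finset.mem_filter.2 ⟨Finset.mem_univ x, by omega, rfl⟩)
        simp at this
    rw [hcard, hcard] at h1
    by_contra hcon
    refine absurd (Finset.card_le_card fun y hy => ?_) (not_le.2 h1)
    simp only [Finset.mem_filter, Finset.mem_univ, true_and] at hy ⊢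
    refine ⟨lt_of_le_of_ne (by omega) fun heq => hcon ?_, hy.2⟩
    have := mem_row_col (t := t.trans g) y
    rwa [heq, hy.2] at this
  -- The row of `h x` in `t` is that of `x`, and its column in `t` is the column of `x` in `t.trans
  -- g`. So `h` preserves rows of `t`, and `h ∘ g` preserves columns.
  let h : Fin d → Fin d := fun x => t ⟨_, hmem x⟩
  have hr : ∀ x, row t (h x) = row t x := fun x => row_apply _
  have hc : ∀ x, col t (h x) = col (t.trans g) x := fun x => col_apply _
  have hbij : Function.Bijective h := Finite.injective_iff_bijective.1 fun x y hxy =>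
    hinj x y (by rw [← hr, hxy, hr]) (by rw [← hc, hxy, hc])
  let p : Equiv.Perm (Fin d) := Equiv.ofBijective h hbij
  have hp : IsRow t p := hr
  refine ⟨p⁻¹, p * g, hp.inv, fun x => ?_, by simp⟩
  change col t (h (g x)) = _
  rw [hc]
  simp [col]

/-- For a group element, either it factors as row times column permutation and is absorbed up to the
sign of the column factor, or a transposition kills the product. -/
lemma rowSum_mul_mul_colSum_self (x : B d) :
    ∃ k : ℂ, rowSum lam t * x * colSum lam t = k • young t := by
  induction x using MonoidAlgebra.induction_on with
  | of g =>
    by_cases hinj : ∀ x y, row t x = row t y → col (t.trans g) x = col (t.trans g) y → x = y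
    · obtain ⟨p, q, hp, hq, rfl⟩ := exists_isRow_mul_isCol g hinj
      refine ⟨((Equiv.Perm.sign q : ℤ) : ℂ), ?_⟩
      rw [map_mul, ← mul_assoc, rowSum_mul_of hp, mul_assoc, of_mul_colSum hq, mul_smul_comm,
        young]
    · push Not at hinj
      obtain ⟨x, y, hr, hc, hxy⟩ := hinj
      refine ⟨0, ?_⟩
      rw [mul_assoc, ← colSum_trans, ← mul_assoc, rowSum_mul_colSum_eq_zero _ hxy hr hc, zero_mul,
        zero_smul]
  | add x y hx hy =>
    obtain ⟨k, hk⟩ := hx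
    obtain ⟨l, hl⟩ := hy
    exact ⟨k + l, by rw [mul_add, add_mul, hk, hl, add_smul]⟩
  | smul c x hx =>
    obtain ⟨k, hk⟩ := hx
    exact ⟨c * k, by rw [mul_smul_comm, smul_mul_assoc, hk, mul_smul]⟩

lemma young_mul_mul_young_self (x : B d) : ∃ k : ℂ, young t * x * young t = k • young t := by
  obtain ⟨k, hk⟩ := rowSum_mul_mul_colSum_self (t := t) (colSum lam t * x * rowSum lam t)
  refine ⟨k, ?_⟩
  rw [← hk, young]
  simp only [mul_assoc]

/-- A row permutation and a column permutation with product `1` are both trivial, so the identity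
arises only once in the expansion. -/
lemma coeff_young_one : (young t).coeff 1 = 1 := by
  classical
  rw [young, rowSum_eq, Finset.sum_mul, MonoidAlgebra.coeff_sum, Finsupp.finsetSum_apply,
    Finset.sum_eq_single 1]
  · have h1 : IsCol t (1⁻¹ * 1) := fun i => by simp
    rw [MonoidAlgebra.of_apply, MonoidAlgebra.coeff_single_mul_apply, coeff_colSum, if_pos h1]
    simp
  · intro g hg hg1
    rw [MonoidAlgebra.of_apply, MonoidAlgebra.coeff_single_mul_apply, coeff_colSum, if_neg,
      mul_zero]
    intro h
    refine hg1 (eq_one_of_isRow_isCol (Finset.mem_filter.1 hg).2 ?_)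
    simpa using h.inv
  · intro h
    exact absurd (Finset.mem_filter.2 ⟨Finset.mem_univ _, fun _ => rfl⟩) h

/-- The trace argument shows that the quasi-idempotent is not nilpotent, without evaluating the
scalar `n_λ`. -/
lemma young_sq_ne_zero : young t * young t ≠ 0 := fun h => by
  have := coeff_one_of_sq _ h
  rw [coeff_young_one] at this
  exact one_ne_zero this

lemma mem_specht {x : B d} : x ∈ specht lam t ↔ ∃ y, y * young t = x :=
  Submodule.mem_span_singleton

end Tableau

/-- Linear independence of homomorphisms out of irreducible representations attached to distinct
partitions. -/
lemma eq_zero_of_sum_smul {d : ℕ} {R N ι : Type} [Ring R] [AddCommGroup N] [Module R N] [Fintype ι]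
    (φ : B d →+* R) (lam : ι → YoungDiagram) (hlam : Function.Injective lam)
    (t : ∀ i, (lam i).cells ≃ Fin d) (m : ι → N) (hm : ∀ i, φ (young (t i)) • m i ≠ 0)
    (x : ∀ i, specht (lam i) (t i)) (hx : ∑ i, φ (x i : B d) • m i = 0) : x = 0 := by
  classical
  have key : ∀ i (g : B d), young (t i) * g * (x i : B d) = 0 := by
    intro i g
    obtain ⟨y, hy⟩ := mem_specht.1 (x i).2
    obtain ⟨k, hk⟩ := young_mul_mul_young_self (t := t i) (g * y)
    have hk' : young (t i) * g * (x i : B d) = k • young (t i) := by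
      rw [← hk, ← hy]
      simp only [mul_assoc]
    have h1 : φ (k • young (t i)) • m i = 0 := by
      rw [← hk', ← smul_zero (φ (young (t i) * g)), ← hx, Finset.smul_sum,
        Finset.sum_eq_single i]
      · rw [map_mul, mul_smul]
      · intro j _ hj
        obtain ⟨z, hz⟩ := mem_specht.1 (x j).2
        have h0 : young (t i) * g * (x j : B d) = 0 := by
          rw [← hz, ← mul_assoc, mul_assoc (young (t i))]
          exact young_mul_mul_young (fun h => hj (hlam h).symm) _
        rw [← mul_smul, ← map_mul, h0, map_zero, zero_smul]
      · exact fun h => absurd (Finset.mem_univ i) h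
    have hk0 : k = 0 := by
      by_contra hk0
      refine hm i ?_
      have : young (t i) = k⁻¹ • 1 * (k • young (t i)) := by
        rw [smul_mul_smul_comm, one_mul, inv_mul_cancel₀ hk0, one_smul]
      rw [this, map_mul, mul_smul, h1, smul_zero]
    rw [hk', hk0, zero_smul]
  funext i
  -- Since `x i` is a left multiple of `young (t i)`, `key` gives `x i * g * x i = 0` for every `g`,
  -- and semiprimeness concludes.
  refine Subtype.ext (eq_zero_of_mul_mul _ fun g => ?_)
  obtain ⟨y, hy⟩ := mem_specht.1 (x i).2
  have h := key i (MonoidAlgebra.of ℂ _ g)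
  rw [← hy, mul_assoc, mul_assoc, ← mul_assoc (young (t i)), hy, h, mul_zero]

/-! ### Projection to a Young subgroup -/

section BlockProj

variable {d n : ℕ}

lemma blockPerm_injective {σ σ' : Equiv.Perm (Fin d)} {τ τ' : Equiv.Perm (Fin n)}
    (h : blockPerm d n σ τ = blockPerm d n σ' τ') : σ = σ' ∧ τ = τ' := by
  constructor
  · ext i
    have := congrArg (fun g => (g (Fin.castAdd n i)).val) h
    simpa using this
  · ext i
    have := congrArg (fun g => (g (Fin.natAdd d i)).val) h
    simpa using this

lemma exists_blockPerm_of_natAdd (g : Equiv.Perm (Fin (d + n)))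
    (h : ∀ j, ∃ j', g (Fin.natAdd d j) = Fin.natAdd d j') :
    ∃ σ τ, blockPerm d n σ τ = g := by
  have hm : Set.MapsTo (finSumFinEquiv.symm.permCongr g : Equiv.Perm (Fin d ⊕ Fin n))
      (Set.range Sum.inl) (Set.range Sum.inl) := by
    rw [Equiv.Perm.perm_mapsTo_inl_iff_mapsTo_inr]
    rintro _ ⟨i, rfl⟩
    obtain ⟨j', hj⟩ := h i
    exact ⟨j', by simp [Equiv.permCongr_apply, hj]⟩
  obtain ⟨⟨a, b⟩, hab⟩ := Equiv.Perm.mem_sumCongrHom_range_of_perm_mapsTo_inl hm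
  refine ⟨a, b, ?_⟩
  have hab' : Equiv.sumCongr a b = finSumFinEquiv.symm.permCongr g := hab
  rw [blockPerm, hab']
  ext i
  simp [Equiv.permCongr_apply]

/-- The inclusion `S_d → S_{d+n}`. -/
def leftPerm (d n : ℕ) : Equiv.Perm (Fin d) →* Equiv.Perm (Fin (d + n)) where
  toFun σ := blockPerm d n σ 1
  map_one' := blockPerm_one d n
  map_mul' σ τ := by rw [← blockPerm_mul, one_mul]

/-- The inclusion `ℂ[S_d] → ℂ[S_{d+n}]`. -/
def blockIncl (d n : ℕ) : B d →ₐ[ℂ] B (d + n) := MonoidAlgebra.mapDomainAlgHom ℂ ℂ (leftPerm d n)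

lemma blockIncl_of (σ : Equiv.Perm (Fin d)) :
    blockIncl d n (MonoidAlgebra.of ℂ _ σ) = MonoidAlgebra.of ℂ _ (blockPerm d n σ 1) :=
  MonoidAlgebra.mapDomain_single

/-- The projection `ℂ[S_{d+n}] → ℂ[S_d × S_n] → ℂ[S_d]`. -/
def blockProj (d n : ℕ) : B (d + n) →ₗ[ℂ] B d where
  toFun x := ∑ σ, ∑ τ, x.coeff (blockPerm d n σ τ) • MonoidAlgebra.of ℂ _ σ
  map_add' x y := by
    simp only [MonoidAlgebra.coeff_add, Finsupp.add_apply, add_smul, Finset.sum_add_distrib]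
  map_smul' c x := by
    simp only [MonoidAlgebra.coeff_smul_apply, smul_assoc, Finset.smul_sum, RingHom.id_apply]

lemma blockProj_apply (x : B (d + n)) :
    blockProj d n x = ∑ σ, ∑ τ, x.coeff (blockPerm d n σ τ) • MonoidAlgebra.of ℂ _ σ := rfl

lemma blockProj_block (σ : Equiv.Perm (Fin d)) (τ : Equiv.Perm (Fin n)) :
    blockProj d n (MonoidAlgebra.of ℂ _ (blockPerm d n σ τ)) = MonoidAlgebra.of ℂ _ σ := by
  classical
  rw [blockProj_apply, Finset.sum_eq_single σ, Finset.sum_eq_single τ]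
  · simp
  · intro τ' _ h
    rw [MonoidAlgebra.of_apply, MonoidAlgebra.coeff_single,
      Finsupp.single_eq_of_ne fun e => h (blockPerm_injective e).2, zero_smul]
  · simp
  · intro σ' _ h
    refine Finset.sum_eq_zero fun τ' _ => ?_
    rw [MonoidAlgebra.of_apply, MonoidAlgebra.coeff_single,
      Finsupp.single_eq_of_ne fun e => h (blockPerm_injective e).1, zero_smul]
  · simp

lemma blockProj_of_ne (g : Equiv.Perm (Fin (d + n))) (hg : ∀ σ τ, blockPerm d n σ τ ≠ g) :
    blockProj d n (MonoidAlgebra.of ℂ _ g) = 0 := by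
  refine Finset.sum_eq_zero fun σ _ => Finset.sum_eq_zero fun τ _ => ?_
  rw [MonoidAlgebra.of_apply, MonoidAlgebra.coeff_single, Finsupp.single_eq_of_ne (hg σ τ),
    zero_smul]

/-- Multiplication by an element of the Young subgroup preserves both this subgroup and its
complement, and the push-forward to `S_d` forgets `τ`. -/
lemma blockProj_mul_block (x : B (d + n)) (σ : Equiv.Perm (Fin d)) (τ : Equiv.Perm (Fin n)) :
    blockProj d n (x * MonoidAlgebra.of ℂ _ (blockPerm d n σ τ)) =
      blockProj d n x * MonoidAlgebra.of ℂ _ σ := by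
  induction x using MonoidAlgebra.induction_on with
  | of g =>
    rw [← map_mul]
    by_cases h : ∃ σ τ, blockPerm d n σ τ = g
    · obtain ⟨σ', τ', rfl⟩ := h
      rw [← blockPerm_mul, blockProj_block, blockProj_block, map_mul]
    · push Not at h
      rw [blockProj_of_ne g h, blockProj_of_ne, zero_mul]
      intro σ' τ' e
      refine h (σ' * σ⁻¹) (τ' * τ⁻¹) ?_
      rw [blockPerm_mul, e, ← blockPerm_inv, mul_inv_cancel_right]
  | add x y hx hy => rw [add_mul, map_add, map_add, hx, hy, add_mul]
  | smul c x hx => rw [smul_mul_assoc, map_smul, map_smul, hx, smul_mul_assoc]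

lemma blockProj_block_mul (x : B (d + n)) (σ : Equiv.Perm (Fin d)) (τ : Equiv.Perm (Fin n)) :
    blockProj d n (MonoidAlgebra.of ℂ _ (blockPerm d n σ τ) * x) =
      MonoidAlgebra.of ℂ _ σ * blockProj d n x := by
  induction x using MonoidAlgebra.induction_on with
  | of g =>
    rw [← map_mul]
    by_cases h : ∃ σ τ, blockPerm d n σ τ = g
    · obtain ⟨σ', τ', rfl⟩ := h
      rw [← blockPerm_mul, blockProj_block, blockProj_block, map_mul]
    · push Not at h
      rw [blockProj_of_ne g h, blockProj_of_ne, mul_zero]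
      intro σ' τ' e
      refine h (σ⁻¹ * σ') (τ⁻¹ * τ') ?_
      rw [blockPerm_mul, e, ← blockPerm_inv, inv_mul_cancel_left]
  | add x y hx hy => rw [mul_add, map_add, map_add, hx, hy, mul_add]
  | smul c x hx => rw [mul_smul_comm, map_smul, map_smul, hx, mul_smul_comm]

lemma blockProj_mul_incl (x : B (d + n)) (y : B d) :
    blockProj d n (x * blockIncl d n y) = blockProj d n x * y := by
  induction y using MonoidAlgebra.induction_on with
  | of g => rw [blockIncl_of, blockProj_mul_block]
  | add y z hy hz => rw [map_add, mul_add, map_add, hy, hz, mul_add]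
  | smul c y hy => rw [map_smul, mul_smul_comm, map_smul, hy, mul_smul_comm]

lemma blockProj_incl_mul (x : B (d + n)) (y : B d) :
    blockProj d n (blockIncl d n y * x) = y * blockProj d n x := by
  induction y using MonoidAlgebra.induction_on with
  | of g => rw [blockIncl_of, blockProj_block_mul]
  | add y z hy hz => rw [map_add, add_mul, map_add, hy, hz, add_mul]
  | smul c y hy => rw [map_smul, smul_mul_assoc, map_smul, hy, smul_mul_assoc]

end BlockProj

/-! ### Extensions of tableaux by horizontal strips -/

section Extension

variable {d n : ℕ} {lam mu : YoungDiagram} (t : lam.cells ≃ Fin d) (u : mu.cells ≃ Fin (d + n))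

/-- The tableau `u` extends the tableau `t`. -/
def Extends : Prop := ∀ i, (u.symm (Fin.castAdd n i)).1 = (t.symm i).1

variable {t u}

lemma Extends.row (h : Extends t u) (i : Fin d) : row u (Fin.castAdd n i) = Fock.row t i :=
  congrArg Prod.fst (h i)

lemma Extends.col (h : Extends t u) (i : Fin d) : col u (Fin.castAdd n i) = Fock.col t i :=
  congrArg Prod.snd (h i)

lemma Interlaces.le (h : Interlaces mu lam) : lam ≤ mu := by
  rintro ⟨i, j⟩ hij
  have hij : (i, j) ∈ lam := hij
  change (i, j) ∈ mu
  rw [YoungDiagram.mem_iff_lt_rowLen] at hij ⊢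
  exact hij.trans_le (h i).1

lemma exists_extends (h : Interlaces mu lam) (hmu : mu.card = d + n) (t : lam.cells ≃ Fin d) :
    ∃ u : mu.cells ≃ Fin (d + n), Extends t u := by
  classical
  let e : {c : mu.cells // c.1 ∈ lam.cells} ≃ lam.cells :=
    { toFun := fun c => ⟨c.1.1, c.2⟩
      invFun := fun c => ⟨⟨c.1, h.le c.2⟩, c.2⟩
      left_inv := fun _ => rfl
      right_inv := fun _ => rfl }
  have h1 : Fintype.card {c : mu.cells // c.1 ∈ lam.cells} = d := by
    rw [Fintype.card_congr (e.trans t), Fintype.card_fin]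
  have h2 : Fintype.card {c : mu.cells // ¬ c.1 ∈ lam.cells} = n := by
    rw [Fintype.card_subtype_compl, h1, Fintype.card_coe]
    have : mu.cells.card = d + n := hmu
    omega
  let f := Fintype.equivFinOfCardEq h2
  refine ⟨(Equiv.sumCompl fun c : mu.cells => c.1 ∈ lam.cells).symm.trans
    ((Equiv.sumCongr (e.trans t) f).trans finSumFinEquiv), fun i => ?_⟩
  simp [e]

/-- A new box is the lowest of its column. A box of `mu` below the new box `(r, c)` would give `c <
mu_{r+1} ≤ lam_r` by interlacing, so that `(r, c)` would already lie in `lam`. -/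
lemma Extends.row_le (hint : Interlaces mu lam) (hext : Extends t u) (j : Fin n) (x : Fin (d + n))
    (hx : Fock.col u x = Fock.col u (Fin.natAdd d j)) :
    Fock.row u x ≤ Fock.row u (Fin.natAdd d j) := by
  by_contra hlt
  have h1 : (Fock.row u (Fin.natAdd d j), Fock.col u (Fin.natAdd d j)) ∉ lam := by
    intro hmem
    have h2 := hext (t ⟨_, hmem⟩)
    rw [Equiv.symm_apply_apply] at h2
    have h3 := congrArg Fin.val (u.symm.injective (Subtype.ext h2))
    have := (t ⟨_, hmem⟩).2
    simp only [Fin.val_castAdd, Fin.val_natAdd] at h3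
    omega
  have h2 := mem_row_col (t := u) x
  rw [hx, YoungDiagram.mem_iff_lt_rowLen] at h2
  rw [YoungDiagram.mem_iff_lt_rowLen] at h1
  have h3 := mu.rowLen_anti _ _ (show Fock.row u (Fin.natAdd d j) + 1 ≤ _ from not_le.1 hlt)
  have h4 := (hint (Fock.row u (Fin.natAdd d j))).2
  omega

/-- New labels sit at the bottom of their columns, so `q` can only move them up, while `p` keeps
rows. As `p q` permutes the new labels, the sum of their row indices is unchanged; hence `q` fixes
the row, and so the position, of each of them. -/
lemma Extends.exists_block (hint : Interlaces mu lam) (hext : Extends t u)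
    {p q : Equiv.Perm (Fin (d + n))} (hp : IsRow u p) (hq : IsCol u q)
    {σ : Equiv.Perm (Fin d)} {τ : Equiv.Perm (Fin n)} (h : blockPerm d n σ τ = p * q) :
    ∃ σ' τ' σ'', blockPerm d n σ' τ' = p ∧ blockPerm d n σ'' 1 = q := by
  have hle : ∀ j, Fock.row u (q (Fin.natAdd d j)) ≤ Fock.row u (Fin.natAdd d j) := fun j =>
    hext.row_le hint j _ (hq _)
  have hg : ∀ j, Fock.row u (q (Fin.natAdd d j)) = Fock.row u (Fin.natAdd d (τ j)) := fun j => by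
    rw [← hp (q _), ← Equiv.Perm.mul_apply, ← h, blockPerm_natAdd]
  have hsum : ∑ j, Fock.row u (q (Fin.natAdd d j)) = ∑ j, Fock.row u (Fin.natAdd d j) := by
    simp only [hg]
    exact Equiv.sum_comp τ fun j => Fock.row u (Fin.natAdd d j)
  have heq := (Finset.sum_eq_sum_iff_of_le fun j _ => hle j).1 hsum
  have hfix : ∀ j, q (Fin.natAdd d j) = Fin.natAdd d j := fun j =>
    row_col_inj (heq j (Finset.mem_univ j)) (hq _)
  obtain ⟨σ'', τ'', rfl⟩ := exists_blockPerm_of_natAdd q fun j => ⟨j, hfix j⟩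
  have hτ : τ'' = 1 := Equiv.ext fun j => by
    have := hfix j
    rw [blockPerm_natAdd] at this
    simpa [Fin.ext_iff] using this
  subst hτ
  refine ⟨σ * σ''⁻¹, τ, σ'', ?_, rfl⟩
  rw [eq_mul_inv_of_mul_eq h.symm, blockPerm_inv, ← blockPerm_mul]
  simp

/-- `blockProj` is not multiplicative in general: two permutations outside the Young subgroup may
have their product inside it. For a row and a column permutation of `u` this is excluded by
`Extends.exists_block`. -/
lemma Extends.blockProj_mul (hint : Interlaces mu lam) (hext : Extends t u)
    {p q : Equiv.Perm (Fin (d + n))} (hp : IsRow u p) (hq : IsCol u q) :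
    blockProj d n (MonoidAlgebra.of ℂ _ p * MonoidAlgebra.of ℂ _ q) =
      blockProj d n (MonoidAlgebra.of ℂ _ p) * blockProj d n (MonoidAlgebra.of ℂ _ q) := by
  by_cases h : ∃ σ τ, blockPerm d n σ τ = p * q
  · obtain ⟨σ, τ, h⟩ := h
    obtain ⟨σ', τ', σ'', rfl, rfl⟩ := hext.exists_block hint hp hq h
    rw [blockProj_mul_block, blockProj_block, blockProj_block]
  · push Not at h
    rw [← map_mul, blockProj_of_ne _ h]
    by_cases hp' : ∃ σ τ, blockPerm d n σ τ = p
    · obtain ⟨σ, τ, rfl⟩ := hp'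
      rw [blockProj_of_ne q, mul_zero]
      rintro σ' τ' rfl
      exact h _ _ (blockPerm_mul _ _ _ _)
    · push Not at hp'
      rw [blockProj_of_ne p hp', zero_mul]

lemma Extends.isRow_block (hext : Extends t u) (σ : Equiv.Perm (Fin d)) (τ : Equiv.Perm (Fin n)) :
    IsRow u (blockPerm d n σ τ) ↔ IsRow t σ ∧
      ∀ j, Fock.row u (Fin.natAdd d (τ j)) = Fock.row u (Fin.natAdd d j) := by
  refine ⟨fun h => ⟨fun i => ?_, fun j => ?_⟩, fun h i => ?_⟩
  · have := h (Fin.castAdd n i)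
    rwa [blockPerm_castAdd, hext.row, hext.row] at this
  · simpa using h (Fin.natAdd d j)
  · refine Fin.addCases (fun i => ?_) (fun j => ?_) i
    · rw [blockPerm_castAdd, hext.row, hext.row, h.1]
    · rw [blockPerm_natAdd, h.2]

/-- A horizontal strip has at most one box in each column, so no column permutation can permute new
labels nontrivially; this is `Extends.exists_block` with `p = 1`. -/
lemma Extends.isCol_block (hint : Interlaces mu lam) (hext : Extends t u)
    (σ : Equiv.Perm (Fin d)) (τ : Equiv.Perm (Fin n)) :
    IsCol u (blockPerm d n σ τ) ↔ IsCol t σ ∧ τ = 1 := by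
  refine ⟨fun h => ⟨fun i => ?_, ?_⟩, ?_⟩
  · have := h (Fin.castAdd n i)
    rwa [blockPerm_castAdd, hext.col, hext.col] at this
  · obtain ⟨_, _, σ'', _, h2⟩ := hext.exists_block hint (p := 1) (fun _ => rfl) h (one_mul _).symm
    exact (blockPerm_injective h2).2.symm
  · rintro ⟨h, rfl⟩ i
    refine Fin.addCases (fun i => ?_) (fun j => ?_) i
    · rw [blockPerm_castAdd, hext.col, hext.col, h]
    · rw [blockPerm_natAdd]; rfl

lemma sign_blockPerm_one (σ : Equiv.Perm (Fin d)) :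
    Equiv.Perm.sign (blockPerm d n σ 1) = Equiv.Perm.sign σ := by
  rw [blockPerm, Equiv.Perm.sign_permCongr, Equiv.Perm.sign_sumCongr, map_one, mul_one]

/-- Old and new labels are permuted independently. The scalar counts the permutations of the new
labels which preserve rows, among which is the identity. -/
lemma Extends.blockProj_rowSum (hext : Extends t u) :
    ∃ k : ℂ, k ≠ 0 ∧ blockProj d n (rowSum mu u) = k • rowSum lam t := by
  classical
  let s := Finset.univ.filter fun τ : Equiv.Perm (Fin n) =>
    ∀ j, Fock.row u (Fin.natAdd d (τ j)) = Fock.row u (Fin.natAdd d j)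
  refine ⟨s.card, Nat.cast_ne_zero.2 (Finset.card_pos.2 ⟨1, ?_⟩).ne', ?_⟩
  · simp [s]
  · rw [blockProj_apply, rowSum_eq t, Finset.smul_sum, Finset.sum_filter]
    refine Finset.sum_congr rfl fun σ _ => ?_
    simp only [coeff_rowSum, hext.isRow_block]
    by_cases h : IsRow t σ
    · simp only [h, true_and, if_true, ite_smul, one_smul, zero_smul]
      rw [← Finset.sum_filter, Finset.sum_const, Nat.cast_smul_eq_nsmul]
    · simp [h]

lemma Extends.blockProj_colSum (hint : Interlaces mu lam) (hext : Extends t u)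
    : blockProj d n (colSum mu u) = colSum lam t := by
  classical
  rw [blockProj_apply, colSum_eq t, Finset.sum_filter]
  refine Finset.sum_congr rfl fun σ _ => ?_
  simp only [coeff_colSum, hext.isCol_block hint]
  rw [Finset.sum_eq_single 1]
  · rw [sign_blockPerm_one]
    by_cases h : IsCol t σ <;> simp [h]
  · intro τ _ hτ
    simp [hτ]
  · simp

/-- The component in `ℂ[S_d × S_n]` of the Young symmetrizer of `μ`, if `μ / λ` is a horizontal
strip. -/
lemma Extends.blockProj_young (hint : Interlaces mu lam) (hext : Extends t u) :
    ∃ k : ℂ, k ≠ 0 ∧ blockProj d n (young u) = k • young t := by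
  classical
  obtain ⟨k, hk, h⟩ := hext.blockProj_rowSum
  refine ⟨k, hk, ?_⟩
  have : blockProj d n (young u) = blockProj d n (rowSum mu u) * blockProj d n (colSum mu u) := by
    rw [young, rowSum_eq, colSum_eq, Finset.sum_mul_sum, map_sum, map_sum, map_sum,
      Finset.sum_mul_sum]
    refine Finset.sum_congr rfl fun p hp => ?_
    rw [map_sum]
    refine Finset.sum_congr rfl fun q hq => ?_
    rw [mul_smul_comm, map_smul, map_smul, mul_smul_comm,
      hext.blockProj_mul hint (Finset.mem_filter.1 hp).2 (Finset.mem_filter.1 hq).2]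
  rw [this, h, hext.blockProj_colSum hint, smul_mul_assoc, young]

/-- This order of the factors detects `V_μ` in the representation induced from `V_λ`. The opposite
order, in `Extends.mul_blockProj_young_ne_zero`, detects `V_λ` in the restriction of `V_μ`. -/
lemma Extends.blockProj_young_mul_ne_zero (hint : Interlaces mu lam) (hext : Extends t u)
    : blockProj d n (young u) * young t ≠ 0 := by
  obtain ⟨k, hk, h⟩ := hext.blockProj_young hint
  rw [h, smul_mul_assoc]
  exact smul_ne_zero hk young_sq_ne_zero

lemma Extends.mul_blockProj_young_ne_zero (hint : Interlaces mu lam) (hext : Extends t u)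
    : young t * blockProj d n (young u) ≠ 0 := by
  obtain ⟨k, hk, h⟩ := hext.blockProj_young hint
  rw [h, mul_smul_comm]
  exact smul_ne_zero hk young_sq_ne_zero

end Extension

/-! ### Horizontal strips in Young's lattice -/

/-- The Young diagram with rows of lengths `f 0, f 1, …`. -/
def ofSeq (f : ℕ → ℕ) (hf : Antitone f) (N : ℕ) : YoungDiagram where
  -- The bound `N` truncates the diagram to finitely many rows; nothing is lost if `f` vanishes from
  -- `N` on, as `rowLen_ofSeq` assumes.
  cells := (Finset.range N ×ˢ Finset.range (f 0)).filter fun c => c.2 < f c.1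
  isLowerSet := by
    rintro ⟨i, j⟩ ⟨i', j'⟩ ⟨hi, hj⟩ h
    simp only [Finset.coe_filter, Finset.mem_product, Finset.mem_range, Set.mem_ofPred_eq] at h ⊢
    simp only at hi hj
    have h1 := hf hi
    have h2 := hf (Nat.zero_le i')
    omega

lemma rowLen_ofSeq (f : ℕ → ℕ) (hf : Antitone f) (N : ℕ) (hN : ∀ i, N ≤ i → f i = 0) (i : ℕ) :
    (ofSeq f hf N).rowLen i = f i := by
  have key : ∀ j, j < (ofSeq f hf N).rowLen i ↔ j < f i := by
    intro j
    rw [← YoungDiagram.mem_iff_lt_rowLen]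
    change (i, j) ∈ Finset.filter _ _ ↔ _
    simp only [Finset.mem_filter, Finset.mem_product, Finset.mem_range]
    refine ⟨fun h => h.2, fun h => ⟨⟨?_, h.trans_le (hf (Nat.zero_le i))⟩, h⟩⟩
    by_contra hi
    rw [hN i (not_lt.1 hi)] at h
    omega
  have h1 := key (f i)
  have h2 := key ((ofSeq f hf N).rowLen i)
  omega

lemma eq_of_rowLen {lam mu : YoungDiagram} (h : ∀ i, lam.rowLen i = mu.rowLen i) : lam = mu := by
  ext ⟨i, j⟩
  rw [YoungDiagram.mem_cells, YoungDiagram.mem_cells, YoungDiagram.mem_iff_lt_rowLen,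
    YoungDiagram.mem_iff_lt_rowLen, h]

lemma rowLen_eq_zero (lam : YoungDiagram) {i : ℕ} (hi : lam.card ≤ i) : lam.rowLen i = 0 := by
  by_contra h
  have hmem : (i, 0) ∈ lam := YoungDiagram.mem_iff_lt_rowLen.2 (Nat.pos_of_ne_zero h)
  have h1 : (Finset.range (i + 1)).image (fun a => (a, 0)) ⊆ lam.cells := by
    intro x hx
    obtain ⟨a, ha, rfl⟩ := Finset.mem_image.1 hx
    exact lam.up_left_mem (Nat.lt_succ_iff.1 (Finset.mem_range.1 ha)) le_rfl hmem
  have c1 := Finset.card_le_card h1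
  rw [Finset.card_image_of_injective _ (fun a b h => (Prod.ext_iff.1 h).1),
    Finset.card_range] at c1
  have : lam.cells.card ≤ i := hi
  omega

lemma card_eq_sum_rowLen (lam : YoungDiagram) {N : ℕ} (hN : ∀ i, N ≤ i → lam.rowLen i = 0) :
    lam.card = ∑ i ∈ Finset.range N, lam.rowLen i := by
  change lam.cells.card = _
  rw [Finset.card_eq_sum_card_fiberwise (f := Prod.fst) (t := Finset.range N)]
  · exact Finset.sum_congr rfl fun i _ => (YoungDiagram.rowLen_eq_card lam).symm
  · rintro ⟨i, j⟩ h
    have h : (i, j) ∈ lam := h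
    rw [YoungDiagram.mem_iff_lt_rowLen] at h
    simp only [Finset.coe_range, Set.mem_Iio]
    by_contra hi
    rw [hN i (not_lt.1 hi)] at h
    omega

lemma Interlaces.eq_of_card {mu lam : YoungDiagram} (h : Interlaces mu lam)
    (hc : mu.card = lam.card) : mu = lam :=
  YoungDiagram.ext (Finset.eq_of_subset_of_card_le (YoungDiagram.cells_subset_iff.2 h.le)
    (le_of_eq hc)).symm

lemma interlaces_self (lam : YoungDiagram) : Interlaces lam lam :=
  fun i => ⟨le_rfl, lam.rowLen_anti _ _ (Nat.le_succ i)⟩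

/-- `mu` is obtained from `nu` by adding a box in the row `i`. -/
def AddBox (mu nu : YoungDiagram) (i : ℕ) : Prop :=
  ∀ j, mu.rowLen j = nu.rowLen j + if j = i then 1 else 0

lemma AddBox.card {mu nu : YoungDiagram} {i : ℕ} (h : AddBox mu nu i) :
    mu.card = nu.card + 1 := by
  obtain ⟨N, hN⟩ : ∃ N, N = mu.card + nu.card + i + 1 := ⟨_, rfl⟩
  rw [card_eq_sum_rowLen mu (N := N) fun j hj => rowLen_eq_zero mu (by omega),
    card_eq_sum_rowLen nu (N := N) fun j hj => rowLen_eq_zero nu (by omega),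
    Finset.sum_congr rfl fun j _ => h j, Finset.sum_add_distrib, Finset.sum_ite_eq',
    if_pos (Finset.mem_range.2 (by omega))]

lemma AddBox.interlaces {mu nu : YoungDiagram} {i : ℕ} (h : AddBox mu nu i) :
    Interlaces mu nu := by
  intro j
  have h1 := h j
  have h2 := h (j + 1)
  have h3 := mu.rowLen_anti j (j + 1) (by omega)
  have h4 := nu.rowLen_anti j (j + 1) (by omega)
  split_ifs at h1 h2 <;> omega

/-- The differences of row lengths are natural numbers with sum `1`, so exactly one of them is
nonzero. -/
lemma exists_addBox {mu nu : YoungDiagram} (h : Interlaces mu nu) (hc : mu.card = nu.card + 1) :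
    ∃ i, AddBox mu nu i := by
  have hz : ∀ j, mu.card ≤ j → nu.rowLen j = 0 := fun j hj => rowLen_eq_zero nu (by omega)
  have hs : ∑ j ∈ Finset.range mu.card, (mu.rowLen j - nu.rowLen j) = 1 := by
    have h1 := card_eq_sum_rowLen mu fun j => rowLen_eq_zero mu
    have h2 := card_eq_sum_rowLen nu hz
    have h3 : ∑ j ∈ Finset.range mu.card, (mu.rowLen j - nu.rowLen j) +
        ∑ j ∈ Finset.range mu.card, nu.rowLen j = ∑ j ∈ Finset.range mu.card, mu.rowLen j := by
      rw [← Finset.sum_add_distrib]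
      exact Finset.sum_congr rfl fun j _ => Nat.sub_add_cancel (h j).1
    omega
  obtain ⟨i, hi, hi0⟩ := Finset.exists_ne_zero_of_sum_ne_zero (hs.trans_ne one_ne_zero)
  have h4 := Finset.add_sum_erase _ (fun j => mu.rowLen j - nu.rowLen j) hi
  simp only [hs] at h4
  have h5 : ∑ j ∈ (Finset.range mu.card).erase i, (mu.rowLen j - nu.rowLen j) = 0 := by omega
  refine ⟨i, fun j => ?_⟩
  have h6 := (h j).1
  split_ifs with hj
  · subst hj; omega
  · by_cases hjN : j < mu.card
    · have := Finset.sum_eq_zero_iff.1 h5 j (Finset.mem_erase.2 ⟨hj, Finset.mem_range.2 hjN⟩)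
      omega
    · have := rowLen_eq_zero mu (not_lt.1 hjN)
      omega

lemma AddBox.row_le {mu nu : YoungDiagram} {i : ℕ} (h : AddBox mu nu i) : i ≤ nu.card := by
  by_contra hi
  have h1 := h i
  have h2 := rowLen_eq_zero mu (i := i) (by rw [h.card]; omega)
  simp only [if_true] at h1
  omega

lemma AddBox.inj_row {mu nu : YoungDiagram} {i j : ℕ} (h : AddBox mu nu i) (h' : AddBox mu nu j) :
    i = j := by
  have h1 := h i
  have h2 := h' i
  simp only [if_true] at h1
  split_ifs at h2 with hij
  · exact hij
  · omega

lemma AddBox.unique_left {mu mu' nu : YoungDiagram} {i : ℕ} (h : AddBox mu nu i)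
    (h' : AddBox mu' nu i) : mu = mu' :=
  eq_of_rowLen fun j => (h j).trans (h' j).symm

lemma AddBox.unique_right {mu nu nu' : YoungDiagram} {i : ℕ} (h : AddBox mu nu i)
    (h' : AddBox mu nu' i) : nu = nu' :=
  eq_of_rowLen fun j => Nat.add_right_cancel ((h j).symm.trans (h' j))

/-! ### Interlacing sequences with one box added or removed -/

/-- The sequences `f` and `g` interlace. -/
def IntSeq (f g : ℕ → ℕ) : Prop := ∀ i, g i ≤ f i ∧ f (i + 1) ≤ g i

lemma IntSeq.antitone_left {f g : ℕ → ℕ} (h : IntSeq f g) : Antitone f :=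
  antitone_nat_of_succ_le fun i => (h i).2.trans (h i).1

lemma IntSeq.antitone_right {f g : ℕ → ℕ} (h : IntSeq f g) : Antitone g :=
  antitone_nat_of_succ_le fun i => (h (i + 1)).1.trans (h i).2

/-- The addition of a box in the row `i`. -/
def incSeq (f : ℕ → ℕ) (i : ℕ) : ℕ → ℕ := fun j => f j + if j = i then 1 else 0

/-- The removal of a box in the row `i`. -/
def decSeq (f : ℕ → ℕ) (i : ℕ) : ℕ → ℕ := fun j => f j - if j = i then 1 else 0

lemma incSeq_self (f : ℕ → ℕ) (i : ℕ) : incSeq f i i = f i + 1 := by simp [incSeq]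

lemma incSeq_ne (f : ℕ → ℕ) {i j : ℕ} (h : j ≠ i) : incSeq f i j = f j := by simp [incSeq, h]

lemma decSeq_self (f : ℕ → ℕ) (i : ℕ) : decSeq f i i = f i - 1 := by simp [decSeq]

lemma decSeq_ne (f : ℕ → ℕ) {i j : ℕ} (h : j ≠ i) : decSeq f i j = f j := by simp [decSeq, h]

/-- Lengthening row `i` of `f` can only break the inequality between `f i` and `g (i - 1)`, which
does not exist for `i = 0`. -/
lemma intSeq_incSeq_iff {f g : ℕ → ℕ} (h : IntSeq f g) (i : ℕ) :
    IntSeq (incSeq f i) g ↔ i = 0 ∨ ∃ k, i = k + 1 ∧ f (k + 1) < g k := by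
  constructor
  · intro hi
    rcases i with _ | k
    · exact Or.inl rfl
    · have := (hi k).2
      rw [incSeq_self] at this
      exact Or.inr ⟨k, rfl, this⟩
  · intro hi j
    have h1 := h j
    refine ⟨h1.1.trans (Nat.le_add_right _ _), ?_⟩
    by_cases hj : j + 1 = i
    · subst hj
      rw [incSeq_self]
      rcases hi with hi | ⟨k, hk, hi⟩
      · omega
      · obtain rfl : j = k := by omega
        exact hi
    · rw [incSeq_ne _ hj]; exact h1.2

/-- Shortening row `i` of `g` can only break `f (i + 1) ≤ g i`. The condition is that of
`intSeq_incSeq_iff` for the row `i + 1`. -/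
lemma intSeq_decSeq_iff {f g : ℕ → ℕ} (h : IntSeq f g) (i : ℕ) :
    (1 ≤ g i ∧ IntSeq f (decSeq g i)) ↔ f (i + 1) < g i := by
  constructor
  · rintro ⟨h1, hi⟩
    have := (hi i).2
    rw [decSeq_self] at this
    omega
  · intro hi
    refine ⟨by omega, fun j => ?_⟩
    have h1 := h j
    refine ⟨(Nat.sub_le _ _).trans h1.1, ?_⟩
    by_cases hj : j = i
    · subst hj
      rw [decSeq_self]; omega
    · rw [decSeq_ne _ hj]; exact h1.2

lemma intSeq_incSeq_iff_decSeq {f g : ℕ → ℕ} (hf : Antitone f) (hg : Antitone g)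
    (h : ¬ IntSeq f g) (i : ℕ) :
    IntSeq (incSeq f i) g ↔ 1 ≤ g i ∧ IntSeq f (decSeq g i) := by
  constructor
  · intro hi
    -- If `f` and `g` do not interlace but one box in row `i` repairs this, the only defect is that
    -- `f i` is too short by one. Adding this box to `f` or removing it from `g` are then equivalent
    -- remedies.
    have h1 : g i = f i + 1 := by
      have h2 := (hi i).1
      rw [incSeq_self] at h2
      by_contra hne
      refine h fun j => ⟨?_, (Nat.le_add_right _ _).trans (hi j).2⟩
      by_cases hj : j = i
      · subst hj; omega
      · have := (hi j).1
        rwa [incSeq_ne _ hj] at this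
    refine ⟨by omega, fun j => ?_⟩
    by_cases hj : j = i
    · subst hj
      have := hf (Nat.le_succ j)
      rw [decSeq_self]
      simp only [Nat.succ_eq_add_one] at this
      omega
    · have h3 := hi j
      rw [incSeq_ne _ hj] at h3
      rw [decSeq_ne _ hj]
      exact ⟨h3.1, (Nat.le_add_right _ _).trans h3.2⟩
  · rintro ⟨hpos, hi⟩
    have h1 : g i = f i + 1 := by
      have h2 := (hi i).1
      rw [decSeq_self] at h2
      by_contra hne
      refine h fun j => ⟨?_, (hi j).2.trans (Nat.sub_le _ _)⟩
      by_cases hj : j = i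
      · subst hj; omega
      · have := (hi j).1
        rwa [decSeq_ne _ hj] at this
    intro j
    constructor
    · by_cases hj : j = i
      · subst hj
        rw [incSeq_self]; omega
      · have := (hi j).1
        rw [decSeq_ne _ hj] at this
        rwa [incSeq_ne _ hj]
    · by_cases hj : j + 1 = i
      · subst hj
        rw [incSeq_self, ← h1]
        exact hg (Nat.le_succ j)
      · rw [incSeq_ne _ hj]
        exact (hi j).2.trans (Nat.sub_le _ _)

-- When `f` and `g` interlace, the shift `i ↦ i + 1` matches removals from `g` with additions to `f`
-- outside the first row, and the addition in row `0` is the extra term. Otherwise the two sets of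
-- rows coincide.
open Classical in
lemma card_incSeq {f g : ℕ → ℕ} (hf : Antitone f) (hg : Antitone g) {N : ℕ}
    (hN : ∀ i, N ≤ i → g i = 0) :
    ((Finset.range (N + 1)).filter fun i => IntSeq (incSeq f i) g).card =
      ((Finset.range (N + 1)).filter fun i => 1 ≤ g i ∧ IntSeq f (decSeq g i)).card +
        if IntSeq f g then 1 else 0 := by
  split_ifs with h
  · have h1 : (Finset.range (N + 1)).filter (fun i => IntSeq (incSeq f i) g) =
        insert 0 (((Finset.range (N + 1)).filter fun i =>
          1 ≤ g i ∧ IntSeq f (decSeq g i)).image Nat.succ) := by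
      ext i
      simp only [Finset.mem_filter, Finset.mem_range, Finset.mem_insert, Finset.mem_image,
        intSeq_incSeq_iff h, intSeq_decSeq_iff h]
      constructor
      · rintro ⟨hi, rfl | ⟨k, rfl, hk⟩⟩
        · exact Or.inl rfl
        · exact Or.inr ⟨k, ⟨by omega, hk⟩, rfl⟩
      · rintro (rfl | ⟨k, ⟨hi, hk⟩, rfl⟩)
        · exact ⟨by omega, Or.inl rfl⟩
        · refine ⟨?_, Or.inr ⟨k, rfl, hk⟩⟩
          -- A row `k ≥ N` of `g` is empty, so it cannot satisfy `f (k + 1) < g k`.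
          by_contra hlt
          have := hN k (by omega)
          omega
    rw [h1, Finset.card_insert_of_notMem, Finset.card_image_of_injective _ Nat.succ_injective]
    intro h0
    obtain ⟨k, _, hk⟩ := Finset.mem_image.1 h0
    exact Nat.succ_ne_zero k hk
  · rw [add_zero]
    congr 1
    exact Finset.filter_congr fun i _ => intSeq_incSeq_iff_decSeq hf hg h i

/-! ### Sums over Young's lattice -/

lemma finite_card (k : ℕ) : {nu : YoungDiagram | nu.card = k}.Finite := by
  refine Set.Finite.of_finite_image (f := YoungDiagram.cells) (Set.Finite.subset
    ((Finset.range k ×ˢ Finset.range k).powerset.finite_toSet) ?_)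
    fun mu _ nu _ h => YoungDiagram.ext h
  rintro _ ⟨nu, rfl, rfl⟩
  rw [Finset.mem_coe, Finset.mem_powerset]
  rintro ⟨i, j⟩ h
  have h : (i, j) ∈ nu := h
  rw [Finset.mem_product, Finset.mem_range, Finset.mem_range]
  constructor
  · by_contra hi
    rw [YoungDiagram.mem_iff_lt_rowLen, rowLen_eq_zero nu (not_lt.1 hi)] at h
    omega
  · by_contra hj
    -- The number of columns is bounded by applying the bound on rows to the transpose.
    have h' : (j, i) ∈ nu.transpose := YoungDiagram.mem_transpose.2 h
    have hc : nu.transpose.card = nu.card := by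
      refine Finset.card_bij (fun c _ => c.swap) (fun c hc => ?_) (fun c _ c' _ hcc => ?_)
        (fun c hc => ⟨c.swap, ?_, by simp⟩)
      · exact YoungDiagram.mem_transpose.1 hc
      · exact Prod.swap_injective hcc
      · exact YoungDiagram.mem_transpose.2 (by simpa using hc)
    rw [YoungDiagram.mem_iff_lt_rowLen, rowLen_eq_zero nu.transpose (by rw [hc]; omega)] at h'
    omega

/-- The partitions of `k`. -/
def parts (k : ℕ) : Finset YoungDiagram := (finite_card k).toFinset

@[simp] lemma mem_parts {k : ℕ} {nu : YoungDiagram} : nu ∈ parts k ↔ nu.card = k := by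
  simp [parts]

/-- The partitions obtained from `lam` by removing a box. -/
def down (lam : YoungDiagram) : Finset YoungDiagram :=
  -- For the empty diagram the truncated subtraction is harmless: the condition on cardinalities
  -- leaves nothing.
  open Classical in (parts (lam.card - 1)).filter fun nu =>
    Interlaces lam nu ∧ lam.card = nu.card + 1

lemma mem_down {lam nu : YoungDiagram} :
    nu ∈ down lam ↔ Interlaces lam nu ∧ lam.card = nu.card + 1 := by
  simp only [down, Finset.mem_filter, mem_parts]
  exact ⟨fun h => h.2, fun h => ⟨by omega, h⟩⟩

/-- The partitions of `k` obtained from `lam` by adding a horizontal strip. -/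
def strips (lam : YoungDiagram) (k : ℕ) : Finset YoungDiagram :=
  open Classical in (parts k).filter fun mu => Interlaces mu lam

lemma mem_strips {lam mu : YoungDiagram} {k : ℕ} :
    mu ∈ strips lam k ↔ mu.card = k ∧ Interlaces mu lam := by
  simp [strips]

-- This is a commutation relation between adding one box and adding a horizontal strip, read off on
-- the pair `(lam, nu)`. It is `card_incSeq` for the row lengths of `nu` and `lam`, a box being
-- recorded by its row.
open Classical in
lemma card_commutation (lam nu : YoungDiagram) :
    ((strips nu (nu.card + 1)).filter fun mu => Interlaces mu lam).card =
      ((down lam).filter fun ka => Interlaces nu ka).card + if Interlaces nu lam then 1 else 0 := by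
  have hlam : ∀ i, lam.card + nu.card + 1 ≤ i → lam.rowLen i = 0 :=
    fun i hi => rowLen_eq_zero lam (by omega)
  have hnu : ∀ i, lam.card + nu.card + 1 ≤ i → nu.rowLen i = 0 :=
    fun i hi => rowLen_eq_zero nu (by omega)
  have hanti : ∀ la : YoungDiagram, Antitone la.rowLen := fun la i j h => la.rowLen_anti i j h
  -- The range of rows goes beyond all nonempty rows of both diagrams, so it contains every row
  -- where a box can be added or removed.
  have key := card_incSeq (hanti nu) (hanti lam) hlam
  have e1 : ((Finset.range (lam.card + nu.card + 1 + 1)).filter fun i =>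
      IntSeq (incSeq nu.rowLen i) lam.rowLen).card =
        ((strips nu (nu.card + 1)).filter fun mu => Interlaces mu lam).card := by
    have hadd : ∀ i ∈ (Finset.range (lam.card + nu.card + 1 + 1)).filter fun i =>
        IntSeq (incSeq nu.rowLen i) lam.rowLen, ∃ mu, AddBox mu nu i := by
      intro i hi
      rw [Finset.mem_filter, Finset.mem_range] at hi
      refine ⟨ofSeq _ hi.2.antitone_left (lam.card + nu.card + 1 + 1), rowLen_ofSeq _ _ _ ?_⟩
      intro j hj
      rw [incSeq_ne _ (by omega), hnu j (by omega)]
    choose! F hF using hadd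
    refine Finset.card_bij (fun i _ => F i) (fun i hi => ?_) (fun i hi j hj h => ?_)
      (fun mu hmu => ?_)
    · have hm := hF i hi
      refine Finset.mem_filter.2 ⟨mem_strips.2 ⟨hm.card, hm.interlaces⟩, fun j => ?_⟩
      have := (Finset.mem_filter.1 hi).2 j
      rw [hm j, hm (j + 1)]
      exact this
    · have h' := hF j hj
      rw [← h] at h'
      exact (hF i hi).inj_row h'
    · obtain ⟨h1, h2⟩ := Finset.mem_filter.1 hmu
      rw [mem_strips] at h1
      obtain ⟨i, hi⟩ := exists_addBox h1.2 h1.1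
      have hmem : i ∈ (Finset.range (lam.card + nu.card + 1 + 1)).filter fun i =>
          IntSeq (incSeq nu.rowLen i) lam.rowLen := by
        refine Finset.mem_filter.2 ⟨Finset.mem_range.2 (by have := hi.row_le; omega), fun j => ?_⟩
        have := h2 j
        rw [hi j, hi (j + 1)] at this
        exact this
      exact ⟨i, hmem, (hF i hmem).unique_left hi⟩
  have e2 : ((Finset.range (lam.card + nu.card + 1 + 1)).filter fun i =>
      1 ≤ lam.rowLen i ∧ IntSeq nu.rowLen (decSeq lam.rowLen i)).card =
        ((down lam).filter fun ka => Interlaces nu ka).card := by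
    have hadd : ∀ i ∈ (Finset.range (lam.card + nu.card + 1 + 1)).filter fun i =>
        1 ≤ lam.rowLen i ∧ IntSeq nu.rowLen (decSeq lam.rowLen i), ∃ ka, AddBox lam ka i := by
      intro i hi
      rw [Finset.mem_filter, Finset.mem_range] at hi
      refine ⟨ofSeq _ hi.2.2.antitone_right (lam.card + nu.card + 1), fun j => ?_⟩
      rw [rowLen_ofSeq]
      · by_cases hj : j = i
        · subst hj
          rw [decSeq_self, if_pos rfl]; omega
        · rw [decSeq_ne _ hj, if_neg hj, add_zero]
      · intro j hj
        have := hlam j hj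
        have := Nat.sub_le (lam.rowLen j) (if j = i then 1 else 0)
        change lam.rowLen j - _ = 0
        omega
    choose! F hF using hadd
    have hdec : ∀ {ka i}, AddBox lam ka i → ∀ j, ka.rowLen j = decSeq lam.rowLen i j := by
      intro ka i h j
      rw [decSeq, h j, Nat.add_sub_cancel]
    refine Finset.card_bij (fun i _ => F i) (fun i hi => ?_) (fun i hi j hj h => ?_)
      (fun ka hka => ?_)
    · have hm := hF i hi
      refine Finset.mem_filter.2 ⟨mem_down.2 ⟨hm.interlaces, hm.card⟩, fun j => ?_⟩
      rw [hdec hm]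
      exact (Finset.mem_filter.1 hi).2.2 j
    · have h' := hF j hj
      rw [← h] at h'
      exact (hF i hi).inj_row h'
    · obtain ⟨h1, h2⟩ := Finset.mem_filter.1 hka
      rw [mem_down] at h1
      obtain ⟨i, hi⟩ := exists_addBox h1.1 h1.2
      have hmem : i ∈ (Finset.range (lam.card + nu.card + 1 + 1)).filter fun i =>
          1 ≤ lam.rowLen i ∧ IntSeq nu.rowLen (decSeq lam.rowLen i) := by
        refine Finset.mem_filter.2 ⟨Finset.mem_range.2 ?_, ?_, fun j => ?_⟩
        · have := hi.row_le
          omega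
        · rw [hi i, if_pos rfl]; omega
        · rw [← hdec hi]; exact h2 j
      exact ⟨i, hmem, (hF i hmem).unique_right hi⟩
  rw [e1, e2] at key
  exact key

/-- A box can be removed from the last nonempty row `i`; the first empty row is `i + 1`. -/
lemma down_nonempty (mu : YoungDiagram) (h : 1 ≤ mu.card) : (down mu).Nonempty := by
  have hex : ∃ i, mu.rowLen i = 0 := ⟨_, rowLen_eq_zero mu le_rfl⟩
  obtain ⟨i, hi⟩ : ∃ i, Nat.find hex = i + 1 := by
    refine Nat.exists_eq_succ_of_ne_zero fun h0 => ?_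
    have h1 := Nat.find_spec hex
    rw [h0] at h1
    have := card_eq_sum_rowLen mu (N := 0) fun j _ => by
      have := mu.rowLen_anti 0 j (Nat.zero_le j)
      omega
    rw [Finset.range_zero, Finset.sum_empty] at this
    omega
  have h1 : mu.rowLen (i + 1) = 0 := hi ▸ Nat.find_spec hex
  have h2 : mu.rowLen i ≠ 0 := Nat.find_min hex (by omega)
  have hanti : Antitone (decSeq mu.rowLen i) := by
    refine antitone_nat_of_succ_le fun j => ?_
    by_cases hj : j = i
    · subst hj
      rw [decSeq_ne _ (by omega), h1]; omega
    · rw [decSeq_ne _ hj]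
      exact (Nat.sub_le _ _).trans (mu.rowLen_anti _ _ (Nat.le_succ j))
  have hbox : AddBox mu (ofSeq _ hanti mu.card) i := by
    intro j
    rw [rowLen_ofSeq]
    · by_cases hj : j = i
      · subst hj
        rw [decSeq_self, if_pos rfl]; omega
      · rw [decSeq_ne _ hj, if_neg hj, add_zero]
    · intro j hj
      have := rowLen_eq_zero mu hj
      change mu.rowLen j - _ = 0
      omega
  exact ⟨_, mem_down.2 ⟨hbox.interlaces, hbox.card⟩⟩

/-! ### Branching inequalities and equalities for a numerical function -/

section Sums

variable (D : YoungDiagram → ℕ)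

lemma sum_strips_self (lam : YoungDiagram) : ∑ mu ∈ strips lam lam.card, D mu = D lam := by
  have : strips lam lam.card = {lam} := by
    ext mu
    rw [mem_strips, Finset.mem_singleton]
    exact ⟨fun h => h.2.eq_of_card h.1, fun h => h ▸ ⟨rfl, interlaces_self _⟩⟩
  rw [this, Finset.sum_singleton]

/-- With `nu` as the outer variable, each `D nu` is weighted by the number of intermediate diagrams,
which `card_commutation` rewrites. -/
lemma sum_strips_down (lam : YoungDiagram) (k : ℕ) :
    ∑ mu ∈ strips lam (k + 1), ∑ nu ∈ down mu, D nu =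
      ∑ ka ∈ down lam, ∑ nu ∈ strips ka k, D nu + ∑ nu ∈ strips lam k, D nu := by
  classical
  calc _ = ∑ nu ∈ parts k, ∑ mu ∈ (strips nu (nu.card + 1)).filter (fun mu => Interlaces mu lam),
        D nu := by
        refine Finset.sum_comm' fun mu nu => ?_
        simp only [mem_strips, mem_down, mem_parts, Finset.mem_filter]
        constructor
        · rintro ⟨⟨h1, h2⟩, h3, h4⟩
          exact ⟨⟨⟨h4, h3⟩, h2⟩, by omega⟩
        · rintro ⟨⟨⟨h1, h2⟩, h3⟩, h4⟩
          exact ⟨⟨by omega, h3⟩, h2, h1⟩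
    _ = ∑ nu ∈ parts k, (∑ ka ∈ (down lam).filter (fun ka => Interlaces nu ka), D nu +
          if Interlaces nu lam then D nu else 0) := by
        refine Finset.sum_congr rfl fun nu _ => ?_
        rw [Finset.sum_const, Finset.sum_const, card_commutation, add_smul, ite_smul, one_smul,
          zero_smul]
    _ = _ := by
        rw [Finset.sum_add_distrib]
        congr 1
        · refine Finset.sum_comm' fun nu ka => ?_
          simp only [mem_strips, mem_parts, Finset.mem_filter]
          tauto
        · rw [strips, Finset.sum_filter]

variable {D}

/-- A function on Young's lattice which satisfies both branching inequalities satisfies both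
branching equalities. -/
lemma sum_down_eq (hdown : ∀ mu, ∑ nu ∈ down mu, D nu ≤ D mu)
    (hup : ∀ lam, ∑ mu ∈ strips lam (lam.card + 1), D mu ≤ (lam.card + 1) * D lam)
    (mu : YoungDiagram) (hmu : 1 ≤ mu.card) : ∑ nu ∈ down mu, D nu = D mu := by
  have step : ∀ d, (∀ lam, lam.card = d → 1 ≤ d → ∑ nu ∈ down lam, D nu = D lam) →
      (∀ ka, ka.card + 1 = d → ∑ nu ∈ strips ka d, D nu = d * D ka) →
      ∀ lam, lam.card = d → (d + 1) * D lam = ∑ mu ∈ strips lam (d + 1), ∑ nu ∈ down mu, D nu := by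
    intro d h1 h2 lam hlam
    rw [sum_strips_down, ← hlam, sum_strips_self]
    -- By `h2` each `ka` contributes `d * D ka`, and by `h1` the `D ka` sum to `D lam`. For `d = 0`
    -- there is no `ka`.
    have h3 : ∑ ka ∈ down lam, ∑ nu ∈ strips ka lam.card, D nu = lam.card * D lam := by
      rcases Nat.eq_zero_or_pos d with hd | hd
      · rw [hlam, hd, zero_mul]
        refine Finset.sum_eq_zero fun ka hka => ?_
        have := (mem_down.1 hka).2
        omega
      · rw [← h1 lam hlam hd, Finset.mul_sum]
        refine Finset.sum_congr rfl fun ka hka => ?_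
        rw [hlam]
        exact h2 ka (by rw [← hlam, (mem_down.1 hka).2])
    rw [h3, add_mul, one_mul]
  have key : ∀ d, (∀ lam, lam.card = d → 1 ≤ d → ∑ nu ∈ down lam, D nu = D lam) ∧
      (∀ ka, ka.card + 1 = d → ∑ nu ∈ strips ka d, D nu = d * D ka) := by
    intro d
    induction d with
    | zero => exact ⟨fun _ _ h => absurd h (by omega), fun _ h => absurd h (by omega)⟩
    | succ d ih =>
      -- The left side is at most `(d + 1) * D lam` by `hup`, and `step` evaluates the right side as
      -- exactly this number. As `hdown` gives the reverse inequality term by term, all terms agree.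
      have hle : ∀ lam, lam.card = d →
          ∑ mu ∈ strips lam (d + 1), D mu ≤ ∑ mu ∈ strips lam (d + 1), ∑ nu ∈ down mu, D nu := by
        intro lam hlam
        rw [← step d ih.1 ih.2 lam hlam]
        have := hup lam
        rwa [hlam] at this
      have heq : ∀ lam, lam.card = d →
          ∑ mu ∈ strips lam (d + 1), ∑ nu ∈ down mu, D nu = ∑ mu ∈ strips lam (d + 1), D mu :=
        fun lam hlam => le_antisymm (Finset.sum_le_sum fun mu _ => hdown mu) (hle lam hlam)
      refine ⟨fun mu hmu h1 => ?_, fun ka hka => ?_⟩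
      -- The termwise equality concerns diagrams lying above some `nu` of size `d`, and every
      -- nonempty `mu` of size `d + 1` is one.
      · obtain ⟨nu, hnu⟩ := down_nonempty mu (by omega)
        have hnu := mem_down.1 hnu
        exact (Finset.sum_eq_sum_iff_of_le fun mu _ => hdown mu).1 (heq nu (by omega)) mu
          (mem_strips.2 ⟨hmu, hnu.1⟩)
      · rw [← heq ka (by omega), ← step d ih.1 ih.2 ka (by omega)]
  exact (key mu.card).1 mu rfl hmu

/-- Expanding each `D mu` over `down mu` and commuting expresses the sum for `k + 1` through sums
for `k`, for `lam` and for the diagrams below it. The binomial coefficients combine by Pascal's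
rule. -/
lemma sum_strips_eq (hdown : ∀ mu, ∑ nu ∈ down mu, D nu ≤ D mu)
    (hup : ∀ lam, ∑ mu ∈ strips lam (lam.card + 1), D mu ≤ (lam.card + 1) * D lam)
    (k : ℕ) (lam : YoungDiagram) (hk : lam.card ≤ k) :
    ∑ mu ∈ strips lam k, D mu = k.choose lam.card * D lam := by
  induction k generalizing lam with
  | zero =>
    obtain h : lam.card = 0 := by omega
    have := sum_strips_self D lam
    rw [h] at this
    rw [this, h, Nat.choose_self, one_mul]
  | succ k ih =>
    rcases hk.eq_or_lt with h | h
    · rw [← h, sum_strips_self, Nat.choose_self, one_mul]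
    · have h1 : ∑ mu ∈ strips lam (k + 1), D mu =
          ∑ mu ∈ strips lam (k + 1), ∑ nu ∈ down mu, D nu :=
        Finset.sum_congr rfl fun mu hmu =>
          (sum_down_eq hdown hup mu (by rw [(mem_strips.1 hmu).1]; omega)).symm
      rw [h1, sum_strips_down, ih lam (by omega)]
      rcases hd : lam.card with _ | d
      · rw [Finset.sum_eq_zero, Nat.choose_zero_right, Nat.choose_zero_right, zero_add]
        intro ka hka
        have := (mem_down.1 hka).2
        omega
      · have h2 : ∑ ka ∈ down lam, ∑ nu ∈ strips ka k, D nu = k.choose d * D lam := by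
          rw [← sum_down_eq hdown hup lam (by omega), Finset.mul_sum]
          refine Finset.sum_congr rfl fun ka hka => ?_
          have h3 := (mem_down.1 hka).2
          rw [ih ka (by omega)]
          congr 2
          omega
        rw [h2, Nat.choose_succ_succ, add_mul]

end Sums

/-! ### Dimensions of the irreducible representations -/

/-- The dimension of the irreducible representation attached to `lam`. -/
def dimV (lam : YoungDiagram) : ℕ := Module.finrank ℂ (specht lam lam.cells.equivFin)

instance {d : ℕ} (lam : YoungDiagram) (t : lam.cells ≃ Fin d) :
    FiniteDimensional ℂ (specht lam t) :=
  inferInstanceAs (FiniteDimensional ℂ ((specht lam t).restrictScalars ℂ))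

/-- Two tableaux of the same shape differ by a relabelling `g`, and right multiplication by `g`
carries the left ideal of one injectively into that of the other. -/
lemma finrank_specht_le {d : ℕ} {lam : YoungDiagram} (t t' : lam.cells ≃ Fin d) :
    Module.finrank ℂ (specht lam t') ≤ Module.finrank ℂ (specht lam t) := by
  obtain ⟨g, rfl⟩ : ∃ g : Equiv.Perm (Fin d), t' = t.trans g :=
    ⟨t.symm.trans t', by ext; simp⟩
  let l : specht lam (t.trans g) →ₗ[ℂ] specht lam t :=
    { toFun := fun x => ⟨x * MonoidAlgebra.of ℂ _ g, by
        obtain ⟨y, hy⟩ := mem_specht.1 x.2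
        exact mem_specht.2 ⟨y * MonoidAlgebra.of ℂ _ g, by
          rw [← hy, mul_assoc, mul_assoc, young_trans]⟩⟩
      map_add' := fun x y => Subtype.ext (add_mul _ _ _)
      map_smul' := fun c x => Subtype.ext (smul_mul_assoc c (x : B d) _) }
  refine LinearMap.finrank_le_finrank_of_injective (f := l) fun x y h => Subtype.ext ?_
  have h1 : (x : B d) * MonoidAlgebra.of ℂ _ g = y * MonoidAlgebra.of ℂ _ g :=
    congrArg Subtype.val h
  have h2 := congrArg (fun z => z * MonoidAlgebra.of ℂ _ g⁻¹) h1
  simpa only [mul_assoc, ← map_mul, mul_inv_cancel, map_one, mul_one] using h2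

lemma finrank_specht {d : ℕ} {lam : YoungDiagram} (t : lam.cells ≃ Fin d) :
    Module.finrank ℂ (specht lam t) = dimV lam := by
  obtain rfl : lam.cells.card = d := by simpa using Fintype.card_congr t
  exact le_antisymm (finrank_specht_le _ _) (finrank_specht_le _ _)

/-- Restricted to `S_d`, where `|mu| = d + 1`, `V_μ` contains the sum of the `V_ν`: each is
generated by a translate of the symmetrizer of `mu`, and `eq_zero_of_sum_smul` makes the sum direct.
-/
lemma sum_dimV_down (mu : YoungDiagram) : ∑ nu ∈ down mu, dimV nu ≤ dimV mu := by
  rcases hmu : mu.card with _ | d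
  · rw [Finset.sum_eq_zero]
    · exact Nat.zero_le _
    · intro nu hnu
      have := (mem_down.1 hnu).2
      omega
  let u : mu.cells ≃ Fin (d + 1) := mu.cells.equivFinOfCardEq hmu
  have hcard : ∀ nu : down mu, nu.1.cells.card = d := fun nu => by
    have h : mu.card = nu.1.cells.card + 1 := (mem_down.1 nu.2).2
    omega
  let t : ∀ nu : down mu, nu.1.cells ≃ Fin d := fun nu => nu.1.cells.equivFinOfCardEq (hcard nu)
  -- One tableau `u` is fixed for `mu`, so that all copies lie in the same left ideal; `g` relabels
  -- it into an extension of the tableau of `nu`.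
  have hg : ∀ nu : down mu, ∃ g : Equiv.Perm (Fin (d + 1)), Extends (t nu) (u.trans g) := by
    intro nu
    obtain ⟨u', hu'⟩ := exists_extends (n := 1) (mem_down.1 nu.2).1 hmu (t nu)
    refine ⟨u.symm.trans u', ?_⟩
    convert hu'
    ext
    simp
  choose g hg using hg
  have hm : ∀ nu : down mu, blockIncl d 1 (young (t nu)) •
      (MonoidAlgebra.of ℂ _ (g nu) * young u) ≠ 0 := by
    intro nu h
    refine (hg nu).mul_blockProj_young_ne_zero (mem_down.1 nu.2).1 ?_
    have h2 : young (u.trans (g nu)) =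
        MonoidAlgebra.of ℂ _ (g nu) * young u * MonoidAlgebra.of ℂ _ (g nu)⁻¹ := by
      rw [← young_trans, mul_assoc, ← map_mul, mul_inv_cancel, map_one, mul_one]
    rw [← blockProj_incl_mul, h2, ← mul_assoc, ← smul_eq_mul (blockIncl d 1 _), h, zero_mul,
      map_zero]
  let l : (∀ nu : down mu, specht nu.1 (t nu)) →ₗ[ℂ] specht mu u :=
    { toFun := fun x => ⟨∑ nu, blockIncl d 1 (x nu) • (MonoidAlgebra.of ℂ _ (g nu) * young u),
        sum_mem fun nu _ => Submodule.smul_mem _ _ (mem_specht.2 ⟨_, rfl⟩)⟩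
      map_add' := fun x y => Subtype.ext (by
        change ∑ nu, _ = ∑ nu, _ + ∑ nu, _
        rw [← Finset.sum_add_distrib]
        refine Finset.sum_congr rfl fun nu _ => ?_
        rw [← add_smul, ← map_add]
        rfl)
      map_smul' := fun c x => Subtype.ext (by
        change ∑ nu, _ = c • ∑ nu, _
        rw [Finset.smul_sum]
        refine Finset.sum_congr rfl fun nu _ => ?_
        rw [← smul_assoc, ← map_smul]
        rfl) }
  have hl : Function.Injective l := by
    rw [injective_iff_map_eq_zero]
    intro x hx
    exact eq_zero_of_sum_smul (blockIncl d 1).toRingHom (fun nu : down mu => nu.1)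
      Subtype.val_injective t _ hm x (congrArg Subtype.val hx)
  have h := LinearMap.finrank_le_finrank_of_injective hl
  rw [Module.finrank_pi_fintype, finrank_specht] at h
  simp only [finrank_specht] at h
  rwa [Finset.sum_coe_sort (down mu) dimV] at h

/-! ### Graded modules concentrated in degree zero -/

lemma blockPerm_blockPerm {d m : ℕ} (σ : Equiv.Perm (Fin d)) :
    blockPerm (d + m) 1 (blockPerm d m σ 1) 1 = blockPerm d (m + 1) σ 1 := by
  refine Equiv.ext fun i => Fin.addCases (fun i => ?_) (fun i => ?_) i
  · rw [blockPerm_castAdd]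
    refine Fin.addCases (fun i => ?_) (fun i => ?_) i
    · rw [blockPerm_castAdd]
      exact (blockPerm_castAdd (b := m + 1) σ 1 i).symm
    · rw [blockPerm_natAdd]
      exact (blockPerm_natAdd (b := m + 1) σ 1 i.castSucc).symm
  · rw [blockPerm_natAdd]
    obtain rfl := Subsingleton.elim 0 i
    exact (blockPerm_natAdd (b := m + 1) σ 1 (Fin.last m)).symm

lemma blockIncl_blockIncl {d m : ℕ} (x : B d) :
    blockIncl (d + m) 1 (blockIncl d m x) = blockIncl d (m + 1) x := by
  induction x using MonoidAlgebra.induction_on with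
  | of σ =>
    rw [blockIncl_of]
    refine (blockIncl_of _).trans ?_
    rw [blockPerm_blockPerm]
    exact (blockIncl_of (n := m + 1) σ).symm
  | add x y hx hy => simp only [map_add, hx, hy]
  | smul c x hx => simp only [map_smul, hx]

/-- The inclusion `ℂ[S_n] → A_n`. -/
def permIncl (n : ℕ) : B n →ₐ[ℂ] A n := MonoidAlgebra.mapDomainAlgHom ℂ ℂ Wr.perm

lemma permIncl_of {n : ℕ} (σ : Equiv.Perm (Fin n)) :
    permIncl n (MonoidAlgebra.of ℂ _ σ) = MonoidAlgebra.of ℂ _ (Wr.perm σ) :=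
  MonoidAlgebra.mapDomain_single

open Classical in
lemma augment_of {n : ℕ} (w : Wr n) : augment n (MonoidAlgebra.of ℂ _ w) =
    if ∀ i, w.m i = 0 then MonoidAlgebra.of ℂ _ w.σ else 0 :=
  MonoidAlgebra.lift_of _ _

lemma augment_perm {n : ℕ} (σ : Equiv.Perm (Fin n)) :
    augment n (MonoidAlgebra.of ℂ _ (Wr.perm σ)) = MonoidAlgebra.of ℂ _ σ := by
  have h : ∀ i, (Wr.perm σ).m i = 0 := fun _ => rfl
  rw [augment_of, if_pos h]
  rfl

lemma augment_permIncl {n : ℕ} (x : B n) : augment n (permIncl n x) = x := by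
  induction x using MonoidAlgebra.induction_on with
  | of σ => rw [permIncl_of, augment_perm]
  | add x y hx hy => simp only [map_add, hx, hy]
  | smul c x hx => simp only [map_smul, hx]

lemma augment_inclL {n : ℕ} (a : A n) :
    augment (n + 1) (inclL n a) = blockIncl n 1 (augment n a) := by
  induction a using A_induction with
  | of w =>
    rw [inclL_of, augment_of, augment_of]
    by_cases h : ∀ i, w.m i = 0
    · rw [if_pos h, if_pos, blockIncl_of]
      · rfl
      · refine fun i => Fin.addCases (fun i => ?_) (fun i => ?_) i <;> simp [block, h]
    · rw [if_neg h, if_neg, map_zero]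
      intro h'
      exact h fun i => by simpa [block] using h' (Fin.castAdd 1 i)
  | add x y hx hy => simp only [map_add, hx, hy]
  | smul c x hx => simp only [map_smul, hx]

lemma augment_inclR {n : ℕ} (f : A 1) :
    augment (n + 1) (inclR n f) = algebraMap ℂ (B (n + 1)) (proj1 f) := by
  induction f using A_induction with
  | of w =>
    rw [inclR_of, augment_of]
    have hw : w.σ = 1 := Subsingleton.elim _ _
    by_cases h : w.m 0 = 0
    · rw [if_pos, proj1, MonoidAlgebra.lift_of]
      · simp [h, hw, block]
      · refine fun i => Fin.addCases (fun i => ?_) (fun i => ?_) i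
        · simp [block]
        · obtain rfl := Subsingleton.elim 0 i
          simp [block, h]
    · rw [if_neg, proj1, MonoidAlgebra.lift_of]
      · simp [h]
      · intro h'
        exact h (by simpa [block] using h' (Fin.natAdd n 0))
  | add x y hx hy => simp only [map_add, hx, hy]
  | smul c x hx => rw [map_smul, map_smul, hx, map_smul, smul_eq_mul, map_mul, Algebra.smul_def]

section Concentrated

variable {n : ℕ}

instance (M : GrMod n) : Module ℂ M := Module.compHom M (algebraMap ℂ (A n))

lemma GrMod.complex_smul_def {M : GrMod n} (c : ℂ) (x : M) : c • x = algebraMap ℂ (A n) c • x := rfl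

instance (M : GrMod n) : IsScalarTower ℂ (A n) M :=
  ⟨fun c a x => by rw [GrMod.complex_smul_def, Algebra.smul_def, mul_smul]⟩

/-- A morphism of graded modules, as a linear map over `ℂ`. -/
def GrMod.complexLin {M N : GrMod n} (f : M ⟶ N) : M →ₗ[ℂ] N where
  toFun := f.lin
  map_add' := map_add f.lin
  map_smul' c x := map_smul f.lin (algebraMap ℂ (A n) c) x

/-- The graded module `M` is concentrated in degree `0`. -/
def Concentrated (M : GrMod n) : Prop := ∀ i ≠ 0, ∀ x ∈ M.deg i, x = 0

lemma Concentrated.mem {M : GrMod n} (h : Concentrated M) (x : M) : x ∈ M.deg 0 := by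
  refine hom_induction (iSup_eq_top M.isInternal) (p := fun x => x ∈ M.deg 0) x
    (fun i x hx => ?_) fun x y hx hy => add_mem hx hy
  by_cases hi : i = 0
  · rwa [← hi]
  · rw [h i hi x hx]; exact zero_mem _

/-- A monomial of positive degree sends `M` to a zero component, so the action factors through the
group algebra. -/
lemma Concentrated.smul {M : GrMod n} (h : Concentrated M) (a : A n) (x : M) :
    a • x = permIncl n (augment n a) • x := by
  induction a using A_induction with
  | of w =>
    rw [augment_of]
    split_ifs with hw
    · rw [permIncl_of]
      congr 2
      ext i
      · exact hw i
      · rfl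
    · rw [map_zero, zero_smul]
      have h1 := M.smul_mem (of_mem_gradA w) (h.mem x)
      refine h _ (fun h0 => hw fun i => ?_) _ h1
      rw [add_zero, Wr.deg, Finset.sum_eq_zero_iff_of_nonneg fun i _ => Int.natCast_nonneg _] at h0
      exact_mod_cast h0 i (Finset.mem_univ i)
  | add a b ha hb => rw [add_smul, ha, hb, map_add, map_add, add_smul]
  | smul c a ha => rw [smul_assoc, ha, map_smul, map_smul, smul_assoc]

/-- The coset representatives have degree `0`, so the coordinates of a homogeneous element have the
same degree as that element. -/
lemma Concentrated.P {M : GrMod n} (h : Concentrated M) : Concentrated ((P n).obj M) := by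
  intro i hi y hy
  rw [← P_sum_coord y]
  refine Finset.sum_eq_zero fun l _ => ?_
  rw [h i hi (P_coord M l y) (PT.coord_mem l hy), gen_zero]

lemma Concentrated.PPow {M : GrMod n} (h : Concentrated M) (m : ℕ) :
    Concentrated ((PPow n m).obj M) := by
  induction m with
  | zero => exact h
  | succ m ih => exact ih.P

lemma concentrated_V (lam : YoungDiagram) (t : lam.cells ≃ Fin n) : Concentrated (V lam t) := by
  intro i hi x hx
  change x ∈ (if i = 0 then ⊤ else ⊥ : AddSubgroup (specht lam t)) at hx
  rw [if_neg hi] at hx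
  exact hx

end Concentrated

/-! ### The symmetrized powers of `𝔓` applied to an irreducible representation -/

/-- The idempotent `(1 / n!) ∑ σ` of the symmetric group of the last `n` indices. -/
def symEl (d n : ℕ) : A (d + n) := (n.factorial : ℂ)⁻¹ • ∑ σ, permEl d n σ

lemma permEl_eq {d n : ℕ} (τ : Equiv.Perm (Fin n)) :
    permEl d n τ = MonoidAlgebra.of ℂ _ (Wr.perm (blockPerm d n 1 τ)) := rfl

lemma permEl_mul_symEl {d n : ℕ} (τ : Equiv.Perm (Fin n)) :
    permEl d n τ * symEl d n = symEl d n := by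
  rw [symEl, mul_smul_comm, Finset.mul_sum]
  congr 1
  simp only [← map_mul]
  exact Equiv.sum_comp (Equiv.mulLeft τ) (permEl d n)

/-- The factor `τ` is absorbed by the average over `S_n`, and `σ` commutes with the permutations of
the last `n` labels. -/
lemma perm_mul_symEl {d n : ℕ} (σ : Equiv.Perm (Fin d)) (τ : Equiv.Perm (Fin n)) :
    MonoidAlgebra.of ℂ _ (Wr.perm (blockPerm d n σ τ)) * symEl d n =
      symEl d n * MonoidAlgebra.of ℂ _ (Wr.perm (blockPerm d n σ 1)) := by
  have h1 : MonoidAlgebra.of ℂ _ (Wr.perm (blockPerm d n σ τ)) =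
      MonoidAlgebra.of ℂ _ (Wr.perm (blockPerm d n σ 1)) * permEl d n τ := by
    rw [permEl_eq, ← map_mul, ← map_mul, ← blockPerm_mul, mul_one, one_mul]
  rw [h1, mul_assoc, permEl_mul_symEl, symEl, mul_smul_comm, smul_mul_assoc, Finset.mul_sum,
    Finset.sum_mul]
  congr 1
  refine Finset.sum_congr rfl fun ρ _ => ?_
  rw [permEl_eq, ← map_mul, ← map_mul, ← map_mul, ← map_mul, ← blockPerm_mul, ← blockPerm_mul]
  simp only [mul_one, one_mul]

/-- The projection ignores right multiplication by the second factor of the Young subgroup, hence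
also averaging over it. -/
lemma blockProj_mul_symEl {d n : ℕ} (x : B (d + n)) :
    blockProj d n (x * augment (d + n) (symEl d n)) = blockProj d n x := by
  have h : ∀ τ, blockProj d n (x * augment (d + n) (permEl d n τ)) = blockProj d n x := by
    intro τ
    rw [permEl_eq, augment_perm, blockProj_mul_block, map_one, mul_one]
  rw [symEl, map_smul, mul_smul_comm, map_smul, map_sum, Finset.mul_sum, map_sum,
    Finset.sum_congr rfl fun τ _ => h τ, Finset.sum_const, Finset.card_univ, Fintype.card_perm,
    Fintype.card_fin, ← Nat.cast_smul_eq_nsmul ℂ, smul_smul,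
    inv_mul_cancel₀ (Nat.cast_ne_zero.2 n.factorial_ne_zero), one_smul]

section GenPow

variable {d : ℕ} {M : GrMod d}

lemma genPow_add (m : ℕ) (b : A (d + m)) (x y : M) :
    genPow d m b (x + y) = genPow d m b x + genPow d m b y := by
  induction m with
  | zero => exact smul_add (b : A d) x y
  | succ m ih =>
    change gen b (genPow d m 1 (x + y)) = gen b _ + gen b _
    rw [ih]
    exact gen_add (M := (PPow d m).obj M) b _ _

lemma add_genPow (m : ℕ) (b c : A (d + m)) (x : M) :
    genPow d m (b + c) x = genPow d m b x + genPow d m c x := by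
  have h : ∀ b, genPow d m b x = b • genPow d m 1 x := fun b => by rw [smul_genPow, mul_one]
  rw [h, h b, h c, add_smul]

lemma genPow_smul (m : ℕ) (b : A (d + m)) (c : ℂ) (x : M) :
    genPow d m b (c • x) = c • genPow d m b x := by
  induction m with
  | zero =>
    change (b : A d) • c • x = c • (b : A d) • x
    rw [GrMod.complex_smul_def, GrMod.complex_smul_def, ← mul_smul, ← mul_smul,
      Algebra.commutes]
  | succ m ih =>
    change gen b (genPow d m 1 (c • x)) = _
    rw [ih]
    exact gen_algebraMap (M := (PPow d m).obj M) c b _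

/-- A permutation of the first `d` labels crosses the tensor signs one at a time through `inclL`. -/
lemma genPow_perm_smul (m : ℕ) (b : A (d + m)) (σ : Equiv.Perm (Fin d)) (x : M) :
    genPow d m b (MonoidAlgebra.of ℂ _ (Wr.perm σ) • x) =
      genPow d m (b * MonoidAlgebra.of ℂ _ (Wr.perm (blockPerm d m σ 1))) x := by
  have key : genPow d m 1 (MonoidAlgebra.of ℂ _ (Wr.perm σ) • x) =
      genPow d m (MonoidAlgebra.of ℂ _ (Wr.perm (blockPerm d m σ 1))) x := by
    clear b
    induction m with
    | zero =>
      have h : blockPerm d 0 σ 1 = σ := Equiv.ext fun i => blockPerm_castAdd (b := 0) σ 1 i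
      rw [h]
      exact one_smul (A d) _
    | succ m ih =>
      change gen 1 (genPow d m 1 _) = _
      rw [ih, gen_genPow, one_mul]
      refine congrArg (fun b => genPow d (m + 1) b x) ?_
      refine (inclL_of _).trans (congrArg _ ?_)
      have h := blockPerm_blockPerm (m := m) σ
      ext i
      · refine Fin.addCases (fun i => ?_) (fun i => ?_) i <;> simp [block, Wr.perm]
      · exact congrArg (fun g => (g i).val) h
  rw [← smul_genPow, ← key, smul_genPow, mul_one]

lemma symmetrizer_genPow (m : ℕ) (b : A (d + m)) (x : M) :
    ((symmetrizer d m).app M).lin (genPow d m b x) = genPow d m (b * symEl d m) x := by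
  let φ : (PPow d m ⟶ PPow d m) →ₗ[ℂ] (PPow d m).obj M :=
    { toFun := fun τ => (τ.app M).lin (genPow d m b x)
      map_add' := fun _ _ => rfl
      map_smul' := fun _ _ => rfl }
  have h1 : ((symmetrizer d m).app M).lin (genPow d m b x) = φ (symmetrizer d m) := rfl
  let χ : A (d + m) →ₗ[ℂ] (PPow d m).obj M :=
    { toFun := fun c => genPow d m c x
      map_add' := fun c c' => add_genPow m c c' x
      map_smul' := fun c a => by
        rw [RingHom.id_apply, GrMod.complex_smul_def, smul_genPow, Algebra.smul_def] }
  have h2 : genPow d m (b * symEl d m) x = χ (b * symEl d m) := rfl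
  rw [h1, h2, symmetrizer, symEl, map_smul, mul_smul_comm, map_smul, Finset.mul_sum, map_sum,
    map_sum]
  congr 1
  exact Finset.sum_congr rfl fun σ _ => permAct_genPow σ M b x

end GenPow

/-! ### The copies of `V_μ` in the image of the symmetrizer -/

section Pieri

variable {d : ℕ} {lam : YoungDiagram} (t : lam.cells ≃ Fin d)

/-- An element of `V_λ`, as an element of the group algebra. -/
def coeV : V lam t →+ B d := (specht lam t).subtype.toAddMonoidHom

/-- An element of the left ideal generated by the Young symmetrizer, as an element of `V_λ`. -/
def toV : specht lam t →ₗ[ℂ] V lam t where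
  toFun x := x
  map_add' _ _ := rfl
  map_smul' c x := by
    refine Subtype.ext ?_
    change c • (x : B d) = augment d (algebraMap ℂ (A d) c) * (x : B d)
    rw [AlgHom.commutes, ← Algebra.smul_def]

lemma coeV_smul (a : A d) (x : V lam t) : coeV t (a • x) = augment d a * coeV t x := rfl

lemma coeV_toV (x : specht lam t) : coeV t (toV t x) = x := rfl

lemma toV_surjective : Function.Surjective (toV t) := fun x => ⟨x, rfl⟩

lemma blockIncl_zero (x : B d) : blockIncl d 0 x = x := by
  induction x using MonoidAlgebra.induction_on with
  | of σ =>
    rw [blockIncl_of]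
    congr 1
    exact Equiv.ext fun i => blockPerm_castAdd (b := 0) σ 1 i
  | add x y hx hy => rw [map_add, hx, hy]
  | smul c x hx => rw [map_smul, hx]

/-- The homomorphism from `𝔓^m V_λ` to the group algebra of `S_{d+m}`. -/
lemma exists_toGroupAlgebra (m : ℕ) : ∃ ψ : (PPow d m).obj (V lam t) →+ B (d + m),
    ∀ b x, ψ (genPow d m b x) = augment (d + m) b * blockIncl d m (coeV t x) := by
  induction m with
  | zero =>
    refine ⟨coeV t, fun b x => ?_⟩
    rw [blockIncl_zero]
    exact coeV_smul t b x
  | succ m ih =>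
    obtain ⟨ψ, hψ⟩ := ih
    -- The formula on generators already makes `ψ` semilinear along `augment`; the balancing
    -- conditions of `P_addLift` at the next stage need this.
    have hlin : ∀ a y, ψ (a • y) = augment (d + m) a * ψ y := by
      intro a y
      induction y using genPow_induction with
      | gen b x => rw [smul_genPow, hψ, hψ, map_mul, mul_assoc]
      | add x y hx hy => rw [smul_add, map_add, map_add, hx, hy, mul_add]
    let h : A (d + m + 1) →+ (PPow d m).obj (V lam t) →+ B (d + m + 1) :=
      AddMonoidHom.mk' (fun b => (AddMonoidHom.mulLeft (augment (d + m + 1) b)).comp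
        ((blockIncl (d + m) 1).toRingHom.toAddMonoidHom.comp ψ)) (fun b b' => by
          ext y : 1
          change augment _ (b + b') * _ = augment _ b * _ + augment _ b' * _
          rw [map_add, add_mul])
    have happ : ∀ b y, h b y = augment (d + m + 1) b * blockIncl (d + m) 1 (ψ y) :=
      fun _ _ => rfl
    refine ⟨P_addLift (M := (PPow d m).obj (V lam t)) h (fun b a y => ?_) (fun b f y => ?_),
      fun b x => ?_⟩
    · rw [happ, happ, map_mul, augment_inclL, hlin, map_mul, mul_assoc]
    · rw [happ, happ, map_mul, augment_inclR, hlin, AlgHom.commutes, map_mul, AlgHom.commutes,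
        mul_assoc]
    · refine (P_addLift_gen (M := (PPow d m).obj (V lam t)) h _ _ b (genPow d m 1 x)).trans ?_
      rw [happ, hψ, map_one, one_mul]
      exact congrArg _ (blockIncl_blockIncl _)

variable (n : ℕ)

/-- The generator of the image of the symmetrizer. -/
def genSym : (PPow d n).obj (V lam t) :=
  genPow d n (symEl d n) (toV t ⟨young t, Submodule.mem_span_singleton_self _⟩)

lemma concentrated_PPow_V : Concentrated ((PPow d n).obj (V lam t)) := (concentrated_V lam t).PPow n

/-- If the product vanished, conjugation by `g` would make `young (u.trans g)` kill `genSym t n`,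
where `u.trans g` extends `t`. Passing to the group algebra by `exists_toGroupAlgebra` and then to
`ℂ[S_d]` by `blockProj`, which does not see the symmetrizer, this contradicts
`Extends.blockProj_young_mul_ne_zero`. -/
lemma exists_young_smul_genSym_ne_zero {mu : YoungDiagram} (u : mu.cells ≃ Fin (d + n))
    (hmu : Interlaces mu lam) : ∃ g : Equiv.Perm (Fin (d + n)),
      permIncl (d + n) (young u) • permIncl (d + n) (MonoidAlgebra.of ℂ _ g) • genSym t n ≠ 0 := by
  have hc : mu.card = d + n := by simpa using Fintype.card_congr u
  obtain ⟨u', hu'⟩ := exists_extends hmu hc t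
  obtain ⟨g, rfl⟩ : ∃ g : Equiv.Perm (Fin (d + n)), u' = u.trans g :=
    ⟨u.symm.trans u', by ext; simp⟩
  refine ⟨g⁻¹, fun h => hu'.blockProj_young_mul_ne_zero hmu ?_⟩
  have h1 : permIncl (d + n) (young (u.trans g)) • genSym t n = 0 := by
    have h2 : young (u.trans g) = MonoidAlgebra.of ℂ _ g * (young u * MonoidAlgebra.of ℂ _ g⁻¹) := by
      rw [← mul_assoc, ← young_trans, mul_assoc, ← map_mul, mul_inv_cancel, map_one, mul_one]
    rw [h2, map_mul, map_mul, mul_smul, mul_smul, h, smul_zero]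
  obtain ⟨ψ, hψ⟩ := exists_toGroupAlgebra t n
  have h3 := congrArg ψ h1
  rw [genSym, smul_genPow, hψ, map_mul, augment_permIncl, map_zero, coeV_toV] at h3
  have h4 := congrArg (blockProj d n) h3
  rwa [blockProj_mul_incl, blockProj_mul_symEl, map_zero] at h4

variable (u : ∀ mu : Interlacing lam (d + n), mu.1.cells ≃ Fin (d + n))

/-- The element which generates the copy of `V_μ` in the image of the symmetrizer. -/
def strip (mu : Interlacing lam (d + n)) : (PPow d n).obj (V lam t) :=
  permIncl (d + n) (MonoidAlgebra.of ℂ _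
    (exists_young_smul_genSym_ne_zero t n (u mu) mu.2.1).choose) • genSym t n

lemma young_smul_strip (mu : Interlacing lam (d + n)) :
    permIncl (d + n) (young (u mu)) • strip t n u mu ≠ 0 :=
  (exists_young_smul_genSym_ne_zero t n (u mu) mu.2.1).choose_spec

instance (k : ℕ) : Fintype (Interlacing lam k) := Fintype.ofFinite _

/-- The homomorphism from the sum of the `V_μ` to `𝔓^n V_λ`. -/
def stripSum : (∀ mu : Interlacing lam (d + n), specht mu.1 (u mu)) →ₗ[ℂ]
    (PPow d n).obj (V lam t) where
  toFun x := ∑ mu, permIncl (d + n) (x mu : B (d + n)) • strip t n u mu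
  map_add' x y := by
    rw [← Finset.sum_add_distrib]
    refine Finset.sum_congr rfl fun mu _ => ?_
    rw [← add_smul, ← map_add]
    rfl
  map_smul' c x := by
    rw [RingHom.id_apply, Finset.smul_sum]
    refine Finset.sum_congr rfl fun mu _ => ?_
    rw [← smul_assoc, ← map_smul]
    rfl

lemma stripSum_injective : Function.Injective (stripSum t n u) := by
  rw [injective_iff_map_eq_zero]
  intro x hx
  exact eq_zero_of_sum_smul (permIncl (d + n)).toRingHom
    (fun mu : Interlacing lam (d + n) => mu.1) Subtype.val_injective u (strip t n u)
    (young_smul_strip t n u) x hx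

/-- The symmetrizer is idempotent and `genSym t n` is one of its values, so it fixes this element
and, by linearity, everything which the element generates. -/
lemma symmetrizer_smul_strip (a : A (d + n)) (mu : Interlacing lam (d + n)) :
    ((symmetrizer d n).app (V lam t)).lin (a • strip t n u mu) = a • strip t n u mu := by
  have h : ((symmetrizer d n).app (V lam t)).lin (genSym t n) = genSym t n := by
    have h1 := congrArg (fun τ => NatTrans.app τ (V lam t)) (symmetrizer_comp d n)
    have h2 : genSym t n = ((symmetrizer d n).app (V lam t)).lin
        (genPow d n 1 (toV t ⟨young t, Submodule.mem_span_singleton_self _⟩)) := by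
      rw [symmetrizer_genPow, one_mul]
      rfl
    rw [h2]
    exact congrArg (fun f => GrMod.Hom.lin f _) h1
  rw [strip, map_smul, map_smul, h]

lemma stripSum_mem (x : ∀ mu : Interlacing lam (d + n), specht mu.1 (u mu)) :
    stripSum t n u x ∈
      LinearMap.range (GrMod.complexLin ((symmetrizer d n).app (V lam t))) := by
  refine sum_mem fun mu _ => ⟨permIncl (d + n) (x mu : B (d + n)) • strip t n u mu, ?_⟩
  exact symmetrizer_smul_strip t n u _ mu

/-! ### The dimension of the image of the symmetrizer -/

/-- The Young subgroup `S_d × S_n` of `S_{d+n}`. -/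
def youngSubgroup (d n : ℕ) : Subgroup (Equiv.Perm (Fin (d + n))) :=
  MonoidHom.range
    ({ toFun := fun p => blockPerm d n p.1 p.2
       map_one' := blockPerm_one d n
       map_mul' := fun p q => blockPerm_mul p.1 q.1 p.2 q.2 } :
      Equiv.Perm (Fin d) × Equiv.Perm (Fin n) →* Equiv.Perm (Fin (d + n)))

lemma mem_youngSubgroup {d n : ℕ} {g : Equiv.Perm (Fin (d + n))} :
    g ∈ youngSubgroup d n ↔ ∃ σ τ, blockPerm d n σ τ = g :=
  ⟨fun ⟨p, hp⟩ => ⟨p.1, p.2, hp⟩, fun ⟨σ, τ, h⟩ => ⟨(σ, τ), h⟩⟩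

lemma index_youngSubgroup (d n : ℕ) : (youngSubgroup d n).index = (d + n).choose d := by
  have h1 : Nat.card (youngSubgroup d n) = d.factorial * n.factorial := by
    rw [youngSubgroup, ← Nat.card_congr (MonoidHom.ofInjective _).toEquiv]
    · rw [Nat.card_prod, Nat.card_eq_fintype_card, Nat.card_eq_fintype_card, Fintype.card_perm,
        Fintype.card_perm, Fintype.card_fin, Fintype.card_fin]
    · intro p q h
      exact Prod.ext (blockPerm_injective h).1 (blockPerm_injective h).2
  have h2 := (youngSubgroup d n).card_mul_index
  rw [h1, Nat.card_eq_fintype_card, Fintype.card_perm, Fintype.card_fin,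
    ← Nat.add_choose_mul_factorial_mul_factorial, ← Nat.choose_symm_add] at h2
  refine Nat.eq_of_mul_eq_mul_left (Nat.mul_pos d.factorial_pos n.factorial_pos) (h2.trans ?_)
  ring

instance (d n : ℕ) : Fintype (Equiv.Perm (Fin (d + n)) ⧸ youngSubgroup d n) := Fintype.ofFinite _

/-- The homomorphism onto the image of the symmetrizer from the sum of the translates of `V_λ`. -/
def cosetSum : ((Equiv.Perm (Fin (d + n)) ⧸ youngSubgroup d n) → specht lam t) →ₗ[ℂ]
    (PPow d n).obj (V lam t) where
  toFun x := ∑ q : Equiv.Perm (Fin (d + n)) ⧸ youngSubgroup d n,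
    genPow d n (MonoidAlgebra.of ℂ _ (Wr.perm q.out) * symEl d n) (toV t (x q))
  map_add' x y := by
    rw [← Finset.sum_add_distrib]
    refine Finset.sum_congr rfl fun q _ => ?_
    rw [Pi.add_apply, map_add, genPow_add]
  map_smul' c x := by
    rw [RingHom.id_apply, Finset.smul_sum]
    refine Finset.sum_congr rfl fun q _ => ?_
    rw [Pi.smul_apply, map_smul, genPow_smul]

/-- Writing `g` as the chosen representative of its coset times an element `(σ, τ)` of the Young
subgroup, `τ` is absorbed by `symEl` and `σ` is moved into `V_λ`. -/
lemma genPow_perm_mem (g : Equiv.Perm (Fin (d + n))) (x : V lam t) :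
    genPow d n (MonoidAlgebra.of ℂ _ (Wr.perm g) * symEl d n) x ∈
      LinearMap.range (cosetSum t n) := by
  classical
  let q : Equiv.Perm (Fin (d + n)) ⧸ youngSubgroup d n := g
  obtain ⟨σ, τ, h⟩ : ∃ σ τ, blockPerm d n σ τ = q.out⁻¹ * g :=
    mem_youngSubgroup.1 (QuotientGroup.eq.1 (QuotientGroup.out_eq' q))
  obtain ⟨y, hy⟩ := toV_surjective t (MonoidAlgebra.of ℂ _ (Wr.perm σ) • x)
  refine ⟨Pi.single q y, ?_⟩
  change ∑ q', _ = _
  rw [Finset.sum_eq_single q]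
  · rw [Pi.single_eq_same, hy, genPow_perm_smul, mul_assoc, ← perm_mul_symEl σ τ, h, ← mul_assoc,
      ← map_mul, ← map_mul, mul_inv_cancel_left]
  · intro q' _ hq
    rw [Pi.single_eq_of_ne hq, map_zero, ← zero_smul ℂ (0 : V lam t), genPow_smul, zero_smul]
  · exact fun h => absurd (Finset.mem_univ q) h

/-- Since the variables act by zero, the coefficient `b` may be replaced by an element of the group
algebra, which reduces to `genPow_perm_mem`. -/
lemma range_symmetrizer_le :
    LinearMap.range (GrMod.complexLin ((symmetrizer d n).app (V lam t))) ≤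
      LinearMap.range (cosetSum t n) := by
  rintro _ ⟨y, rfl⟩
  change ((symmetrizer d n).app (V lam t)).lin y ∈ _
  induction y using genPow_induction with
  | add x y hx hy => rw [map_add]; exact add_mem hx hy
  | gen b x =>
    have h1 : genPow d n b x = genPow d n (permIncl (d + n) (augment (d + n) b)) x := by
      have h2 := (concentrated_PPow_V t n).smul b (genPow d n 1 x)
      rwa [smul_genPow, smul_genPow, mul_one, mul_one] at h2
    rw [h1]
    generalize augment (d + n) b = z
    rw [symmetrizer_genPow]
    induction z using MonoidAlgebra.induction_on with
    | of g => rw [permIncl_of]; exact genPow_perm_mem t n g x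
    | add y z hy hz => rw [map_add, add_mul, add_genPow]; exact add_mem hy hz
    | smul c z hz =>
      have h3 : genPow d n (permIncl (d + n) (c • z) * symEl d n) x =
          c • genPow d n (permIncl (d + n) z * symEl d n) x := by
        rw [map_smul, smul_mul_assoc, GrMod.complex_smul_def, smul_genPow, Algebra.smul_def]
      rw [h3]
      exact Submodule.smul_mem _ c hz

/-- There is one copy of `V_λ` for each coset of the Young subgroup. Independence of these copies is
not needed, as the lower bound from the strips will match. -/
lemma finrank_symmetrizer_le :
    Module.finrank ℂ (LinearMap.range (GrMod.complexLin ((symmetrizer d n).app (V lam t)))) ≤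
      (d + n).choose d * dimV lam := by
  refine (Submodule.finrank_mono (range_symmetrizer_le t n)).trans ?_
  refine (LinearMap.finrank_range_le _).trans (le_of_eq ?_)
  rw [Module.finrank_pi_fintype, Finset.sum_const, finrank_specht, smul_eq_mul, Finset.card_univ,
    ← Nat.card_eq_fintype_card, ← index_youngSubgroup]
  rfl

instance : FiniteDimensional ℂ ((PPow d n).obj (V lam t)) := (finDim_V lam t).PPow n

lemma finrank_stripSum : Module.finrank ℂ (LinearMap.range (stripSum t n u)) =
    ∑ mu ∈ strips lam (d + n), dimV mu := by
  rw [LinearMap.finrank_range_of_inj (stripSum_injective t n u), Module.finrank_pi_fintype]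
  simp only [finrank_specht]
  refine (Finset.sum_subtype (strips lam (d + n)) (fun mu => ?_) dimV).symm
  rw [mem_strips, and_comm]

lemma range_stripSum_le : LinearMap.range (stripSum t n u) ≤
    LinearMap.range (GrMod.complexLin ((symmetrizer d n).app (V lam t))) := by
  rintro _ ⟨x, rfl⟩
  exact stripSum_mem t n u x

end Pieri

/-- The two bounds on the image of the symmetrizer for `n = 1`, where the binomial coefficient is
`lam.card + 1`. -/
lemma sum_dimV_up (lam : YoungDiagram) :
    ∑ mu ∈ strips lam (lam.card + 1), dimV mu ≤ (lam.card + 1) * dimV lam := by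
  let t : lam.cells ≃ Fin lam.card := lam.cells.equivFin
  let u : ∀ mu : Interlacing lam (lam.card + 1), mu.1.cells ≃ Fin (lam.card + 1) :=
    fun mu => mu.1.cells.equivFinOfCardEq mu.2.2
  have h := (Submodule.finrank_mono (range_stripSum_le t 1 u)).trans (finrank_symmetrizer_le t 1)
  rwa [finrank_stripSum, Nat.choose_succ_self_right] at h

/-- One inclusion is known, and `sum_strips_eq`, fed with the two branching inequalities, makes the
dimension of the smaller space equal to the upper bound for the larger. -/
lemma range_stripSum {d : ℕ} {lam : YoungDiagram} (t : lam.cells ≃ Fin d) (n : ℕ)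
    (u : ∀ mu : Interlacing lam (d + n), mu.1.cells ≃ Fin (d + n)) :
    LinearMap.range (stripSum t n u) =
      LinearMap.range (GrMod.complexLin ((symmetrizer d n).app (V lam t))) := by
  refine Submodule.eq_of_le_of_finrank_le (range_stripSum_le t n u) ?_
  refine (finrank_symmetrizer_le t n).trans (le_of_eq ?_)
  have hd : lam.card = d := by simpa using Fintype.card_congr t
  rw [finrank_stripSum, sum_strips_eq sum_dimV_down sum_dimV_up (d + n) lam (by omega), hd]

/-! ### The symmetrizer splits over the sum of the irreducible representations -/

section Split

variable {d : ℕ} {lam : YoungDiagram} (t : lam.cells ≃ Fin d) (n : ℕ)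
  (u : ∀ mu : Interlacing lam (d + n), mu.1.cells ≃ Fin (d + n))

/-- The morphism from `V_μ` to `𝔓^n V_λ`. -/
def stripHom (mu : Interlacing lam (d + n)) : V mu.1 (u mu) ⟶ (PPow d n).obj (V lam t) where
  lin :=
    { toFun := fun x => permIncl (d + n) (coeV (u mu) x) • strip t n u mu
      map_add' := fun x y => by rw [map_add, map_add, add_smul]
      map_smul' := fun a x => by
        rw [coeV_smul, map_mul, mul_smul, ← (concentrated_PPow_V t n).smul]
        rfl }
  mem i x hx := by
    by_cases hi : i = 0
    · rw [hi]
      exact (concentrated_PPow_V t n).mem _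
    · rw [concentrated_V mu.1 (u mu) i hi x hx, map_zero]
      exact zero_mem _

/-- The morphism from the sum of the `V_μ` to `𝔓^n V_λ`. -/
def sumHom : (⨁ fun mu : Interlacing lam (d + n) => V mu.1 (u mu)) ⟶ (PPow d n).obj (V lam t) :=
  biproduct.desc (stripHom t n u)

lemma biproduct_sum {k : ℕ} {J : Type} [Fintype J] (M : J → GrMod k) (z : (⨁ M : GrMod k)) :
    z = ∑ j, (biproduct.ι M j).lin ((biproduct.π M j).lin z) := by
  have e := congrArg (fun f : (⨁ M) ⟶ (⨁ M) => f.lin z) (biproduct.total (f := M))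
  rw [GrMod.id_lin] at e
  refine e.symm.trans ?_
  let φ : ((⨁ M) ⟶ (⨁ M)) →+ (⨁ M : GrMod k) :=
    { toFun := fun f => f.lin z, map_zero' := rfl, map_add' := fun _ _ => rfl }
  exact map_sum φ _ _

lemma sumHom_ι (mu : Interlacing lam (d + n)) (x : V mu.1 (u mu)) :
    (sumHom t n u).lin ((biproduct.ι (fun mu : Interlacing lam (d + n) => V mu.1 (u mu)) mu).lin x)
      = permIncl (d + n) (coeV (u mu) x) • strip t n u mu :=
  congrArg (fun f => GrMod.Hom.lin f x) (biproduct.ι_desc (stripHom t n u) mu)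

lemma sumHom_lin (z : (⨁ fun mu : Interlacing lam (d + n) => V mu.1 (u mu) : GrMod (d + n))) :
    (sumHom t n u).lin z = stripSum t n u fun mu =>
      (biproduct.π (fun mu : Interlacing lam (d + n) => V mu.1 (u mu)) mu).lin z := by
  conv_lhs => rw [biproduct_sum _ z, map_sum]
  exact Finset.sum_congr rfl fun mu _ => sumHom_ι t n u mu _

instance : Mono (sumHom t n u) := by
  refine Preadditive.mono_of_cancel_zero _ fun {W} g hg => ?_
  refine GrMod.hom_ext fun x => ?_
  have h := congrArg (fun f => GrMod.Hom.lin f x) hg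
  change (sumHom t n u).lin (g.lin x) = 0 at h
  rw [sumHom_lin] at h
  have h0 := stripSum_injective t n u (h.trans (map_zero _).symm)
  refine (?_ : g.lin x = 0)
  rw [biproduct_sum _ (g.lin x)]
  refine Finset.sum_eq_zero fun mu _ => ?_
  have h' : (biproduct.π (fun mu : Interlacing lam (d + n) => V mu.1 (u mu)) mu).lin (g.lin x) = 0 :=
    congrFun h0 mu
  rw [h', map_zero]

lemma sumHom_symmetrizer : sumHom t n u ≫ (symmetrizer d n).app (V lam t) = sumHom t n u := by
  refine biproduct.hom_ext' _ _ fun mu => ?_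
  ext x
  change ((symmetrizer d n).app (V lam t)).lin ((sumHom t n u).lin
    ((biproduct.ι (fun mu : Interlacing lam (d + n) => V mu.1 (u mu)) mu).lin x)) =
      (sumHom t n u).lin
        ((biproduct.ι (fun mu : Interlacing lam (d + n) => V mu.1 (u mu)) mu).lin x)
  rw [sumHom_ι, symmetrizer_smul_strip]

/-- The image of the symmetrizer is the image of `sumHom`, by `range_stripSum`. In this form it lets
the symmetrizer be lifted through the monomorphism `sumHom`. -/
lemma symmetrizer_cokernel :
    (symmetrizer d n).app (V lam t) ≫ cokernel.π (sumHom t n u) = 0 := by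
  ext y
  have hy : GrMod.complexLin ((symmetrizer d n).app (V lam t)) y ∈
      LinearMap.range (stripSum t n u) := by
    rw [range_stripSum]
    exact ⟨y, rfl⟩
  obtain ⟨x, hx⟩ := hy
  have h1 : ((symmetrizer d n).app (V lam t)).lin y = (sumHom t n u).lin (∑ mu,
      (biproduct.ι (fun mu : Interlacing lam (d + n) => V mu.1 (u mu)) mu).lin
        (toV (u mu) (x mu))) := by
    rw [map_sum]
    simp only [sumHom_ι]
    exact hx.symm
  rw [GrMod.comp_lin, h1, ← GrMod.comp_lin, cokernel.condition]
  rfl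

/-- The projection of `𝔓^n V_λ` to the sum of the `V_μ`. -/
def sumProj : (PPow d n).obj (V lam t) ⟶ ⨁ fun mu : Interlacing lam (d + n) => V mu.1 (u mu) :=
  Abelian.monoLift (sumHom t n u) _ (symmetrizer_cokernel t n u)

lemma sumProj_sumHom : sumProj t n u ≫ sumHom t n u = (symmetrizer d n).app (V lam t) :=
  Abelian.monoLift_comp _ _ _

lemma sumHom_sumProj : sumHom t n u ≫ sumProj t n u = 𝟙 _ := by
  rw [← cancel_mono (sumHom t n u), Category.assoc, sumProj_sumHom, sumHom_symmetrizer,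
    Category.id_comp]

end Split

/-! ### Passage to the derived categories -/

section Derived

variable {d m : ℕ}

/-- The value of the derived functor of `𝔓^m` on a module in cohomological degree `0`. -/
def derivedSingle (M : GrMod d) :
    (PPow d m).mapDerivedCategory.obj ((DerivedCategory.singleFunctor (GrMod d) 0).obj M) ≅
      (DerivedCategory.singleFunctor (GrMod (d + m)) 0).obj ((PPow d m).obj M) :=
  (PPow d m).mapDerivedCategory.mapIso ((DerivedCategory.singleFunctorIsoCompQ _ 0).app M) ≪≫
    (PPow d m).mapDerivedCategoryFactors.app
      ((HomologicalComplex.single (GrMod d) (ComplexShape.up ℤ) 0).obj M) ≪≫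
    DerivedCategory.Q.mapIso
      ((HomologicalComplex.singleMapHomologicalComplex (PPow d m) (ComplexShape.up ℤ) 0).app M) ≪≫
    ((DerivedCategory.singleFunctorIsoCompQ _ 0).app ((PPow d m).obj M)).symm

/-- A morphism to a single complex is determined in degree `0`, where the identity is the naturality
of `τ` along the identification of the component with `M`. -/
lemma mapHomologicalComplex_single (τ : PPow d m ⟶ PPow d m) (M : GrMod d) :
    (NatTrans.mapHomologicalComplex τ (ComplexShape.up ℤ)).app
        ((HomologicalComplex.single (GrMod d) (ComplexShape.up ℤ) 0).obj M) ≫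
      (HomologicalComplex.singleMapHomologicalComplex (PPow d m) (ComplexShape.up ℤ) 0).hom.app M =
    (HomologicalComplex.singleMapHomologicalComplex (PPow d m) (ComplexShape.up ℤ) 0).hom.app M ≫
      (HomologicalComplex.single (GrMod (d + m)) (ComplexShape.up ℤ) 0).map (τ.app M) := by
  refine HomologicalComplex.to_single_hom_ext ?_
  rw [HomologicalComplex.comp_f, HomologicalComplex.comp_f,
    HomologicalComplex.singleMapHomologicalComplex_hom_app_self,
    HomologicalComplex.single_map_f_self]
  have h {X : GrMod d} {Y : GrMod (d + m)} (e : X ⟶ M) (e' : Y ≅ (PPow d m).obj M) :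
      τ.app X ≫ (PPow d m).map e ≫ e'.inv =
        ((PPow d m).map e ≫ e'.inv) ≫ e'.hom ≫ τ.app M ≫ e'.inv := by
    rw [Category.assoc, Iso.inv_hom_id_assoc, τ.naturality_assoc]
  exact h _ _

lemma derivedHom_Q (τ : PPow d m ⟶ PPow d m) (K : CochainComplex (GrMod d) ℤ) :
    (derivedHom τ).app (DerivedCategory.Q.obj K) ≫
        (PPow d m).mapDerivedCategoryFactors.hom.app K =
      (PPow d m).mapDerivedCategoryFactors.hom.app K ≫
        DerivedCategory.Q.map ((NatTrans.mapHomologicalComplex τ _).app K) := by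
  have h := Localization.liftNatTrans_app DerivedCategory.Q
    (HomologicalComplex.quasiIso (GrMod d) (ComplexShape.up ℤ))
    ((PPow d m).mapHomologicalComplex _ ⋙ DerivedCategory.Q)
    ((PPow d m).mapHomologicalComplex _ ⋙ DerivedCategory.Q)
    (PPow d m).mapDerivedCategory (PPow d m).mapDerivedCategory
    (Functor.whiskerRight (NatTrans.mapHomologicalComplex τ _) DerivedCategory.Q) K
  rw [derivedHom, h, Category.assoc, Category.assoc]
  -- The isomorphism implicit in the localization instance is by definition the comparison
  -- isomorphism of the derived functor.
  have h2 : (Localization.Lifting.iso DerivedCategory.Q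
      (HomologicalComplex.quasiIso (GrMod d) (ComplexShape.up ℤ))
      ((PPow d m).mapHomologicalComplex _ ⋙ DerivedCategory.Q)
      (PPow d m).mapDerivedCategory) = (PPow d m).mapDerivedCategoryFactors := rfl
  rw [h2, Iso.inv_hom_id_app]
  exact congrArg _ (Category.comp_id _)

lemma derivedSingle_hom (M : GrMod d) :
    (derivedSingle (m := m) M).hom =
      (PPow d m).mapDerivedCategory.map
          ((DerivedCategory.singleFunctorIsoCompQ (GrMod d) 0).hom.app M) ≫
        (PPow d m).mapDerivedCategoryFactors.hom.app
            ((HomologicalComplex.single (GrMod d) (ComplexShape.up ℤ) 0).obj M) ≫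
          DerivedCategory.Q.map ((HomologicalComplex.singleMapHomologicalComplex (PPow d m)
              (ComplexShape.up ℤ) 0).hom.app M) ≫
            (DerivedCategory.singleFunctorIsoCompQ (GrMod (d + m)) 0).inv.app
              ((PPow d m).obj M) := rfl

/-- The three comparisons making up `derivedSingle` are compatible with `τ` one after the other.
Thus a splitting of `τ.app M` among modules gives a splitting of the derived endomorphism. -/
lemma derivedHom_single (τ : PPow d m ⟶ PPow d m) (M : GrMod d) :
    (derivedHom τ).app ((DerivedCategory.singleFunctor (GrMod d) 0).obj M) ≫
        (derivedSingle M).hom =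
      (derivedSingle M).hom ≫
        (DerivedCategory.singleFunctor (GrMod (d + m)) 0).map (τ.app M) := by
  have h1 := (derivedHom τ).naturality ((DerivedCategory.singleFunctorIsoCompQ _ 0).hom.app M)
  have h2 := derivedHom_Q τ ((HomologicalComplex.single (GrMod d) (ComplexShape.up ℤ) 0).obj M)
  have h3 := congrArg (fun f => DerivedCategory.Q.map f) (mapHomologicalComplex_single τ M)
  have h4 := (DerivedCategory.singleFunctorIsoCompQ (GrMod (d + m)) 0).inv.naturality (τ.app M)
  simp only [Functor.map_comp] at h3
  rw [derivedSingle_hom]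
  rw [← reassoc_of% h1]
  erw [reassoc_of% h2, reassoc_of% h3, h4]
  simp only [Category.assoc]
  refine congrArg (_ ≫ ·) ?_
  exact ((Category.assoc _ _ _).trans (congrArg (_ ≫ ·) (Category.assoc _ _ _))).symm

end Derived

/-- The coefficients of `j(Γ̃₋(z)) V_λ` are the sums of the `V_μ` over the interlacing `μ`. -/
theorem nonempty_gammaMinus_iso {d : ℕ} (lam : YoungDiagram) (t : lam.cells ≃ Fin d)
    (u : ∀ (n : ℕ) (mu : Interlacing lam (d + n)), mu.1.cells ≃ Fin (d + n)) :
    Nonempty ((gammaMinus d).obj (single (V lam t) (finDim_V lam t)) ≅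
      fun n : ℕ => (Idempotents.toKaroubi (D (d + n))).obj (sumV lam (d + n) (u n))) := by
  refine ⟨Pi.isoMk fun n => ?_⟩
  let X := single (V lam t) (finDim_V lam t)
  let S := DerivedCategory.singleFunctor (GrMod (d + n)) 0
  -- The section and the retraction of the splitting among graded modules, transported along
  -- `derivedSingle`.
  let i : sumV lam (d + n) (u n) ⟶ (DPow d n).obj X :=
    ObjectProperty.homMk (S.map (sumHom t n (u n)) ≫ (derivedSingle (V lam t)).inv)
  let r : (DPow d n).obj X ⟶ sumV lam (d + n) (u n) :=
    ObjectProperty.homMk ((derivedSingle (V lam t)).hom ≫ S.map (sumProj t n (u n)))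
  let p : (DPow d n).obj X ⟶ (DPow d n).obj X := (DHom (symmetrizer d n)).app X
  have hir : i ≫ r = 𝟙 _ := by
    refine ObjectProperty.hom_ext _ ?_
    change (S.map _ ≫ (derivedSingle (V lam t)).inv) ≫ (derivedSingle (V lam t)).hom ≫ S.map _ = 𝟙 _
    rw [Category.assoc, Iso.inv_hom_id_assoc, ← Functor.map_comp, sumHom_sumProj,
      CategoryTheory.Functor.map_id]
  have hri : r ≫ i = p := by
    refine ObjectProperty.hom_ext _ ?_
    change ((derivedSingle (V lam t)).hom ≫ S.map _) ≫ S.map _ ≫ (derivedSingle (V lam t)).inv =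
      (derivedHom (symmetrizer d n)).app _
    rw [Category.assoc, ← Functor.map_comp_assoc, sumProj_sumHom, ← Category.assoc,
      Iso.comp_inv_eq]
    exact (derivedHom_single _ _).symm
  have hpr : p ≫ r = r := by rw [← hri, Category.assoc, hir, Category.comp_id]
  have hip : i ≫ p = i := by rw [← hri, ← Category.assoc, hir, Category.id_comp]
  -- The identity of `(X, p)` in the Karoubi envelope is `p` itself, so `r ≫ i = p` and `i ≫ r = 𝟙`
  -- say that `r` and `i` are mutually inverse there.
  exact
    { hom := ⟨r, by
        change p ≫ r ≫ 𝟙 _ = r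
        rw [Category.comp_id, hpr]⟩
      inv := ⟨i, by
        change 𝟙 _ ≫ i ≫ p = i
        rw [Category.id_comp, hip]⟩
      hom_inv_id := Idempotents.Karoubi.hom_ext _ _ hri
      inv_hom_id := Idempotents.Karoubi.hom_ext _ _ hir }

end Fock

end

theorem mainTheorem8 {d : ℕ} (lam : YoungDiagram) (t : lam.cells ≃ Fin d)
    (u : ∀ (n : ℕ) (mu : Fock.Interlacing lam (d + n)), mu.1.cells ≃ Fin (d + n)) :
    Nonempty ((Fock.gammaMinus d).obj (Fock.single (Fock.V lam t) (Fock.finDim_V lam t)) ≅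
      fun n : ℕ => (Idempotents.toKaroubi (Fock.D (d + n))).obj (Fock.sumV lam (d + n) (u n))) :=
  Fock.nonempty_gammaMinus_iso lam t u
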